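/- **Setting.** There are $M\ge1$ agents, a server and $K\ge 1$ arms with contexts $x_1,\dots,x_K\in\mathbb R^d$ ($d\ge1$), $\|x_k\|_2\le1$, and an unknown $\theta^*\in\mathbb R^d$ with $\|\theta^*\|_2\le1$. In round $t=1,2,\dots$ one agent $m_t$ is active (chosen arbitrarily, possibly depending on the past), pulls an arm $k_t$ and receives $r_t=x_{k_t}^\top\theta^*+\eta_t$. The noise is conditionally $\sigma$-sub-Gaussian, $\sigma>0$: $\mathbb E[e^{s\eta_t}\mid\mathcal F_{t-1}]\le e^{\sigma^2s^2/2}$ for all $s\in\mathbb R$, where $\mathcal F_{t-1}$ contains the past noise and $m_1,\dots,m_t$. Write $y(i,j)=x_i-x_j$, $\Delta(i,j)=y(i,j)^\top\theta^*$, and let $k^*$ be a best arm. Let $\rho(y)$ be the minimum of $\sum_k w_k^2/p_k$ over $w\in\mathbb R^K$ and probability vectors $p$ with $y=\sum_kw_kx_k$ and $w_k=0$ whenever $p_k=0$ (such terms count as $0$); let $p^*(y)$ be an optimal $p$ (any fixed choice). For $\epsilon>0$ put $$H^L_\epsilon=\sum_{k=1}^K\max_{i,j}\frac{\rho(y(i,j))\,p^*_k(y(i,j))}{\max\big(\frac{\Delta(k^*,i)+\epsilon}3,\frac{\Delta(k^*,j)+\epsilon}3,\epsilon\big)^2}.$$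 **Algorithm FALinPE**, with inputs $\epsilon>0$, $\delta\in(0,1)$, $\lambda,\gamma_1,\gamma_2>0$. A data set is a triple $(V,b,T)$ (covariance matrix, sum of rewards times contexts, arm counts). From $(V,b,T)$ compute $\hat\theta=V^{-1}b$, $\hat\Delta(i,j)=y(i,j)^\top\hat\theta$, $$\alpha(i,j)=\Big(\sqrt\lambda+(\sqrt{2\gamma_1}M+\sqrt{1+\gamma_1M})\,\sigma\sqrt{d\log\big(\tfrac2\delta\big(1+\tfrac{(1+\gamma_2M)\sum_kT(k)}{\min(\gamma_1,1)\lambda}\big)\big)}\Big)\|y(i,j)\|_{V^{-1}},$$ $\hat i\in\arg\max_kx_k^\top\hat\theta$, $\hat j\in\arg\max_j\big(\hat\Delta(j,\hat i)+\alpha(\hat i,j)\big)$ and $B=\hat\Delta(\hat j,\hat i)+\alpha(\hat i,\hat j)$ (ties are broken by any fixed measurable rules). In rounds $1,\dots,K$ every arm is pulled once; the server and all agents then hold these data, with $V=\lambda I+\sum_kx_kx_k^\top$. In every later round the active agent $m$, with downloaded data $(V_m,b_m,T_m)$, pulls an arm minimizing $T_m(k)/p^*_k(y(\hat i,\hat j))$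 over the $k$ with $p^*_k(y(\hat i,\hat j))>0$, and adds the observation to its unsent data $(V^{loc}_m,b^{loc}_m,T^{loc}_m)$. If $$\det(V_m+V_m^{loc})>(1+\gamma_1)\det V_m\quad\text{or}\quad\sum_k\big(T_m(k)+T^{loc}_m(k)\big)>(1+\gamma_2)\sum_kT_m(k),$$ it uploads the unsent data; the server adds them to its own and, if now $B\le\epsilon$ for the server's data, the algorithm stops and returns $\hat k^*=\hat i$ (of the server); otherwise the agent downloads the server's data and its unsent data are reset to zero. Let $\tau$ be the total number of rounds until the stop ($\tau=\infty$ if there is none), and let the communication cost $\mathcal C(\tau)$ be twice the number of communications in the rounds $K+1,\dots,\tau$. **Theorem.** Let $\gamma_1=1/M^2$, $\gamma_2=1/(2MK)$ and $0<\lambda\le\sigma^2(\sqrt{1+\gamma_1M}+\sqrt{2\gamma_1}M)^2\log(2/\delta)$. Put $$A=\frac{1+\gamma_2M}{1-\gamma_2KM}\Big(\sqrt2+\sqrt{1+\tfrac1M}\Big)^2H^L_\epsilon\,4\sigma^2d,\qquad\Gamma=A\log\frac2\delta+\frac{1+\gamma_2M}{1-\gamma_2KM}K(M+1),$$ $$\Lambda=A\sqrt{1+\frac{1+1/(2K)}{\lambda/M^2}}+\Gamma,\qquad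 U=A\log\Big(1+\frac{(1+1/(2K))\Lambda^2}{\lambda/M^2}\Big)+\Gamma .$$ 1. With probability at least $1-\delta$, all of the following hold: the algorithm stops, the returned arm is $\epsilon$-optimal, $\Delta(k^*,\hat k^*)\le\epsilon$; the sample complexity satisfies $\tau\le U$; and the communication cost satisfies $$\mathcal C(\tau)\le 4\max(2MK,M^2)\Big(d\log_2\Big(1+\frac{U}{\lambda d}\Big)+\log_2U\Big),$$ that is, $\mathcal C(\tau)=O(\max(2MK,M^2))$ up to the factor $d$ and logarithmic factors. 2. On every sample path on which the algorithm stops, $$\mathcal C(\tau)\le2\Big((M+1/\gamma_1)\,d\log_2\Big(1+\frac\tau{\lambda d}\Big)+(M+1/\gamma_2)\log_2\tau\Big).$$ -/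

import Mathlib

open MeasureTheory ProbabilityTheory
open scoped Matrix

noncomputable section

namespace FedLin

/-! ### Optimal allocation and problem complexity -/

/-- `(w, p)` is feasible for the design program of the direction `y`: `y = ∑ k, w k • x k`, `p` is a
probability vector on the arms, and no weight sits on an arm of probability zero. -/
def IsFeasible {K d : ℕ} (x : Fin K → Fin d → ℝ) (y : Fin d → ℝ) (w p : Fin K → ℝ) : Prop :=
  y = ∑ k, w k • x k ∧ ∑ k, p k = 1 ∧ (∀ k, 0 ≤ p k) ∧ ∀ k, p k = 0 → w k = 0

/-- The objective `∑ k, w k ^ 2 / p k`; terms with `p k = 0` (hence `w k = 0`) count as zero. -/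
def designCost {K : ℕ} (w p : Fin K → ℝ) : ℝ := ∑ k, w k ^ 2 / p k

/-- `ρ(y)`, the optimal value of the design program. -/
def rho {K d : ℕ} (x : Fin K → Fin d → ℝ) (y : Fin d → ℝ) : ℝ :=
  sInf {c | ∃ w p : Fin K → ℝ, IsFeasible x y w p ∧ c = designCost w p}

/-- `p` is an optimal allocation `p*(y)`: together with some weights it attains `ρ(y)`. -/
def IsOptimalAllocation {K d : ℕ} (x : Fin K → Fin d → ℝ) (y : Fin d → ℝ) (p : Fin K → ℝ) : Prop :=
  ∃ w : Fin K → ℝ, IsFeasible x y w p ∧ designCost w p = rho x y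

/-! ### Rules for the ties -/

/-- A (measurable) rule which picks a maximizer of any score vector. -/
def IsArgmaxRule {K : ℕ} (f : (Fin K → ℝ) → Fin K) : Prop :=
  Measurable f ∧ ∀ (v : Fin K → ℝ) (k : Fin K), v k ≤ v (f v)

/-- A rule which, for a pair `(i, j)` and counts `T`, picks a minimizer of `T k / p i j k` among the
arms `k` with `p i j k > 0`. -/
def IsAllocationRule {K : ℕ} (p : Fin K → Fin K → Fin K → ℝ)
    (f : Fin K → Fin K → (Fin K → ℕ) → Fin K) : Prop :=
  ∀ i j T, 0 < p i j (f i j T) ∧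
    ∀ k, 0 < p i j k → (T (f i j T) : ℝ) / p i j (f i j T) ≤ (T k : ℝ) / p i j k

/-! ### Data -/

/-- Sufficient statistics: a covariance matrix, a reward-weighted sum of contexts, arm counts. -/
structure Stats (K d : ℕ) where
  V : Matrix (Fin d) (Fin d) ℝ
  b : Fin d → ℝ
  T : Fin K → ℕ

/-- Pooling of data. -/
def Stats.add {K d : ℕ} (S S' : Stats K d) : Stats K d :=
  ⟨S.V + S'.V, S.b + S'.b, S.T + S'.T⟩

/-- No data. -/
def Stats.empty (K d : ℕ) : Stats K d := ⟨0, 0, 0⟩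

/-- The data of the whole system: `server` has been uploaded, `agent m` is what agent `m` last
downloaded, `loc m` is what agent `m` has collected and not yet uploaded. -/
structure State (M K d : ℕ) where
  server : Stats K d
  agent : Fin M → Stats K d
  loc : Fin M → Stats K d

/-- A linear bandit instance with the inputs of the algorithm: contexts `x`, unknown parameter
`theta`, noise level `sigma`, accuracy `eps`, confidence `delta`, regularization `lam`, trigger
parameters `gamma1`, `gamma2`, allocations `p`, and the rules used for `argmax` and `argmin`. -/
structure Spec (M K d : ℕ) where
  x : Fin K → Fin d → ℝ
  theta : Fin d → ℝ
  sigma : ℝ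
  eps : ℝ
  delta : ℝ
  lam : ℝ
  gamma1 : ℝ
  gamma2 : ℝ
  p : Fin K → Fin K → Fin K → ℝ
  bestRule : (Fin K → ℝ) → Fin K
  challengerRule : (Fin K → ℝ) → Fin K
  armRule : Fin K → Fin K → (Fin K → ℕ) → Fin K

namespace Spec

variable {M K d : ℕ}

/-- The context difference `y(i, j)`. -/
def y (P : Spec M K d) (i j : Fin K) : Fin d → ℝ := P.x i - P.x j

/-- The expected reward gap `Δ(i, j)`. -/
def gap (P : Spec M K d) (i j : Fin K) : ℝ := P.y i j ⬝ᵥ P.theta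

/-- The problem complexity `H_ε`; `kstar` is a best arm. -/
def complexity (P : Spec M K d) (kstar : Fin K) : ℝ :=
  ∑ k, ⨆ ij : Fin K × Fin K, rho P.x (P.y ij.1 ij.2) * P.p ij.1 ij.2 k /
    max (max ((P.gap kstar ij.1 + P.eps) / 3) ((P.gap kstar ij.2 + P.eps) / 3)) P.eps ^ 2

/-! #### What the server or an agent computes from its data -/

/-- The ridge estimator. -/
def thetaHat (_P : Spec M K d) (S : Stats K d) : Fin d → ℝ := S.V⁻¹ *ᵥ S.b

/-- The estimated gap. -/
def gapHat (P : Spec M K d) (S : Stats K d) (i j : Fin K) : ℝ := P.y i j ⬝ᵥ P.thetaHat S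

/-- The confidence radius. -/
def radius (P : Spec M K d) (S : Stats K d) : ℝ :=
  √P.lam + (√(2 * P.gamma1) * M + √(1 + P.gamma1 * M)) *
    (P.sigma * √(d * Real.log (2 / P.delta *
      (1 + (1 + P.gamma2 * M) * (∑ k, (S.T k : ℝ)) / (min P.gamma1 1 * P.lam)))))

/-- The exploration bonus `α(i, j)`. -/
def bonus (P : Spec M K d) (S : Stats K d) (i j : Fin K) : ℝ :=
  P.radius S * √(P.y i j ⬝ᵥ (S.V⁻¹ *ᵥ P.y i j))

/-- The empirically best arm. -/
def best (P : Spec M K d) (S : Stats K d) : Fin K := P.bestRule fun k => P.x k ⬝ᵥ P.thetaHat S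

/-- The most ambiguous arm. -/
def challenger (P : Spec M K d) (S : Stats K d) : Fin K :=
  P.challengerRule fun j => P.gapHat S j (P.best S) + P.bonus S (P.best S) j

/-- The breaking index `B`. -/
def breakIndex (P : Spec M K d) (S : Stats K d) : ℝ :=
  P.gapHat S (P.challenger S) (P.best S) + P.bonus S (P.best S) (P.challenger S)

/-- The arm which an agent with downloaded data `S` pulls. -/
def pull (P : Spec M K d) (S : Stats K d) : Fin K := P.armRule (P.best S) (P.challenger S) S.T

/-! #### The algorithm -/

/-- The data of one pull of arm `k` with the given noise. -/
def obs (P : Spec M K d) (k : Fin K) (noise : ℝ) : Stats K d :=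
  ⟨Matrix.vecMulVec (P.x k) (P.x k), (P.x k ⬝ᵥ P.theta + noise) • P.x k, Pi.single k 1⟩

/-- The state after the first `K` rounds, in which every arm is pulled once: everyone holds the
resulting data, and nothing is waiting for upload. -/
def init (P : Spec M K d) (noise : ℕ → ℝ) : State M K d :=
  let S : Stats K d :=
    ⟨P.lam • (1 : Matrix (Fin d) (Fin d) ℝ) + ∑ k, (P.obs k (noise k)).V,
      ∑ k, (P.obs k (noise k)).b, ∑ k, (P.obs k (noise k)).T⟩
  ⟨S, fun _ => S, fun _ => Stats.empty K d⟩

/-- The unsent data of the active agent `a` after its pull in the current round. -/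
def newLoc (P : Spec M K d) (s : State M K d) (a : Fin M) (noise : ℝ) : Stats K d :=
  (s.loc a).add (P.obs (P.pull (s.agent a)) noise)

/-- The hybrid event trigger for downloaded data `S` and unsent data `L`. -/
def Trigger (P : Spec M K d) (S L : Stats K d) : Prop :=
  (1 + P.gamma1) * S.V.det < (S.V + L.V).det ∨
    (1 + P.gamma2) * (∑ k, (S.T k : ℝ)) < ∑ k, ((S.T k : ℝ) + (L.T k : ℝ))

open Classical in
/-- One round in which agent `a` is active. If the trigger fires, `a` uploads its unsent data and
downloads the updated data of the server. -/
def step (P : Spec M K d) (s : State M K d) (a : Fin M) (noise : ℝ) : State M K d :=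
  let L := P.newLoc s a noise
  if P.Trigger (s.agent a) L then
    ⟨s.server.add L, Function.update s.agent a (s.server.add L),
      Function.update s.loc a (Stats.empty K d)⟩
  else
    ⟨s.server, s.agent, Function.update s.loc a L⟩

/-- The state after `K + n` rounds. Rounds are numbered from `0`: `act t` is the active agent and
`noise t` the reward noise of round `t`. -/
def run (P : Spec M K d) (act : ℕ → Fin M) (noise : ℕ → ℝ) : ℕ → State M K d
  | 0 => P.init noise
  | n + 1 => P.step (run P act noise n) (act (K + n)) (noise (K + n))

/-- The active agent communicates with the server in round `K + n`. -/
def Communicates (P : Spec M K d) (act : ℕ → Fin M) (noise : ℕ → ℝ) (n : ℕ) : Prop :=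
  P.Trigger ((P.run act noise n).agent (act (K + n)))
    (P.newLoc (P.run act noise n) (act (K + n)) (noise (K + n)))

/-- In round `K + n` there is a communication, after which the breaking condition holds. -/
def Breaks (P : Spec M K d) (act : ℕ → Fin M) (noise : ℕ → ℝ) (n : ℕ) : Prop :=
  P.Communicates act noise n ∧ P.breakIndex (P.run act noise (n + 1)).server ≤ P.eps

/-- The algorithm terminates in round `K + n`, that is, after `K + n + 1` rounds. -/
def Terminates (P : Spec M K d) (act : ℕ → Fin M) (noise : ℕ → ℝ) (n : ℕ) : Prop :=
  P.Breaks act noise n ∧ ∀ l < n, ¬ P.Breaks act noise l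

/-- The arm returned when the algorithm terminates in round `K + n`. -/
def output (P : Spec M K d) (act : ℕ → Fin M) (noise : ℕ → ℝ) (n : ℕ) : Fin K :=
  P.best (P.run act noise (n + 1)).server

open Classical in
/-- The communication cost up to and including round `K + n`: one upload and one download for every
communication. -/
def commCost (P : Spec M K d) (act : ℕ → Fin M) (noise : ℕ → ℝ) (n : ℕ) : ℕ :=
  2 * ((Finset.range (n + 1)).filter fun l => P.Communicates act noise l).card

/-! #### The explicit bound on the sample complexity -/

/-- The factor `(1 + γ₂ M) / (1 - γ₂ K M) · (√2 + √(1 + 1 / M))² · H · 4 σ² d`. -/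
def boundFactor (P : Spec M K d) (kstar : Fin K) : ℝ :=
  (1 + P.gamma2 * M) / (1 - P.gamma2 * K * M) * (√2 + √(1 + 1 / (M : ℝ))) ^ 2 *
    P.complexity kstar * (4 * P.sigma ^ 2 * d)

/-- The term `Γ`: the contribution of `log (2 / δ)`, and that of the `K` initial pulls and of the
rounding of the batch sizes. -/
def boundGamma (P : Spec M K d) (kstar : Fin K) : ℝ :=
  P.boundFactor kstar * Real.log (2 / P.delta) +
    (1 + P.gamma2 * M) / (1 - P.gamma2 * K * M) * (K * (M + 1))

/-- The term `Λ`. -/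
def boundLambda (P : Spec M K d) (kstar : Fin K) : ℝ :=
  P.boundFactor kstar * √(1 + (1 + 1 / (2 * (K : ℝ))) / (P.lam / (M : ℝ) ^ 2)) +
    P.boundGamma kstar

/-- The bound on the sample complexity. -/
def sampleBound (P : Spec M K d) (kstar : Fin K) : ℝ :=
  P.boundFactor kstar *
    Real.log (1 + (1 + 1 / (2 * (K : ℝ))) * P.boundLambda kstar ^ 2 / (P.lam / (M : ℝ) ^ 2)) +
  P.boundGamma kstar

end Spec

/-- Conditionally `σ`-sub-Gaussian noise: `η t` is revealed after the information `ℱ t`, and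
`𝔼[exp (s η t) | ℱ t] ≤ exp (σ² s² / 2)` for all real `s`. -/
def IsCondSubGaussian {Ω : Type*} {mΩ : MeasurableSpace Ω} (μ : Measure Ω)
    (ℱ : Filtration ℕ mΩ) (η : ℕ → Ω → ℝ) (sigma : ℝ) : Prop :=
  ∀ t, Measurable[ℱ (t + 1)] (η t) ∧ ∀ s : ℝ,
    Integrable (fun ω => Real.exp (s * η t ω)) μ ∧
      μ[fun ω => Real.exp (s * η t ω) | ℱ t] ≤ᵐ[μ] fun _ => Real.exp (sigma ^ 2 * s ^ 2 / 2)

end FedLin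

end

/-!
# Federated pure exploration in linear bandits

**Communication.** Give every state of the system the potential
`1 / γ * log₂ f (server) + ∑ m, log₂ f (snapshot of m)`, once with `f` the determinant of the covariance matrix and `γ = γ₁`, and
once with `f` the number of observations and `γ = γ₂`. A trigger of agent `m` says that `f` grows
by at least `γ f (snapshot of m)` through the upload; for the determinant at the server this uses
its supermodularity. Either the snapshot is recent, and the server gains, or it is old, and the
agent gains by the download: `potential_communication` shows that each communication increases the
sum of the potentials by at least one. The growth of the determinant bounds the potentials by the
logarithm of the number of rounds (`commCost_le`).

**Confidence.** Which data reach the server depends on the noise, through the triggers and the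
pulls, so the noise sum of the server is not a martingale. It is the noise sum of all data minus
that of the unsent data. For all data, the mixture of the exponential martingales over a Gaussian
prior is a supermartingale (`lintegral_mul_mixture_add_le`). For the unsent data of an agent such a
mixture has to be restarted at each communication. To avoid a union bound over the restarts, the
mixture gets a small weight and is added to a decreasing function of the number of observations,
whose decrease until the next communication pays for the weight of the next mixture
(`factor_reset_le`). The product of these factors over the agents is again a supermartingale.
Ville's inequality, at level `2 / δ` for both supermartingales, gives an event of probability at
least `1 - δ` (`measure_good_ge`) on which the confidence radius is valid for the data of the
server right after every communication (`abs_dotProduct_thetaHat_sub_le`). What makes the radius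
sufficient is the numerical inequality `radius_inequality`.

**Sample complexity.** With a valid radius, the breaking index bounds the suboptimality of the
empirically best arm, and as long as it exceeds `ε`, the bonus of the compared pair of arms is at
least its threshold in the problem complexity. The allocation rule keeps
`‖y‖²_{V⁻¹} ≤ ρ(y) p_k / T(k)` for the arm `k` about to be pulled, so `T(k)` is at most the squared radius times the
contribution of `k` to the complexity (`Confident.count_pull_le`). The server can exceed this bound
only through one late upload per agent (`Bounded.step`). Summing over the arms bounds the number
`τ` of rounds by `A log τ` up to constants, and `le_of_le_mul_log` solves this for `τ`. In
particular the algorithm terminates (`exists_terminates`).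
-/

open scoped ENNReal

noncomputable section

namespace FedLin

/-! ### Quadratic forms of positive definite matrices -/

section LinearAlgebra

set_option linter.unusedSectionVars false

variable {n : Type*} [Fintype n] [DecidableEq n] {A B C : Matrix n n ℝ}

/-- The squared norm `‖s‖²_{A⁻¹}` of a vector. -/
def invSq (A : Matrix n n ℝ) (s : n → ℝ) : ℝ := s ⬝ᵥ (A⁻¹ *ᵥ s)

theorem dotProduct_mulVec_symm (hA : A.IsHermitian) (u v : n → ℝ) :
    u ⬝ᵥ (A *ᵥ v) = v ⬝ᵥ (A *ᵥ u) := by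
  rw [Matrix.dotProduct_mulVec, dotProduct_comm, ← Matrix.mulVec_transpose]
  have h : Aᵀ = A := by
    rw [← Matrix.conjTranspose_eq_transpose_of_trivial]; exact hA.eq
  rw [h]

theorem quad_nonneg (hA : A.PosSemidef) (v : n → ℝ) : 0 ≤ v ⬝ᵥ (A *ᵥ v) := by
  simpa using hA.dotProduct_mulVec_nonneg v

theorem mulVec_inv_mulVec (hA : A.PosDef) (s : n → ℝ) : A *ᵥ (A⁻¹ *ᵥ s) = s := by
  rw [Matrix.mulVec_mulVec, Matrix.mul_nonsing_inv _ hA.det_pos.ne'.isUnit, Matrix.one_mulVec]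

theorem inv_mulVec_mulVec (hA : A.PosDef) (s : n → ℝ) : A⁻¹ *ᵥ (A *ᵥ s) = s := by
  rw [Matrix.mulVec_mulVec, Matrix.nonsing_inv_mul _ hA.det_pos.ne'.isUnit, Matrix.one_mulVec]

theorem invSq_nonneg (hA : A.PosDef) (s : n → ℝ) : 0 ≤ invSq A s :=
  quad_nonneg hA.inv.posSemidef s

theorem invSq_zero (A : Matrix n n ℝ) : invSq A 0 = 0 := by simp [invSq]

theorem invSq_neg (A : Matrix n n ℝ) (s : n → ℝ) : invSq A (-s) = invSq A s := by
  simp [invSq, Matrix.mulVec_neg]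

/-- The variational lower bound of `‖s‖²_{A⁻¹}`, with equality at `v = A⁻¹ s`. -/
theorem two_dotProduct_sub_le_invSq (hA : A.PosDef) (s v : n → ℝ) :
    2 * (s ⬝ᵥ v) - v ⬝ᵥ (A *ᵥ v) ≤ invSq A s := by
  have h := quad_nonneg hA.posSemidef (v - A⁻¹ *ᵥ s)
  rw [Matrix.mulVec_sub, mulVec_inv_mulVec hA, sub_dotProduct, dotProduct_sub, dotProduct_sub,
    dotProduct_mulVec_symm hA.1 (A⁻¹ *ᵥ s) v, mulVec_inv_mulVec hA] at h
  rw [invSq, dotProduct_comm s v, dotProduct_comm s (A⁻¹ *ᵥ s)]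
  linarith

/-- Inversion reverses the Loewner order. -/
theorem invSq_le_of_quad_le (hA : A.PosDef) (hB : B.PosDef) {c : ℝ} (hc : 0 < c)
    (h : ∀ v, v ⬝ᵥ (A *ᵥ v) ≤ c * (v ⬝ᵥ (B *ᵥ v))) (s : n → ℝ) :
    invSq B s ≤ c * invSq A s := by
  have h1 := two_dotProduct_sub_le_invSq hA s (c⁻¹ • (B⁻¹ *ᵥ s))
  have h2 := h (B⁻¹ *ᵥ s)
  rw [mulVec_inv_mulVec hB, dotProduct_comm (B⁻¹ *ᵥ s) s] at h2
  simp only [Matrix.mulVec_smul, dotProduct_smul, smul_dotProduct, smul_eq_mul] at h1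
  change _ ≤ c * invSq B s at h2
  change 2 * (c⁻¹ * invSq B s) - _ ≤ _ at h1
  have h3 : c⁻¹ * (c⁻¹ * (B⁻¹ *ᵥ s ⬝ᵥ A *ᵥ B⁻¹ *ᵥ s)) ≤ c⁻¹ * (c⁻¹ * (c * invSq B s)) := by
    gcongr
  have h4 : c⁻¹ * (c * invSq B s) = invSq B s := by field_simp
  rw [h4] at h3
  have h5 : c⁻¹ * invSq B s ≤ invSq A s := by linarith
  calc invSq B s = c * (c⁻¹ * invSq B s) := by field_simp
    _ ≤ _ := by gcongr

/-- The Cauchy–Schwarz inequality for `A⁻¹`. -/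
theorem dotProduct_inv_le (hA : A.PosDef) (y s : n → ℝ) :
    |y ⬝ᵥ (A⁻¹ *ᵥ s)| ≤ √(invSq A y) * √(invSq A s) := by
  have hI := hA.inv
  have key : ∀ t : ℝ, 0 ≤ invSq A y * (t * t) + 2 * (y ⬝ᵥ (A⁻¹ *ᵥ s)) * t + invSq A s := by
    intro t
    have h := quad_nonneg hI.posSemidef (t • y + s)
    simp only [Matrix.mulVec_add, Matrix.mulVec_smul, add_dotProduct, dotProduct_add,
      smul_dotProduct, dotProduct_smul, smul_eq_mul] at h
    rw [dotProduct_mulVec_symm hI.1 s y] at h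
    simp only [invSq]
    linarith
  have hd := discrim_le_zero key
  rw [discrim] at hd
  rw [← Real.sqrt_mul (invSq_nonneg hA y)]
  apply Real.abs_le_sqrt
  nlinarith

theorem sqrt_invSq_add_le (hA : A.PosDef) (s t : n → ℝ) :
    √(invSq A (s + t)) ≤ √(invSq A s) + √(invSq A t) := by
  have hI := hA.inv
  have h := (abs_le.1 (dotProduct_inv_le hA s t)).2
  apply Real.sqrt_le_iff.2
  refine ⟨by positivity, ?_⟩
  have e : invSq A (s + t) = invSq A s + 2 * (s ⬝ᵥ (A⁻¹ *ᵥ t)) + invSq A t := by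
    simp only [invSq, Matrix.mulVec_add, add_dotProduct, dotProduct_add]
    rw [dotProduct_mulVec_symm hI.1 t s]; ring
  rw [e, add_sq, Real.sq_sqrt (invSq_nonneg hA s), Real.sq_sqrt (invSq_nonneg hA t)]
  linarith

theorem sqrt_invSq_sum_le (hA : A.PosDef) {ι : Type*} (u : Finset ι) (s : ι → n → ℝ) :
    √(invSq A (∑ i ∈ u, s i)) ≤ ∑ i ∈ u, √(invSq A (s i)) := by
  classical
  induction u using Finset.induction_on with
  | empty => simp [invSq_zero]
  | insert i u hi ih =>
    rw [Finset.sum_insert hi, Finset.sum_insert hi]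
    exact (sqrt_invSq_add_le hA _ _).trans (by gcongr)

/-! ### Rank-one updates and determinants -/

theorem posSemidef_vecMulVec_self (x : n → ℝ) : (Matrix.vecMulVec x x).PosSemidef := by
  simpa using Matrix.posSemidef_vecMulVec_self_star x

theorem quad_vecMulVec (x v : n → ℝ) : v ⬝ᵥ (Matrix.vecMulVec x x *ᵥ v) = (x ⬝ᵥ v) ^ 2 := by
  rw [Matrix.vecMulVec_mulVec]
  simp [dotProduct_smul, dotProduct_comm v x, sq]

theorem posDef_add_vecMulVec (hA : A.PosDef) (x : n → ℝ) :
    (A + Matrix.vecMulVec x x).PosDef := hA.add_posSemidef (posSemidef_vecMulVec_self x)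

/-- The matrix determinant lemma for a symmetric rank-one update. -/
theorem det_add_vecMulVec (hA : A.PosDef) (x : n → ℝ) :
    (A + Matrix.vecMulVec x x).det = A.det * (1 + invSq A x) := by
  rw [Matrix.vecMulVec_eq Unit,
    Matrix.det_add_replicateCol_mul_replicateRow hA.det_pos.ne'.isUnit,
    Matrix.det_unique (n := Unit)]
  congr 1
  simp [invSq, Matrix.add_apply, Matrix.mul_apply, Matrix.replicateRow, Matrix.replicateCol,
    dotProduct, Matrix.mulVec, Finset.mul_sum, Finset.sum_mul]
  rw [Finset.sum_comm]
  refine Finset.sum_congr rfl fun i _ => Finset.sum_congr rfl fun j _ => by ring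

/-- The Sherman–Morrison formula, in the form of a quadratic form. -/
theorem invSq_add_vecMulVec (hA : A.PosDef) (x s : n → ℝ) :
    invSq (A + Matrix.vecMulVec x x) s =
      invSq A s - (x ⬝ᵥ (A⁻¹ *ᵥ s)) ^ 2 / (1 + invSq A x) := by
  have ha := invSq_nonneg hA x
  have hne : 1 + invSq A x ≠ 0 := by positivity
  have hv : (A + Matrix.vecMulVec x x)⁻¹ *ᵥ s =
      A⁻¹ *ᵥ s - ((x ⬝ᵥ (A⁻¹ *ᵥ s)) / (1 + invSq A x)) • (A⁻¹ *ᵥ x) := by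
    have h : (A + Matrix.vecMulVec x x) *ᵥ
        (A⁻¹ *ᵥ s - ((x ⬝ᵥ (A⁻¹ *ᵥ s)) / (1 + invSq A x)) • (A⁻¹ *ᵥ x)) = s := by
      rw [Matrix.add_mulVec, Matrix.mulVec_sub, Matrix.mulVec_smul, mulVec_inv_mulVec hA,
        mulVec_inv_mulVec hA, Matrix.vecMulVec_mulVec, dotProduct_sub, dotProduct_smul]
      change s - _ • x + MulOpposite.op (_ - _ • invSq A x) • x = s
      ext i
      simp only [Pi.add_apply, Pi.sub_apply, Pi.smul_apply, smul_eq_mul, op_smul_eq_smul]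
      field_simp
      ring
    conv_lhs => rw [← h]
    exact inv_mulVec_mulVec (posDef_add_vecMulVec hA x) _
  rw [invSq, hv, dotProduct_sub, dotProduct_smul, dotProduct_mulVec_symm hA.inv.1 s x,
    smul_eq_mul]
  change invSq A s - _ = _
  ring

/-- The determinant is monotone in the Loewner order: the update is a sum of rank-one matrices, each
of which increases the determinant. -/
theorem det_le_det_add (hA : A.PosDef) (hC : C.PosSemidef) : A.det ≤ (A + C).det := by
  obtain ⟨m, v, rfl⟩ := Matrix.posSemidef_iff_eq_sum_vecMulVec.1 hC
  have key : ∀ u : Finset (Fin m), (A + ∑ i ∈ u, Matrix.vecMulVec (v i) (v i)).PosDef ∧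
      A.det ≤ (A + ∑ i ∈ u, Matrix.vecMulVec (v i) (v i)).det := by
    intro u
    induction u using Finset.induction_on with
    | empty => simpa using hA
    | insert i u hi ih =>
      rw [Finset.sum_insert hi, add_comm (Matrix.vecMulVec (v i) (v i)), ← add_assoc]
      refine ⟨posDef_add_vecMulVec ih.1 _, ?_⟩
      rw [det_add_vecMulVec ih.1]
      have h1 := invSq_nonneg ih.1 (v i)
      have h2 := ih.1.det_pos
      nlinarith [ih.2]
  simpa using (key Finset.univ).2

theorem posSemidef_sub_of_quad_le (hA : A.IsHermitian) (hB : B.IsHermitian)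
    (h : ∀ v, v ⬝ᵥ (A *ᵥ v) ≤ v ⬝ᵥ (B *ᵥ v)) : (B - A).PosSemidef := by
  refine Matrix.PosSemidef.of_dotProduct_mulVec_nonneg (hB.sub hA) fun v => ?_
  rw [Matrix.sub_mulVec, dotProduct_sub]
  simpa using h v

theorem det_le_det_of_quad_le (hA : A.PosDef) (hB : B.PosDef)
    (h : ∀ v, v ⬝ᵥ (A *ᵥ v) ≤ v ⬝ᵥ (B *ᵥ v)) : A.det ≤ B.det := by
  simpa using det_le_det_add hA (posSemidef_sub_of_quad_le hA.1 hB.1 h)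

/-- A determinant ratio controls the update in the Loewner order: restrict the update to the
direction `B v`. -/
theorem one_add_quad_div_le_det_div (hA : A.PosDef) (hB : B.PosSemidef) (v : n → ℝ) :
    A.det * (v ⬝ᵥ (B *ᵥ v)) ≤ ((A + B).det - A.det) * (v ⬝ᵥ (A *ᵥ v)) := by
  have hAv := quad_nonneg hA.posSemidef v
  have hdet := det_le_det_add hA hB
  rcases (quad_nonneg hB v).eq_or_lt with h0 | h0
  · rw [← h0, mul_zero]
    exact mul_nonneg (by linarith) hAv
  set q := v ⬝ᵥ (B *ᵥ v) with hq
  -- the rank-one part `(B v)(B v)ᵀ / (vᵀ B v)` of `B`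
  set u : n → ℝ := (√q)⁻¹ • (B *ᵥ v) with hu
  have huv : ∀ t, (u ⬝ᵥ t) ^ 2 = (v ⬝ᵥ (B *ᵥ t)) ^ 2 / q := by
    intro t
    rw [hu, smul_dotProduct, smul_eq_mul, mul_pow, inv_pow, Real.sq_sqrt h0.le,
      dotProduct_comm, dotProduct_mulVec_symm hB.1]
    field_simp
  have hBu : ∀ t, t ⬝ᵥ (Matrix.vecMulVec u u *ᵥ t) ≤ t ⬝ᵥ (B *ᵥ t) := by
    intro t
    rw [quad_vecMulVec, huv, div_le_iff₀ h0]
    have key : ∀ r : ℝ, 0 ≤ q * (r * r) + 2 * (v ⬝ᵥ (B *ᵥ t)) * r + t ⬝ᵥ (B *ᵥ t) := by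
      intro r
      have h := quad_nonneg hB (r • v + t)
      simp only [Matrix.mulVec_add, Matrix.mulVec_smul, add_dotProduct, dotProduct_add,
        smul_dotProduct, dotProduct_smul, smul_eq_mul] at h
      rw [dotProduct_mulVec_symm hB.1 t v] at h
      linarith
    have hd := discrim_le_zero key
    rw [discrim] at hd
    nlinarith
  have h1 : (A + Matrix.vecMulVec u u).det ≤ (A + B).det := by
    refine det_le_det_of_quad_le (posDef_add_vecMulVec hA u) (hA.add_posSemidef hB) fun t => ?_
    rw [Matrix.add_mulVec, Matrix.add_mulVec, dotProduct_add, dotProduct_add]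
    linarith [hBu t]
  rw [det_add_vecMulVec hA] at h1
  -- `u ⬝ v = √q`
  have h2 : q ≤ invSq A u * (v ⬝ᵥ (A *ᵥ v)) := by
    have h3 := dotProduct_inv_le hA u (A *ᵥ v)
    rw [inv_mulVec_mulVec hA] at h3
    have h4 : invSq A (A *ᵥ v) = v ⬝ᵥ (A *ᵥ v) := by
      rw [invSq, inv_mulVec_mulVec hA, dotProduct_comm]
    rw [h4, ← Real.sqrt_mul (invSq_nonneg hA u)] at h3
    have h5 : (u ⬝ᵥ v) ^ 2 = q := by
      rw [huv, ← hq]; field_simp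
    have h6 : 0 ≤ invSq A u * (v ⬝ᵥ (A *ᵥ v)) := mul_nonneg (invSq_nonneg hA u) hAv
    rw [← h5, ← sq_abs, ← Real.sq_sqrt h6]
    gcongr
  have := hA.det_pos
  calc A.det * q ≤ A.det * (invSq A u * (v ⬝ᵥ (A *ᵥ v))) := by gcongr
    _ = (A.det * (1 + invSq A u) - A.det) * (v ⬝ᵥ (A *ᵥ v)) := by ring
    _ ≤ _ := by gcongr

/-- The determinant as a function of the update is supermodular: a rank-one update adds at least as
much after another one. -/
theorem det_add_vecMulVec_supermodular (hA : A.PosDef) (x y : n → ℝ) :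
    (A + Matrix.vecMulVec x x).det - A.det ≤
      (A + Matrix.vecMulVec y y + Matrix.vecMulVec x x).det - (A + Matrix.vecMulVec y y).det := by
  rw [det_add_vecMulVec (posDef_add_vecMulVec hA y), det_add_vecMulVec hA, det_add_vecMulVec hA,
    invSq_add_vecMulVec hA]
  have ha := invSq_nonneg hA x
  have hb := invSq_nonneg hA y
  have hdet := hA.det_pos
  have hne : 1 + invSq A y ≠ 0 := by positivity
  have hc : (y ⬝ᵥ (A⁻¹ *ᵥ x)) ^ 2 ≤ invSq A y * invSq A x := by
    rw [← sq_abs, ← Real.sq_sqrt (mul_nonneg hb ha), Real.sqrt_mul hb]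
    gcongr
    exact dotProduct_inv_le hA y x
  have e : A.det * (1 + invSq A y) *
      (1 + (invSq A x - (y ⬝ᵥ (A⁻¹ *ᵥ x)) ^ 2 / (1 + invSq A y))) =
      A.det * ((1 + invSq A y) * (1 + invSq A x) - (y ⬝ᵥ (A⁻¹ *ᵥ x)) ^ 2) := by
    field_simp
    ring
  rw [e]
  nlinarith

/-- The arithmetic–geometric mean inequality for the eigenvalues. -/
theorem det_le_trace_div_pow [Nonempty n] (hA : A.PosDef) :
    A.det ≤ (A.trace / Fintype.card n) ^ Fintype.card n := by
  have hn : (0 : ℝ) < Fintype.card n := by exact_mod_cast Fintype.card_pos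
  have he := fun i => (hA.eigenvalues_pos i).le
  have h := Real.geom_mean_le_arith_mean_weighted Finset.univ
    (fun _ : n => (1 : ℝ) / Fintype.card n) hA.1.eigenvalues (fun _ _ => by positivity)
    (by simp) (fun i _ => he i)
  have e1 : A.det = ∏ i, hA.1.eigenvalues i := by simpa using hA.1.det_eq_prod_eigenvalues
  have e2 : A.trace = ∑ i, hA.1.eigenvalues i := by simpa using hA.1.trace_eq_sum_eigenvalues
  rw [← Finset.mul_sum, Real.finsetProd_rpow _ _ (fun i _ => he i), ← e1, ← e2] at h
  have hd := hA.det_pos.le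
  calc A.det = (A.det ^ ((1 : ℝ) / Fintype.card n)) ^ Fintype.card n := by
        rw [← Real.rpow_natCast, ← Real.rpow_mul hd, one_div_mul_cancel hn.ne', Real.rpow_one]
    _ ≤ (1 / Fintype.card n * A.trace) ^ Fintype.card n := by gcongr
    _ = _ := by rw [one_div_mul_eq_div]

end LinearAlgebra

/-! ### Nonnegative supermartingales -/

section Probability

variable {Ω : Type*} {mΩ : MeasurableSpace Ω} {μ : Measure Ω}

/-- **Ville's inequality** for a nonnegative supermartingale. The supermartingale property is
expressed by integrals over the events known at each time. -/
theorem ville {ℱ : ℕ → MeasurableSpace Ω} (hmono : Monotone ℱ) (hle : ∀ n, ℱ n ≤ mΩ)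
    {X : ℕ → Ω → ℝ≥0∞} (hX : ∀ n, Measurable[ℱ n] (X n))
    (hstep : ∀ n A, MeasurableSet[ℱ n] A → ∫⁻ ω in A, X (n + 1) ω ∂μ ≤ ∫⁻ ω in A, X n ω ∂μ)
    (c : ℝ≥0∞) : c * μ {ω | ∃ n, c ≤ X n ω} ≤ ∫⁻ ω, X 0 ω ∂μ := by
  -- `B n`: the level `c` has been reached before time `n`
  set B : ℕ → Set Ω := fun n => {ω | ∃ i < n, c ≤ X i ω} with hB
  have hlev : ∀ n, MeasurableSet[ℱ n] {ω | c ≤ X n ω} := fun n => hX n measurableSet_Ici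
  have hBsucc : ∀ n, B (n + 1) = B n ∪ {ω | c ≤ X n ω} := by
    intro n; ext ω
    simp only [hB, Set.mem_ofPred_eq, Set.mem_union, Nat.lt_succ_iff]
    constructor
    · rintro ⟨i, hi, h⟩
      rcases hi.eq_or_lt with rfl | hi
      · exact Or.inr h
      · exact Or.inl ⟨i, hi, h⟩
    · rintro (⟨i, hi, h⟩ | h)
      · exact ⟨i, hi.le, h⟩
      · exact ⟨n, le_rfl, h⟩
  have hBm : ∀ n, MeasurableSet[ℱ n] (B n) := by
    intro n
    induction n with
    | zero => simp [hB]
    | succ n ih =>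
      rw [hBsucc]
      exact MeasurableSet.union (hmono (Nat.le_succ n) _ ih) (hmono (Nat.le_succ n) _ (hlev n))
  have key : ∀ n, c * μ (B n) + ∫⁻ ω in (B n)ᶜ, X n ω ∂μ ≤ ∫⁻ ω, X 0 ω ∂μ := by
    intro n
    induction n with
    | zero => simp [hB]
    | succ n ih =>
      refine le_trans ?_ ih
      set L := {ω | c ≤ X n ω}
      have hLm : MeasurableSet L := hle n _ (hlev n)
      have hBnm : MeasurableSet (B n) := hle n _ (hBm n)
      have hsub : ∫⁻ ω in (B n)ᶜ, X n ω ∂μ =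
          ∫⁻ ω in (B n)ᶜ ∩ L, X n ω ∂μ + ∫⁻ ω in (B n)ᶜ \ L, X n ω ∂μ :=
        (lintegral_inter_add_sdiff _ _ hLm).symm
      have h1 : c * μ ((B n)ᶜ ∩ L) ≤ ∫⁻ ω in (B n)ᶜ ∩ L, X n ω ∂μ := by
        rw [← setLIntegral_const]
        exact setLIntegral_mono' (hBnm.compl.inter hLm) fun ω hω => hω.2
      have h2 : (B (n + 1))ᶜ = (B n)ᶜ \ L := by
        rw [hBsucc, Set.compl_union, Set.sdiff_eq]
      have h3 : ∫⁻ ω in (B (n + 1))ᶜ, X (n + 1) ω ∂μ ≤ ∫⁻ ω in (B n)ᶜ \ L, X n ω ∂μ := by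
        rw [h2]
        refine hstep n _ ?_
        exact MeasurableSet.diff (MeasurableSet.compl (hBm n)) (hlev n)
      have h4 : μ (B (n + 1)) ≤ μ (B n) + μ ((B n)ᶜ ∩ L) := by
        have : B (n + 1) = B n ∪ ((B n)ᶜ ∩ L) := by
          rw [hBsucc]; ext ω; simp only [Set.mem_union, Set.mem_inter_iff, Set.mem_compl_iff]; tauto
        rw [this]; exact measure_union_le _ _
      calc c * μ (B (n + 1)) + ∫⁻ ω in (B (n + 1))ᶜ, X (n + 1) ω ∂μ
          ≤ c * (μ (B n) + μ ((B n)ᶜ ∩ L)) + ∫⁻ ω in (B n)ᶜ \ L, X n ω ∂μ := by gcongr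
        _ = c * μ (B n) + (c * μ ((B n)ᶜ ∩ L) + ∫⁻ ω in (B n)ᶜ \ L, X n ω ∂μ) := by ring
        _ ≤ c * μ (B n) + ∫⁻ ω in (B n)ᶜ, X n ω ∂μ := by rw [hsub]; gcongr
  have hU : {ω | ∃ n, c ≤ X n ω} = ⋃ n, B n := by
    ext ω
    simp only [hB, Set.mem_ofPred_eq, Set.mem_iUnion]
    exact ⟨fun ⟨n, h⟩ => ⟨n + 1, n, n.lt_succ_self, h⟩, fun ⟨_, i, _, h⟩ => ⟨i, h⟩⟩
  have hmB : Monotone B := fun a b hab ω ⟨i, hi, h⟩ => ⟨i, hi.trans_le hab, h⟩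
  rw [hU, hmB.measure_iUnion, ENNReal.mul_iSup]
  exact iSup_le fun n => le_trans le_self_add (key n)

/-- A bound for the conditional expectation given `m`, tested against sets, can be tested against
nonnegative `m`-measurable weights. -/
theorem lintegral_mul_le_of_setLIntegral_le {Ω : Type*} {m mΩ : MeasurableSpace Ω}
    {μ : Measure Ω} (hm : m ≤ mΩ)
    {f : Ω → ℝ≥0∞} (hf : Measurable f) {c : ℝ≥0∞}
    (h : ∀ A, MeasurableSet[m] A → ∫⁻ ω in A, f ω ∂μ ≤ c * μ A)
    {H : Ω → ℝ≥0∞} (hH : Measurable[m] H) :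
    ∫⁻ ω, H ω * f ω ∂μ ≤ c * ∫⁻ ω, H ω ∂μ := by
  have hH' : Measurable H := hH.mono hm le_rfl
  have hle : (μ.withDensity f).trim hm ≤ c • μ.trim hm := by
    refine @Measure.le_iff _ m _ _ |>.2 fun A hA => ?_
    rw [trim_measurableSet_eq hm hA, withDensity_apply _ (hm _ hA), Measure.smul_apply,
      trim_measurableSet_eq hm hA, smul_eq_mul]
    exact h A hA
  calc ∫⁻ ω, H ω * f ω ∂μ = ∫⁻ ω, H ω ∂(μ.withDensity f) := by
        rw [lintegral_withDensity_eq_lintegral_mul _ hf hH']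
        simp [mul_comm]
    _ = ∫⁻ ω, H ω ∂((μ.withDensity f).trim hm) := (lintegral_trim hm hH).symm
    _ ≤ ∫⁻ ω, H ω ∂(c • μ.trim hm) := lintegral_mono' hle le_rfl
    _ = c * ∫⁻ ω, H ω ∂μ := by rw [lintegral_smul_measure, lintegral_trim hm hH, smul_eq_mul]

/-- The exponential martingale increment of slope `s` has conditional expectation at most one,
tested against weights known before the noise. -/
theorem IsCondSubGaussian.lintegral_exp_le [IsFiniteMeasure μ] {ℱ : Filtration ℕ mΩ}
    {η : ℕ → Ω → ℝ} {sigma : ℝ}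
    (h : IsCondSubGaussian μ ℱ η sigma) (t : ℕ) (s : ℝ) {H : Ω → ℝ≥0∞} (hH : Measurable[ℱ t] H) :
    ∫⁻ ω, H ω * ENNReal.ofReal (Real.exp (s * η t ω - sigma ^ 2 * s ^ 2 / 2)) ∂μ ≤
      ∫⁻ ω, H ω ∂μ := by
  obtain ⟨hmeas, hs⟩ := h t
  obtain ⟨hint, hcond⟩ := hs s
  have hηm : Measurable (η t) := hmeas.mono (ℱ.le _) le_rfl
  have h1 : ∀ A, MeasurableSet[ℱ t] A →
      ∫⁻ ω in A, ENNReal.ofReal (Real.exp (s * η t ω - sigma ^ 2 * s ^ 2 / 2)) ∂μ ≤ 1 * μ A := by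
    intro A hA
    have hint' : Integrable (fun ω => Real.exp (s * η t ω - sigma ^ 2 * s ^ 2 / 2)) μ := by
      simp only [Real.exp_sub]
      exact hint.div_const _
    rw [← ofReal_integral_eq_lintegral_ofReal hint'.integrableOn
      (Filter.Eventually.of_forall fun ω => (Real.exp_pos _).le), one_mul]
    have h2 : ∫ ω in A, Real.exp (s * η t ω) ∂μ ≤
        Real.exp (sigma ^ 2 * s ^ 2 / 2) * μ.real A := by
      rw [← setIntegral_condExp (ℱ.le t) hint hA]
      calc ∫ ω in A, (μ[fun ω => Real.exp (s * η t ω) | ℱ t]) ω ∂μ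
          ≤ ∫ _ω in A, Real.exp (sigma ^ 2 * s ^ 2 / 2) ∂μ :=
            setIntegral_mono_ae integrable_condExp.integrableOn (integrable_const _).integrableOn
              hcond
        _ = _ := by rw [setIntegral_const, smul_eq_mul, mul_comm]
    have h3 : ∫ ω in A, Real.exp (s * η t ω - sigma ^ 2 * s ^ 2 / 2) ∂μ ≤ μ.real A := by
      simp only [Real.exp_sub]
      rw [integral_div, div_le_iff₀ (Real.exp_pos _)]
      linarith
    calc ENNReal.ofReal _ ≤ ENNReal.ofReal (μ.real A) := ENNReal.ofReal_le_ofReal h3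
      _ = μ A := ENNReal.ofReal_toReal (measure_ne_top _ _)
  have hfm : Measurable fun ω =>
      ENNReal.ofReal (Real.exp (s * η t ω - sigma ^ 2 * s ^ 2 / 2)) :=
    ((hηm.const_mul s).sub_const _).exp.ennreal_ofReal
  have := lintegral_mul_le_of_setLIntegral_le (ℱ.le t) hfm h1 hH
  simpa using this

/-! ### The method of mixtures -/

/-- Integrating the exponential martingale increments against a Gaussian prior for the slope. -/
theorem lintegral_gaussianPDF_mul_exp {sigma a b h : ℝ} (hsigma : 0 < sigma) (ha : 0 < a) :
    ∫⁻ s, gaussianPDF (b / sigma ^ 2) (Real.toNNReal (a / sigma ^ 2)) s *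
        ENNReal.ofReal (Real.exp (s * h - sigma ^ 2 * s ^ 2 / 2)) =
      ENNReal.ofReal ((√(1 + a))⁻¹ *
        Real.exp ((2 * b * h + a * h ^ 2 - b ^ 2) / (2 * sigma ^ 2 * (1 + a)))) := by
  set C := (√(1 + a))⁻¹ * Real.exp ((2 * b * h + a * h ^ 2 - b ^ 2) / (2 * sigma ^ 2 * (1 + a)))
    with hC
  have hv : (0 : ℝ) < a / sigma ^ 2 := by positivity
  have hv' : (0 : ℝ) < a / (sigma ^ 2 * (1 + a)) := by positivity
  have key : ∀ s : ℝ, gaussianPDF (b / sigma ^ 2) (Real.toNNReal (a / sigma ^ 2)) s *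
        ENNReal.ofReal (Real.exp (s * h - sigma ^ 2 * s ^ 2 / 2)) =
      ENNReal.ofReal C * gaussianPDF ((b + a * h) / (sigma ^ 2 * (1 + a)))
        (Real.toNNReal (a / (sigma ^ 2 * (1 + a)))) s := by
    intro s
    rw [gaussianPDF, gaussianPDF, ← ENNReal.ofReal_mul (gaussianPDFReal_nonneg _ _ _),
      ← ENNReal.ofReal_mul (by positivity)]
    congr 1
    simp only [gaussianPDFReal, Real.coe_toNNReal _ hv.le, Real.coe_toNNReal _ hv'.le, hC]
    have e1 : √(2 * Real.pi * (a / sigma ^ 2)) =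
        √(1 + a) * √(2 * Real.pi * (a / (sigma ^ 2 * (1 + a)))) := by
      rw [← Real.sqrt_mul (by positivity)]
      congr 1
      field_simp
    rw [e1, mul_inv]
    have e2 : -(s - b / sigma ^ 2) ^ 2 / (2 * (a / sigma ^ 2)) + (s * h - sigma ^ 2 * s ^ 2 / 2) =
        (2 * b * h + a * h ^ 2 - b ^ 2) / (2 * sigma ^ 2 * (1 + a)) +
        -(s - (b + a * h) / (sigma ^ 2 * (1 + a))) ^ 2 / (2 * (a / (sigma ^ 2 * (1 + a)))) := by
      field_simp
      ring
    calc _ = (√(1 + a))⁻¹ * (√(2 * Real.pi * (a / (sigma ^ 2 * (1 + a)))))⁻¹ *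
          (Real.exp (-(s - b / sigma ^ 2) ^ 2 / (2 * (a / sigma ^ 2))) *
            Real.exp (s * h - sigma ^ 2 * s ^ 2 / 2)) := by ring
      _ = _ := by rw [← Real.exp_add, e2, Real.exp_add]; ring
  simp_rw [key]
  rw [lintegral_const_mul _ (measurable_gaussianPDF _ _), lintegral_gaussianPDF_eq_one _ (by simpa),
    mul_one]

theorem measurable_gaussianPDF_comp {Ω : Type*} {m : MeasurableSpace Ω} {a b : Ω → ℝ}
    (ha : Measurable a) (hb : Measurable b) (c s : ℝ) :
    Measurable fun ω => gaussianPDF (b ω / c) (Real.toNNReal (a ω / c)) s :=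
  measurable_uncurry_gaussianPDF.comp (f := fun ω : Ω =>
    (b ω / c, Real.toNNReal (a ω / c), s)) (by fun_prop)

/-- One step of the mixture of the exponential martingales, in the direction of the new context. -/
theorem lintegral_mul_mixture_step_le [IsFiniteMeasure μ] {ℱ : Filtration ℕ mΩ} {η : ℕ → Ω → ℝ}
    {sigma : ℝ} (hsigma : 0 < sigma) (hη : IsCondSubGaussian μ ℱ η sigma) (t : ℕ)
    {H : Ω → ℝ≥0∞} (hH : Measurable[ℱ t] H) {a b : Ω → ℝ} (ha : Measurable[ℱ t] a)
    (hb : Measurable[ℱ t] b) (ha0 : ∀ ω, 0 ≤ a ω) (hab : ∀ ω, a ω = 0 → b ω = 0) :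
    ∫⁻ ω, H ω * ENNReal.ofReal ((√(1 + a ω))⁻¹ * Real.exp
      ((2 * b ω * η t ω + a ω * η t ω ^ 2 - b ω ^ 2) / (2 * sigma ^ 2 * (1 + a ω)))) ∂μ ≤
      ∫⁻ ω, H ω ∂μ := by
  have hle := ℱ.le t
  have hηm : Measurable (η t) := (hη t).1.mono (ℱ.le _) le_rfl
  -- where `a` vanishes the Gaussian prior is degenerate, but there the new factor is one
  have hZm : MeasurableSet[ℱ t] {ω | a ω = 0} := ha (measurableSet_singleton 0)
  set Z := {ω | a ω = 0} with hZ
  set W : Ω → ℝ≥0∞ := fun ω => ENNReal.ofReal ((√(1 + a ω))⁻¹ * Real.exp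
      ((2 * b ω * η t ω + a ω * η t ω ^ 2 - b ω ^ 2) / (2 * sigma ^ 2 * (1 + a ω)))) with hW
  rw [← lintegral_add_compl (fun ω => H ω * W ω) (hle _ hZm),
    ← lintegral_add_compl H (hle _ hZm)]
  refine add_le_add (le_of_eq ?_) ?_
  · refine setLIntegral_congr_fun (hle _ hZm) fun ω hω => ?_
    have h0 : a ω = 0 := hω
    simp [hW, h0, hab ω h0]
  set H' : Ω → ℝ≥0∞ := Zᶜ.indicator H with hH'
  have hH'm : Measurable[ℱ t] H' := hH.indicator hZm.compl
  set p : Ω → ℝ → ℝ≥0∞ := fun ω s =>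
    gaussianPDF (b ω / sigma ^ 2) (Real.toNNReal (a ω / sigma ^ 2)) s with hp
  set e : Ω → ℝ → ℝ≥0∞ := fun ω s =>
    ENNReal.ofReal (Real.exp (s * η t ω - sigma ^ 2 * s ^ 2 / 2)) with he
  have hpm : Measurable (Function.uncurry p) := by
    have ha' := ha.mono hle le_rfl
    have hb' := hb.mono hle le_rfl
    exact measurable_uncurry_gaussianPDF.comp (f := fun q : Ω × ℝ =>
      (b q.1 / sigma ^ 2, Real.toNNReal (a q.1 / sigma ^ 2), q.2)) (by fun_prop)
  have hps : ∀ s, Measurable[ℱ t] fun ω => p ω s := fun s =>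
    measurable_gaussianPDF_comp ha hb (sigma ^ 2) s
  have hem : Measurable (Function.uncurry e) := by
    simp only [he]
    fun_prop
  have hHm : Measurable H' := hH'm.mono hle le_rfl
  calc ∫⁻ ω in Zᶜ, H ω * W ω ∂μ = ∫⁻ ω, H' ω * (∫⁻ s, p ω s * e ω s) ∂μ := by
        rw [← lintegral_indicator (hle _ hZm).compl]
        refine lintegral_congr fun ω => ?_
        by_cases hω : ω ∈ Z
        · simp [hH', hω]
        · have hpos : 0 < a ω := lt_of_le_of_ne (ha0 ω) (Ne.symm hω)
          simp only [hp, he, lintegral_gaussianPDF_mul_exp hsigma hpos, hH']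
          simp [hω, hW]
    _ = ∫⁻ ω, ∫⁻ s, H' ω * p ω s * e ω s ∂volume ∂μ := by
        refine lintegral_congr fun ω => ?_
        rw [← lintegral_const_mul]
        · simp_rw [mul_assoc]
        · exact (hpm.comp measurable_prodMk_left).mul (hem.comp measurable_prodMk_left)
    _ = ∫⁻ s, ∫⁻ ω, H' ω * p ω s * e ω s ∂μ ∂volume := by
        refine lintegral_lintegral_swap ?_
        exact (((hHm.comp measurable_fst).mul hpm).mul hem).aemeasurable
    _ ≤ ∫⁻ s, ∫⁻ ω, H' ω * p ω s ∂μ ∂volume := by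
        refine lintegral_mono fun s => ?_
        exact hη.lintegral_exp_le t s (hH'm.mul (hps s))
    _ = ∫⁻ ω, ∫⁻ s, H' ω * p ω s ∂volume ∂μ := by
        refine lintegral_lintegral_swap ?_ |>.symm
        exact ((hHm.comp measurable_fst).mul hpm).aemeasurable
    _ = ∫⁻ ω, H' ω ∂μ := by
        refine lintegral_congr fun ω => ?_
        rw [lintegral_const_mul (f := p ω) _ (hpm.comp measurable_prodMk_left)]
        by_cases hω : ω ∈ Z
        · simp [hH', hω]
        · have hpos : 0 < a ω := lt_of_le_of_ne (ha0 ω) (Ne.symm hω)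
          have : Real.toNNReal (a ω / sigma ^ 2) ≠ 0 := by
            have : 0 < a ω / sigma ^ 2 := by positivity
            simpa using this
          rw [show ∫⁻ s, p ω s = 1 from lintegral_gaussianPDF_eq_one _ this, mul_one]
    _ = _ := lintegral_indicator (hle _ hZm).compl _

/-- The self-normalized mixture `√(det W₀ / det W) exp (‖s‖²_{W⁻¹} / (2 σ²))`: the integral of the
exponential martingales against a Gaussian prior with precision proportional to `W₀`, where `W` is
`W₀` plus the covariance of the data and `s` is the noise sum. -/
def mixture {d : ℕ} (sigma : ℝ) (W₀ W : Matrix (Fin d) (Fin d) ℝ) (s : Fin d → ℝ) : ℝ :=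
  √(W₀.det / W.det) * Real.exp (invSq W s / (2 * sigma ^ 2))

theorem mixture_pos {d : ℕ} (sigma : ℝ) {W₀ W : Matrix (Fin d) (Fin d) ℝ} (h₀ : W₀.PosDef)
    (h : W.PosDef) (s : Fin d → ℝ) : 0 < mixture sigma W₀ W s :=
  mul_pos (Real.sqrt_pos.2 (div_pos h₀.det_pos h.det_pos)) (Real.exp_pos _)

theorem mixture_self_zero {d : ℕ} (sigma : ℝ) {W : Matrix (Fin d) (Fin d) ℝ} (h : W.PosDef) :
    mixture sigma W W 0 = 1 := by
  simp [mixture, invSq_zero, div_self h.det_pos.ne']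

theorem mixture_add {d : ℕ} {sigma : ℝ} (hsigma : 0 < sigma) {W₀ W : Matrix (Fin d) (Fin d) ℝ}
    (h : W.PosDef) (x s : Fin d → ℝ) (η : ℝ) :
    mixture sigma W₀ (W + Matrix.vecMulVec x x) (s + η • x) = mixture sigma W₀ W s *
      ((√(1 + invSq W x))⁻¹ * Real.exp ((2 * (x ⬝ᵥ (W⁻¹ *ᵥ s)) * η + invSq W x * η ^ 2 -
        (x ⬝ᵥ (W⁻¹ *ᵥ s)) ^ 2) / (2 * sigma ^ 2 * (1 + invSq W x)))) := by
  have ha := invSq_nonneg h x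
  have e1 : invSq W (s + η • x) = invSq W s + 2 * η * (x ⬝ᵥ (W⁻¹ *ᵥ s)) + η ^ 2 * invSq W x := by
    simp only [invSq, Matrix.mulVec_add, Matrix.mulVec_smul, add_dotProduct, dotProduct_add,
      smul_dotProduct, dotProduct_smul, smul_eq_mul]
    rw [dotProduct_mulVec_symm h.inv.1 s x]; ring
  have e2 : x ⬝ᵥ (W⁻¹ *ᵥ (s + η • x)) = x ⬝ᵥ (W⁻¹ *ᵥ s) + η * invSq W x := by
    simp only [invSq, Matrix.mulVec_add, Matrix.mulVec_smul, dotProduct_add, dotProduct_smul,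
      smul_eq_mul]
  rw [mixture, mixture, invSq_add_vecMulVec h, e1, e2, det_add_vecMulVec h, ← div_div,
    Real.sqrt_div' _ (by positivity)]
  have e3 : (invSq W s + 2 * η * (x ⬝ᵥ (W⁻¹ *ᵥ s)) + η ^ 2 * invSq W x -
      (x ⬝ᵥ (W⁻¹ *ᵥ s) + η * invSq W x) ^ 2 / (1 + invSq W x)) / (2 * sigma ^ 2) =
      invSq W s / (2 * sigma ^ 2) + (2 * (x ⬝ᵥ (W⁻¹ *ᵥ s)) * η + invSq W x * η ^ 2 -
        (x ⬝ᵥ (W⁻¹ *ᵥ s)) ^ 2) / (2 * sigma ^ 2 * (1 + invSq W x)) := by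
    field_simp
    ring
  rw [e3, Real.exp_add]
  ring

theorem measurable_dotProduct {Ω : Type*} {m : MeasurableSpace Ω} {d : ℕ} {u v : Ω → Fin d → ℝ}
    (hu : Measurable u) (hv : Measurable v) : Measurable fun ω => u ω ⬝ᵥ v ω :=
  Finset.measurable_sum _ fun i _ =>
    ((measurable_pi_apply i).comp hu).mul ((measurable_pi_apply i).comp hv)

theorem measurable_mulVec {Ω : Type*} {m : MeasurableSpace Ω} {d : ℕ}
    {W : Ω → Matrix (Fin d) (Fin d) ℝ} {v : Ω → Fin d → ℝ}
    (hW : ∀ i j, Measurable fun ω => W ω i j) (hv : Measurable v) :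
    Measurable fun ω => W ω *ᵥ v ω :=
  measurable_pi_lambda _ fun i => measurable_dotProduct
    (measurable_pi_lambda _ fun j => hW i j) hv

theorem measurable_invSq {Ω : Type*} {m : MeasurableSpace Ω} {d : ℕ}
    {W : Ω → Matrix (Fin d) (Fin d) ℝ} {s : Ω → Fin d → ℝ}
    (hW : ∀ i j, Measurable fun ω => (W ω)⁻¹ i j) (hs : Measurable s) :
    Measurable fun ω => invSq (W ω) (s ω) :=
  measurable_dotProduct hs (measurable_mulVec hW hs)

/-- The mixture is a supermartingale, also after multiplication with a weight known in advance. -/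
theorem lintegral_mul_mixture_add_le [IsFiniteMeasure μ] {ℱ : Filtration ℕ mΩ} {η : ℕ → Ω → ℝ}
    {sigma : ℝ} (hsigma : 0 < sigma) (hη : IsCondSubGaussian μ ℱ η sigma) (t : ℕ) {d : ℕ}
    {W₀ W : Ω → Matrix (Fin d) (Fin d) ℝ} {s x : Ω → Fin d → ℝ} {H : Ω → ℝ≥0∞}
    (h₀ : ∀ ω, (W₀ ω).PosDef) (h : ∀ ω, (W ω).PosDef)
    (hWm : ∀ i j, Measurable[ℱ t] fun ω => (W ω)⁻¹ i j)
    (hd : Measurable[ℱ t] fun ω => (W₀ ω).det / (W ω).det)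
    (hs : Measurable[ℱ t] s) (hx : Measurable[ℱ t] x) (hH : Measurable[ℱ t] H) :
    ∫⁻ ω, H ω * ENNReal.ofReal (mixture sigma (W₀ ω) (W ω + Matrix.vecMulVec (x ω) (x ω))
      (s ω + η t ω • x ω)) ∂μ ≤
      ∫⁻ ω, H ω * ENNReal.ofReal (mixture sigma (W₀ ω) (W ω) (s ω)) ∂μ := by
  have hmix : Measurable[ℱ t] fun ω => mixture sigma (W₀ ω) (W ω) (s ω) := by
    have h1 := measurable_invSq hWm hs
    simp only [mixture]
    exact hd.sqrt.mul (h1.div_const _).exp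
  have hb : Measurable[ℱ t] fun ω => x ω ⬝ᵥ ((W ω)⁻¹ *ᵥ s ω) :=
    measurable_dotProduct hx (measurable_mulVec hWm hs)
  have key := lintegral_mul_mixture_step_le hsigma hη t (hH.mul hmix.ennreal_ofReal)
    (measurable_invSq hWm hx) hb (fun ω => invSq_nonneg (h ω) _) (fun ω h0 => by
      have := dotProduct_inv_le (h ω) (x ω) (s ω)
      simp only [h0] at this
      simpa using this)
  refine le_trans (le_of_eq (lintegral_congr fun ω => ?_)) key
  rw [mixture_add hsigma (h ω), ENNReal.ofReal_mul (mixture_pos sigma (h₀ ω) (h ω) _).le,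
    ← mul_assoc]
  rfl

end Probability

/-- The determinant as a function of the update is supermodular. This lets the determinant trigger,
which compares with the snapshot of an agent, be read off at the server. -/
theorem det_supermodular {n : Type*} [Fintype n] [DecidableEq n] {A B C : Matrix n n ℝ}
    (hA : A.PosDef) (hB : B.PosSemidef) (hC : C.PosSemidef) :
    (A + C).det - A.det ≤ (A + B + C).det - (A + B).det := by
  obtain ⟨m, v, rfl⟩ := Matrix.posSemidef_iff_eq_sum_vecMulVec.1 hC
  obtain ⟨l, w, rfl⟩ := Matrix.posSemidef_iff_eq_sum_vecMulVec.1 hB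
  simp only [star_trivial]
  have one : ∀ (x : n → ℝ) (u : Finset (Fin l)) (D : Matrix n n ℝ), D.PosDef →
      (D + ∑ i ∈ u, Matrix.vecMulVec (w i) (w i)).PosDef ∧
      (D + Matrix.vecMulVec x x).det - D.det ≤
        (D + ∑ i ∈ u, Matrix.vecMulVec (w i) (w i) + Matrix.vecMulVec x x).det -
          (D + ∑ i ∈ u, Matrix.vecMulVec (w i) (w i)).det := by
    intro x u D hD
    induction u using Finset.induction_on with
    | empty => simpa using hD
    | insert i u hi ih =>
      rw [Finset.sum_insert hi, add_comm (Matrix.vecMulVec (w i) (w i)), ← add_assoc]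
      exact ⟨posDef_add_vecMulVec ih.1 _,
        ih.2.trans (det_add_vecMulVec_supermodular ih.1 x (w i))⟩
  have key : ∀ u : Finset (Fin m), (A + ∑ i ∈ u, Matrix.vecMulVec (v i) (v i)).PosDef ∧
      (A + ∑ i ∈ u, Matrix.vecMulVec (v i) (v i)).det - A.det ≤
      (A + ∑ i, Matrix.vecMulVec (w i) (w i) + ∑ i ∈ u, Matrix.vecMulVec (v i) (v i)).det -
        (A + ∑ i, Matrix.vecMulVec (w i) (w i)).det := by
    intro u
    induction u using Finset.induction_on with
    | empty => simpa using hA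
    | insert i u hi ih =>
      rw [Finset.sum_insert hi, add_comm (Matrix.vecMulVec (v i) (v i)), ← add_assoc, ← add_assoc]
      refine ⟨posDef_add_vecMulVec ih.1 _, ?_⟩
      have h := (one (v i) Finset.univ _ ih.1).2
      rw [add_right_comm A (∑ i ∈ u, Matrix.vecMulVec (v i) (v i))
        (∑ i, Matrix.vecMulVec (w i) (w i))] at h
      linarith [ih.2]
  exact (key Finset.univ).2

/-! ### The data of a run -/

/-- The number of observations in a data set. -/
def Stats.count {K d : ℕ} (S : Stats K d) : ℝ := ∑ k, (S.T k : ℝ)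

theorem Stats.count_add {K d : ℕ} (S S' : Stats K d) : (S.add S').count = S.count + S'.count := by
  simp [Stats.count, Stats.add, Finset.sum_add_distrib]

theorem Stats.count_empty {K d : ℕ} : (Stats.empty K d).count = 0 := by
  simp [Stats.count, Stats.empty]

theorem Stats.count_nonneg {K d : ℕ} (S : Stats K d) : 0 ≤ S.count :=
  Finset.sum_nonneg fun _ _ => Nat.cast_nonneg _

namespace Spec

variable {M K d : ℕ} {P : Spec M K d}

/-- The covariance matrix of data with arm counts `T`. -/
def cov (P : Spec M K d) (T : Fin K → ℕ) : Matrix (Fin d) (Fin d) ℝ :=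
  ∑ k, (T k : ℝ) • Matrix.vecMulVec (P.x k) (P.x k)

/-- The regularized covariance matrix of data with arm counts `T`. -/
def regCov (P : Spec M K d) (T : Fin K → ℕ) : Matrix (Fin d) (Fin d) ℝ :=
  P.lam • (1 : Matrix (Fin d) (Fin d) ℝ) + P.cov T

theorem cov_add (T T' : Fin K → ℕ) : P.cov (T + T') = P.cov T + P.cov T' := by
  simp [cov, add_smul, Finset.sum_add_distrib]

theorem cov_zero : P.cov 0 = 0 := by simp [cov]

theorem cov_sum {ι : Type*} (u : Finset ι) (T : ι → Fin K → ℕ) :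
    P.cov (∑ i ∈ u, T i) = ∑ i ∈ u, P.cov (T i) := by
  classical
  induction u using Finset.induction_on with
  | empty => simp [cov_zero]
  | insert i u hi ih => rw [Finset.sum_insert hi, Finset.sum_insert hi, cov_add, ih]

theorem cov_single (k : Fin K) : P.cov (Pi.single k 1) = Matrix.vecMulVec (P.x k) (P.x k) := by
  rw [cov, Finset.sum_eq_single k]
  · simp
  · intro j _ hj; simp [hj]
  · simp

theorem regCov_add (T T' : Fin K → ℕ) : P.regCov (T + T') = P.regCov T + P.cov T' := by
  rw [regCov, regCov, cov_add, add_assoc]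

theorem posSemidef_cov (T : Fin K → ℕ) : (P.cov T).PosSemidef :=
  Matrix.posSemidef_sum _ fun _ _ => (posSemidef_vecMulVec_self _).smul (Nat.cast_nonneg _)

theorem posDef_smul_one (hlam : 0 < P.lam) :
    (P.lam • (1 : Matrix (Fin d) (Fin d) ℝ)).PosDef := Matrix.PosDef.one.smul hlam

theorem posDef_regCov (hlam : 0 < P.lam) (T : Fin K → ℕ) : (P.regCov T).PosDef :=
  (posDef_smul_one hlam).add_posSemidef (posSemidef_cov T)

theorem quad_cov (T : Fin K → ℕ) (v : Fin d → ℝ) :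
    v ⬝ᵥ (P.cov T *ᵥ v) = ∑ k, (T k : ℝ) * (P.x k ⬝ᵥ v) ^ 2 := by
  rw [cov, Matrix.sum_mulVec, dotProduct_sum]
  refine Finset.sum_congr rfl fun k _ => ?_
  rw [Matrix.smul_mulVec, dotProduct_smul, quad_vecMulVec, smul_eq_mul]

theorem quad_smul_one (v : Fin d → ℝ) :
    v ⬝ᵥ ((P.lam • (1 : Matrix (Fin d) (Fin d) ℝ)) *ᵥ v) = P.lam * (v ⬝ᵥ v) := by
  rw [Matrix.smul_mulVec, Matrix.one_mulVec, dotProduct_smul, smul_eq_mul]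

theorem quad_cov_le (hx : ∀ k, P.x k ⬝ᵥ P.x k ≤ 1) (T : Fin K → ℕ) (v : Fin d → ℝ) :
    v ⬝ᵥ (P.cov T *ᵥ v) ≤ (∑ k, (T k : ℝ)) * (v ⬝ᵥ v) := by
  rw [quad_cov, Finset.sum_mul]
  refine Finset.sum_le_sum fun k _ => ?_
  have hv : 0 ≤ v ⬝ᵥ v := by simpa using dotProduct_star_self_nonneg v
  have h : (P.x k ⬝ᵥ v) ^ 2 ≤ (P.x k ⬝ᵥ P.x k) * (v ⬝ᵥ v) := by
    simp only [dotProduct, ← sq]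
    exact Finset.sum_mul_sq_le_sq_mul_sq _ _ _
  have := hx k
  gcongr
  nlinarith

theorem quad_cov_mono {T T' : Fin K → ℕ} (h : T ≤ T') (v : Fin d → ℝ) :
    v ⬝ᵥ (P.cov T *ᵥ v) ≤ v ⬝ᵥ (P.cov T' *ᵥ v) := by
  rw [quad_cov, quad_cov]
  gcongr with k
  exact h k

theorem quad_regCov (T : Fin K → ℕ) (v : Fin d → ℝ) :
    v ⬝ᵥ (P.regCov T *ᵥ v) = P.lam * (v ⬝ᵥ v) + v ⬝ᵥ (P.cov T *ᵥ v) := by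
  rw [regCov, Matrix.add_mulVec, dotProduct_add, quad_smul_one]

theorem det_regCov_mono (hlam : 0 < P.lam) {T T' : Fin K → ℕ} (h : T ≤ T') :
    (P.regCov T).det ≤ (P.regCov T').det := by
  refine det_le_det_of_quad_le (posDef_regCov hlam T) (posDef_regCov hlam T') fun v => ?_
  rw [quad_regCov, quad_regCov]
  linarith [quad_cov_mono (P := P) h v]

theorem det_regCov_zero : (P.regCov 0).det = P.lam ^ d := by
  simp [regCov, cov_zero]

theorem pow_le_det_regCov (hlam : 0 < P.lam) (T : Fin K → ℕ) : P.lam ^ d ≤ (P.regCov T).det := by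
  rw [← det_regCov_zero]
  exact det_regCov_mono hlam fun k => Nat.zero_le _

/-- The growth of the determinant, by the inequality of arithmetic and geometric means. -/
theorem det_regCov_le (hd : 0 < d) (hlam : 0 < P.lam) (hx : ∀ k, P.x k ⬝ᵥ P.x k ≤ 1)
    (T : Fin K → ℕ) :
    (P.regCov T).det ≤ P.lam ^ d * (1 + (∑ k, (T k : ℝ)) / (P.lam * d)) ^ d := by
  have hne : Nonempty (Fin d) := ⟨⟨0, hd⟩⟩
  have hd' : (0 : ℝ) < d := by exact_mod_cast hd
  have htr : (P.regCov T).trace ≤ P.lam * d + ∑ k, (T k : ℝ) := by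
    rw [regCov, cov, Matrix.trace_add, Matrix.trace_smul, Matrix.trace_one, Matrix.trace_sum]
    simp only [Fintype.card_fin, smul_eq_mul, Matrix.trace_smul, Matrix.trace_vecMulVec]
    gcongr with k
    nlinarith [hx k, (T k).cast_nonneg (α := ℝ)]
  have h := det_le_trace_div_pow (posDef_regCov hlam T)
  have htr0 : 0 ≤ (P.regCov T).trace := (posDef_regCov hlam T).posSemidef.trace_nonneg
  rw [Fintype.card_fin] at h
  refine h.trans ?_
  rw [← mul_pow]
  gcongr
  rw [div_le_iff₀ hd']
  calc _ ≤ _ := htr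
    _ = _ := by field_simp

/-- The deviation of the reward-weighted context sum from its mean. -/
def dev (P : Spec M K d) (S : Stats K d) : Fin d → ℝ := S.b - S.V *ᵥ P.theta

theorem dev_add (S S' : Stats K d) : P.dev (S.add S') = P.dev S + P.dev S' := by
  simp only [dev, Stats.add, Matrix.add_mulVec]
  abel

theorem dev_empty : P.dev (Stats.empty K d) = 0 := by simp [dev, Stats.empty]

/-- The deviation of a single observation is its noise times its context. -/
theorem dev_obs (k : Fin K) (e : ℝ) : P.dev (P.obs k e) = e • P.x k := by
  simp only [dev, obs, Matrix.vecMulVec_mulVec]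
  rw [dotProduct_comm]
  ext i
  simp only [Pi.sub_apply, Pi.smul_apply, smul_eq_mul, op_smul_eq_smul]
  rw [dotProduct_comm]
  ring

theorem count_obs (k : Fin K) (e : ℝ) : (P.obs k e).count = 1 := by
  rw [Stats.count, Finset.sum_eq_single k]
  · simp [obs]
  · intro j _ hj; simp [obs, hj]
  · simp

/-- What the states of the system satisfy at all times: the matrices are the covariance matrices of
the counts, all downloaded data are contained in the data of the server, every arm has been pulled,
and no trigger is pending. -/
structure Consistent (P : Spec M K d) (s : State M K d) : Prop where
  server_V : s.server.V = P.regCov s.server.T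
  agent_V : ∀ m, (s.agent m).V = P.regCov (s.agent m).T
  loc_V : ∀ m, (s.loc m).V = P.cov (s.loc m).T
  agent_le : ∀ m, (s.agent m).T ≤ s.server.T
  one_le : ∀ m k, 1 ≤ (s.agent m).T k
  one_le_server : ∀ k, 1 ≤ s.server.T k
  not_trigger : ∀ m, ¬ P.Trigger (s.agent m) (s.loc m)

theorem trigger_iff (S L : Stats K d) : P.Trigger S L ↔
    (1 + P.gamma1) * S.V.det < (S.V + L.V).det ∨ (1 + P.gamma2) * S.count < S.count + L.count := by
  simp only [Trigger, Stats.count, Finset.sum_add_distrib]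

theorem not_trigger_empty {S : Stats K d} (h1 : 0 ≤ P.gamma1) (h2 : 0 ≤ P.gamma2)
    (hV : 0 ≤ S.V.det) : ¬ P.Trigger S (Stats.empty K d) := by
  rw [trigger_iff, Stats.count_empty]
  have := S.count_nonneg
  simp only [Stats.empty, add_zero, not_or, not_lt]
  constructor <;> nlinarith

theorem newLoc_V {s : State M K d} (hs : P.Consistent s) (a : Fin M) (e : ℝ) :
    (P.newLoc s a e).V = P.cov (P.newLoc s a e).T := by
  simp [newLoc, Stats.add, cov_add, hs.loc_V, obs, cov_single]

theorem step_of_trigger {s : State M K d} {a : Fin M} {e : ℝ}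
    (h : P.Trigger (s.agent a) (P.newLoc s a e)) : P.step s a e =
    ⟨s.server.add (P.newLoc s a e), Function.update s.agent a (s.server.add (P.newLoc s a e)),
      Function.update s.loc a (Stats.empty K d)⟩ := by
  simp only [step]; rw [if_pos h]

theorem step_of_not_trigger {s : State M K d} {a : Fin M} {e : ℝ}
    (h : ¬ P.Trigger (s.agent a) (P.newLoc s a e)) : P.step s a e =
    ⟨s.server, s.agent, Function.update s.loc a (P.newLoc s a e)⟩ := by
  simp only [step]; rw [if_neg h]

theorem consistent_step (h1 : 0 ≤ P.gamma1) (h2 : 0 ≤ P.gamma2) (hlam : 0 < P.lam)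
    {s : State M K d} (hs : P.Consistent s) (a : Fin M) (e : ℝ) : P.Consistent (P.step s a e) := by
  have hL := newLoc_V hs a e
  by_cases h : P.Trigger (s.agent a) (P.newLoc s a e)
  · rw [step_of_trigger h]
    have hSV : (s.server.add (P.newLoc s a e)).V =
        P.regCov (s.server.add (P.newLoc s a e)).T := by
      simp only [Stats.add, regCov_add, hs.server_V, hL]
    have hle : s.server.T ≤ (s.server.add (P.newLoc s a e)).T := by
      intro k; simp [Stats.add]
    refine ⟨hSV, fun m => ?_, fun m => ?_, fun m => ?_, fun m k => ?_, fun k => ?_, fun m => ?_⟩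
    · by_cases hm : m = a
      · subst hm; simpa using hSV
      · simpa [hm] using hs.agent_V m
    · by_cases hm : m = a
      · subst hm; simp [Stats.empty, cov_zero]
      · simpa [hm] using hs.loc_V m
    · by_cases hm : m = a
      · subst hm; simp
      · simpa [hm] using (hs.agent_le m).trans hle
    · by_cases hm : m = a
      · subst hm; simpa using (hs.one_le_server k).trans (hle k)
      · simpa [hm] using hs.one_le m k
    · exact (hs.one_le_server k).trans (hle k)
    · by_cases hm : m = a
      · subst hm
        simp only [Function.update_self]
        refine not_trigger_empty h1 h2 ?_
        rw [hSV]
        exact (posDef_regCov hlam _).det_pos.le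
      · simpa [hm] using hs.not_trigger m
  · rw [step_of_not_trigger h]
    refine ⟨hs.server_V, hs.agent_V, fun m => ?_, hs.agent_le, hs.one_le, hs.one_le_server,
      fun m => ?_⟩
    · by_cases hm : m = a
      · subst hm; simpa using hL
      · simpa [hm] using hs.loc_V m
    · by_cases hm : m = a
      · subst hm; simpa using h
      · simpa [hm] using hs.not_trigger m

theorem sum_obs_T (noise : ℕ → ℝ) : ∑ k : Fin K, (P.obs k (noise k)).T = fun _ => 1 := by
  ext j
  simp only [obs, Finset.sum_apply]
  rw [Finset.sum_eq_single j]
  · simp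
  · intro i _ hi; simp [Ne.symm hi]
  · simp

theorem consistent_init (h1 : 0 ≤ P.gamma1) (h2 : 0 ≤ P.gamma2) (hlam : 0 < P.lam)
    (noise : ℕ → ℝ) : P.Consistent (P.init noise) := by
  have hV : (P.init noise).server.V = P.regCov (P.init noise).server.T := by
    simp only [init, regCov, cov_sum]
    congr 1
    exact Finset.sum_congr rfl fun k _ => (cov_single k).symm
  have hT : ∀ k, 1 ≤ (P.init noise).server.T k := by
    intro k; simp only [init, sum_obs_T]; rfl
  refine ⟨hV, fun m => hV, fun m => ?_, fun m => le_rfl, fun m => hT, hT, fun m => ?_⟩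
  · simp [init, Stats.empty, cov_zero]
  · refine not_trigger_empty h1 h2 ?_
    change 0 ≤ (P.init noise).server.V.det
    rw [hV]
    exact (posDef_regCov hlam _).det_pos.le

theorem consistent_run (h1 : 0 ≤ P.gamma1) (h2 : 0 ≤ P.gamma2) (hlam : 0 < P.lam)
    (act : ℕ → Fin M) (noise : ℕ → ℝ) (n : ℕ) : P.Consistent (P.run act noise n) := by
  induction n with
  | zero => exact consistent_init h1 h2 hlam noise
  | succ n ih => exact consistent_step h1 h2 hlam ih _ _

/-- The sum of an additive statistic over the server and the unsent data of all agents changes in a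
step by the contribution of the new observation. -/
theorem total_step {G : Type*} [AddCommGroup G] (f : Stats K d → G)
    (hadd : ∀ S S', f (S.add S') = f S + f S') (h0 : f (Stats.empty K d) = 0)
    (s : State M K d) (a : Fin M) (e : ℝ) :
    f (P.step s a e).server + ∑ m, f ((P.step s a e).loc m) =
      f s.server + ∑ m, f (s.loc m) + f (P.obs (P.pull (s.agent a)) e) := by
  have hupd : ∀ L : Stats K d, ∑ m, f (Function.update s.loc a L m) =
      ∑ m, f (s.loc m) - f (s.loc a) + f L := by
    intro L
    rw [← Finset.add_sum_erase _ _ (Finset.mem_univ a),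
      ← Finset.add_sum_erase _ (fun m => f (s.loc m)) (Finset.mem_univ a),
      Finset.sum_congr rfl fun m hm => by
        rw [Function.update_of_ne (Finset.ne_of_mem_erase hm)]]
    simp only [Function.update_self]
    abel
  have hL : f (P.newLoc s a e) = f (s.loc a) + f (P.obs (P.pull (s.agent a)) e) := hadd _ _
  by_cases h : P.Trigger (s.agent a) (P.newLoc s a e)
  · rw [step_of_trigger h]
    simp only [hadd, hupd, h0, hL]
    abel
  · rw [step_of_not_trigger h]
    simp only [hupd, hL]
    abel

/-- No observation is lost: after `K + n` rounds the server and the unsent data of the agents hold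
`K + n` observations. -/
theorem count_total (act : ℕ → Fin M) (noise : ℕ → ℝ) (n : ℕ) :
    (P.run act noise n).server.count + ∑ m, ((P.run act noise n).loc m).count = K + n := by
  induction n with
  | zero =>
    have hT : (P.init noise).server.T = fun _ => 1 := sum_obs_T noise
    have hL : ∀ m, (P.init noise).loc m = Stats.empty K d := fun _ => rfl
    have hc : (P.init noise).server.count = K := by simp [Stats.count, hT]
    simp [run, hL, Stats.count_empty, hc]
  | succ n ih =>
    rw [run, total_step Stats.count Stats.count_add Stats.count_empty, ih, count_obs]
    push_cast; ring

theorem count_server_le (act : ℕ → Fin M) (noise : ℕ → ℝ) (n : ℕ) :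
    (P.run act noise n).server.count ≤ K + n := by
  have := count_total (P := P) act noise n
  have h : 0 ≤ ∑ m, ((P.run act noise n).loc m).count :=
    Finset.sum_nonneg fun m _ => Stats.count_nonneg _
  linarith

theorem one_le_count {S : Stats K d} (hK : 0 < K) (h : ∀ k, 1 ≤ S.T k) : 1 ≤ S.count := by
  calc (1 : ℝ) ≤ S.T ⟨0, hK⟩ := by exact_mod_cast h _
    _ ≤ S.count := Finset.single_le_sum (f := fun k => (S.T k : ℝ))
        (fun _ _ => Nat.cast_nonneg _) (Finset.mem_univ _)

theorem count_mono {S S' : Stats K d} (h : S.T ≤ S'.T) : S.count ≤ S'.count :=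
  Finset.sum_le_sum fun k _ => by exact_mod_cast h k

theorem server_T_step (s : State M K d) (a : Fin M) (e : ℝ) :
    s.server.T ≤ (P.step s a e).server.T := by
  by_cases h : P.Trigger (s.agent a) (P.newLoc s a e)
  · rw [step_of_trigger h]; intro k; simp [Stats.add]
  · rw [step_of_not_trigger h]

theorem server_T_mono (act : ℕ → Fin M) (noise : ℕ → ℝ) :
    Monotone fun n => (P.run act noise n).server.T :=
  monotone_nat_of_le_succ fun _ => server_T_step _ _ _

end Spec

/-! ### The number of communications -/

theorem le_logb_two_one_add {x : ℝ} (h0 : 0 ≤ x) (h1 : x ≤ 1) : x ≤ Real.logb 2 (1 + x) := by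
  rw [Real.le_logb_iff_rpow_le (by norm_num) (by linarith)]
  have := rpow_one_add_le_one_add_mul_self (s := 1) (by norm_num) h0 h1
  norm_num at this
  exact this

theorem one_sub_le_neg_logb_two {r : ℝ} (h0 : 0 < r) (h1 : r ≤ 1) : 1 - r ≤ -Real.logb 2 r := by
  have h2 : 0 < Real.log 2 := Real.log_pos (by norm_num)
  have h3 : Real.log 2 ≤ 1 := by linarith [Real.log_two_lt_d9]
  rw [Real.logb, ← neg_div, le_div_iff₀ h2]
  have := Real.log_le_sub_one_of_pos h0
  nlinarith

/-- The amortized cost of a communication: `a` is the value of a monotone quantity in the snapshot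
of the agent, and `b` and `c` are its values at the server before and after the upload. The gain of
the server in `logb 2`, weighted by `1 / g`, plus the gain of the agent is at least one. -/
theorem one_le_amortized {g a b c : ℝ} (hg : 0 < g) (hg1 : g ≤ 1) (ha : 0 < a) (hab : a ≤ b)
    (hc : b + g * a ≤ c) : 1 ≤ 1 / g * (Real.logb 2 c - Real.logb 2 b) +
      (Real.logb 2 c - Real.logb 2 a) := by
  have hb : 0 < b := ha.trans_le hab
  have hga : 0 < g * a := mul_pos hg ha
  have hcp : 0 < c := by linarith
  set r := a / b with hr
  have hr0 : 0 < r := div_pos ha hb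
  have hr1 : r ≤ 1 := (div_le_one hb).2 hab
  have h1 : g * r ≤ Real.logb 2 c - Real.logb 2 b := by
    rw [← Real.logb_div hcp.ne' hb.ne']
    refine (le_logb_two_one_add (by positivity) (by nlinarith)).trans ?_
    refine Real.logb_le_logb_of_le (by norm_num) (by positivity) ?_
    rw [le_div_iff₀ hb, hr]
    field_simp
    linarith
  have h2 : 1 - r ≤ Real.logb 2 b - Real.logb 2 a := by
    have := one_sub_le_neg_logb_two hr0 hr1
    rw [hr, Real.logb_div ha.ne' hb.ne'] at this
    rw [hr]; linarith
  have h3 : Real.logb 2 b ≤ Real.logb 2 c :=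
    Real.logb_le_logb_of_le (by norm_num) hb (by linarith)
  have h4 : r ≤ 1 / g * (Real.logb 2 c - Real.logb 2 b) := by
    rw [one_div, inv_mul_eq_div, le_div_iff₀ hg]; linarith
  linarith

namespace Spec

variable {M K d : ℕ} {P : Spec M K d}

/-- The weighted logarithms of a quantity at the server and in the snapshots of the agents. -/
def potential (f : Stats K d → ℝ) (g : ℝ) (s : State M K d) : ℝ :=
  1 / g * Real.logb 2 (f s.server) + ∑ m, Real.logb 2 (f (s.agent m))

/-- The change of the potential at a communication. -/
theorem potential_add_gain {f : Stats K d → ℝ} {g : ℝ} (s : State M K d) (a : Fin M)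
    {e : ℝ} (h : P.Trigger (s.agent a) (P.newLoc s a e)) :
    potential f g s + (1 / g * (Real.logb 2 (f (s.server.add (P.newLoc s a e))) -
      Real.logb 2 (f s.server)) + (Real.logb 2 (f (s.server.add (P.newLoc s a e))) -
      Real.logb 2 (f (s.agent a)))) = potential f g (P.step s a e) := by
  rw [step_of_trigger h]
  simp only [potential]
  rw [← Finset.add_sum_erase _ _ (Finset.mem_univ a),
      ← Finset.add_sum_erase _ (fun m => Real.logb 2 (f (Function.update s.agent a
        (s.server.add (P.newLoc s a e)) m))) (Finset.mem_univ a),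
      Finset.sum_congr (g := fun m => Real.logb 2 (f (Function.update s.agent a
        (s.server.add (P.newLoc s a e)) m))) rfl fun m hm => by
        rw [Function.update_of_ne (Finset.ne_of_mem_erase hm)]]
  simp only [Function.update_self]
  ring

theorem potential_le_step {f : Stats K d → ℝ} {g : ℝ} (hg : 0 < g) {s : State M K d} {a : Fin M}
    {e : ℝ} (h : P.Trigger (s.agent a) (P.newLoc s a e)) (ha : 0 < f (s.agent a))
    (hab : f (s.agent a) ≤ f s.server) (hbc : f s.server ≤ f (s.server.add (P.newLoc s a e))) :
    potential f g s ≤ potential f g (P.step s a e) := by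
  rw [← potential_add_gain s a h]
  have h1 := Real.logb_le_logb_of_le (b := 2) (by norm_num) (ha.trans_le hab) hbc
  have h2 := Real.logb_le_logb_of_le (b := 2) (by norm_num) ha (hab.trans hbc)
  have : 0 ≤ 1 / g * (Real.logb 2 (f (s.server.add (P.newLoc s a e))) -
    Real.logb 2 (f s.server)) := mul_nonneg (by positivity) (by linarith)
  linarith

theorem potential_add_one_le_step {f : Stats K d → ℝ} {g : ℝ} (hg : 0 < g) (hg1 : g ≤ 1)
    {s : State M K d} {a : Fin M}
    {e : ℝ} (h : P.Trigger (s.agent a) (P.newLoc s a e)) (ha : 0 < f (s.agent a))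
    (hab : f (s.agent a) ≤ f s.server)
    (hbc : f s.server + g * f (s.agent a) ≤ f (s.server.add (P.newLoc s a e))) :
    potential f g s + 1 ≤ potential f g (P.step s a e) := by
  rw [← potential_add_gain s a h]
  linarith [one_le_amortized hg hg1 ha hab hbc]

theorem potential_of_not_trigger {f : Stats K d → ℝ} {g : ℝ} {s : State M K d} {a : Fin M}
    {e : ℝ} (h : ¬ P.Trigger (s.agent a) (P.newLoc s a e)) :
    potential f g (P.step s a e) = potential f g s := by
  rw [step_of_not_trigger h]; rfl

theorem potential_le {f : Stats K d → ℝ} {g : ℝ} {s : State M K d}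
    (ha : ∀ m, 0 < f (s.agent m)) (hab : ∀ m, f (s.agent m) ≤ f s.server) :
    potential f g s ≤ (M + 1 / g) * Real.logb 2 (f s.server) := by
  have : ∑ m, Real.logb 2 (f (s.agent m)) ≤ ∑ _m : Fin M, Real.logb 2 (f s.server) :=
    Finset.sum_le_sum fun m _ => Real.logb_le_logb_of_le (by norm_num) (ha m) (hab m)
  simp at this
  rw [potential]; linarith

/-- Every communication increases the sum of the potentials of the determinant and of the number of
observations by at least one: the quantity whose trigger fires pays, and the other one does not
decrease. -/
theorem potential_communication (hK : 0 < K) (h1 : 0 < P.gamma1) (h1' : P.gamma1 ≤ 1)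
    (h2 : 0 < P.gamma2) (h2' : P.gamma2 ≤ 1) (hlam : 0 < P.lam)
    {s : State M K d} (hs : P.Consistent s) {a : Fin M} {e : ℝ}
    (h : P.Trigger (s.agent a) (P.newLoc s a e)) :
    potential (fun S => S.V.det) P.gamma1 s + potential Stats.count P.gamma2 s + 1 ≤
      potential (fun S => S.V.det) P.gamma1 (P.step s a e) +
        potential Stats.count P.gamma2 (P.step s a e) := by
  have hA : (s.agent a).V.PosDef := by rw [hs.agent_V]; exact posDef_regCov hlam _
  have hS : s.server.V.PosDef := by rw [hs.server_V]; exact posDef_regCov hlam _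
  have hL : (P.newLoc s a e).V.PosSemidef := by rw [newLoc_V hs]; exact posSemidef_cov _
  have hB : (s.server.V - (s.agent a).V).PosSemidef := by
    refine posSemidef_sub_of_quad_le hA.isHermitian hS.isHermitian fun v => ?_
    rw [hs.agent_V, hs.server_V, quad_regCov, quad_regCov]
    linarith [quad_cov_mono (P := P) (hs.agent_le a) v]
  -- the increase of the determinant at the server is at least that at the agent
  have hdet := det_supermodular hA hB hL
  rw [add_sub_cancel] at hdet
  have hAS : (s.agent a).V.det ≤ s.server.V.det := by
    rw [hs.agent_V, hs.server_V]; exact det_regCov_mono hlam (hs.agent_le a)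
  have hAL := det_le_det_add hA hL
  have hcA := one_le_count hK (hs.one_le a)
  have hcS := count_mono (hs.agent_le a)
  have hcL := (P.newLoc s a e).count_nonneg
  rcases (trigger_iff _ _).1 h with ht | ht
  · have e1 := potential_add_one_le_step (f := fun S => S.V.det) h1 h1' h hA.det_pos hAS
      (by simp only [Stats.add]; nlinarith)
    have e2 := potential_le_step (f := Stats.count) h2 h (by linarith) hcS
      (by rw [Stats.count_add]; linarith)
    linarith
  · have e1 := potential_le_step (f := fun S => S.V.det) h1 h hA.det_pos hAS
      (by simp only [Stats.add]; linarith)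
    have e2 := potential_add_one_le_step (f := Stats.count) h2 h2' h (by linarith) hcS
      (by rw [Stats.count_add]; linarith)
    linarith

open Classical in
theorem card_communications_le_potential (hK : 0 < K) (h1 : 0 < P.gamma1) (h1' : P.gamma1 ≤ 1)
    (h2 : 0 < P.gamma2) (h2' : P.gamma2 ≤ 1) (hlam : 0 < P.lam)
    (act : ℕ → Fin M) (noise : ℕ → ℝ) (n : ℕ) :
    (((Finset.range n).filter fun l => P.Communicates act noise l).card : ℝ) ≤
      (potential (fun S => S.V.det) P.gamma1 (P.run act noise n) +
        potential Stats.count P.gamma2 (P.run act noise n)) -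
      (potential (fun S => S.V.det) P.gamma1 (P.run act noise 0) +
        potential Stats.count P.gamma2 (P.run act noise 0)) := by
  induction n with
  | zero => simp
  | succ n ih =>
    rw [Finset.range_add_one, Finset.filter_insert]
    have hs := consistent_run h1.le h2.le hlam act noise n
    by_cases h : P.Communicates act noise n
    · rw [if_pos h, Finset.card_insert_of_notMem (by simp)]
      have := potential_communication hK h1 h1' h2 h2' hlam hs h
      rw [show P.run act noise (n + 1) = P.step _ _ _ from rfl]
      push_cast
      linarith
    · rw [if_neg h, show P.run act noise (n + 1) = P.step _ _ _ from rfl,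
        potential_of_not_trigger h, potential_of_not_trigger h]
      exact ih

/-- The communication cost is logarithmic in the number of rounds, whether or not the algorithm
has terminated. -/
theorem commCost_le (hK : 0 < K) (h1 : 0 < P.gamma1) (h1' : P.gamma1 ≤ 1)
    (h2 : 0 < P.gamma2) (h2' : P.gamma2 ≤ 1) (hlam : 0 < P.lam)
    (hd : 0 < d) (hx : ∀ k, P.x k ⬝ᵥ P.x k ≤ 1)
    (act : ℕ → Fin M) (noise : ℕ → ℝ) (n : ℕ) :
    (P.commCost act noise n : ℝ) ≤
      2 * ((M + 1 / P.gamma1) * d * Real.logb 2 (1 + ((K + n + 1 : ℕ) : ℝ) / (P.lam * d)) +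
        (M + 1 / P.gamma2) * Real.logb 2 ((K + n + 1 : ℕ) : ℝ)) := by
  have hcard := card_communications_le_potential hK h1 h1' h2 h2' hlam act noise (n + 1)
  have hs := consistent_run h1.le h2.le hlam act noise (n + 1)
  have hpos : ∀ m, 0 < ((P.run act noise (n + 1)).agent m).V.det := fun m => by
    rw [hs.agent_V]; exact (posDef_regCov hlam _).det_pos
  have hend1 := potential_le (f := fun S => S.V.det) (g := P.gamma1) hpos fun m => by
    rw [hs.agent_V, hs.server_V]; exact det_regCov_mono hlam (hs.agent_le m)
  have hend2 := potential_le (f := Stats.count) (g := P.gamma2)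
    (fun m => by linarith [one_le_count hK (hs.one_le m)]) fun m => count_mono (hs.agent_le m)
  have hinit : ∀ (f : Stats K d → ℝ) (g : ℝ), potential f g (P.run act noise 0) =
      (M + 1 / g) * Real.logb 2 (f (P.run act noise 0).server) := by
    intro f g
    have : ∀ m, (P.run act noise 0).agent m = (P.run act noise 0).server := fun _ => rfl
    simp only [potential, this, Finset.sum_const, Finset.card_univ, Fintype.card_fin, nsmul_eq_mul]
    ring
  rw [hinit, hinit] at hcard
  have hs0 := consistent_run h1.le h2.le hlam act noise 0
  have hc0 : 0 ≤ Real.logb 2 (P.run act noise 0).server.count :=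
    Real.logb_nonneg (by norm_num) (one_le_count hK hs0.one_le_server)
  have hc1 : Real.logb 2 (P.run act noise (n + 1)).server.count ≤
      Real.logb 2 ((K + n + 1 : ℕ) : ℝ) := by
    refine Real.logb_le_logb_of_le (by norm_num)
      (by linarith [one_le_count hK hs.one_le_server]) ?_
    refine (count_server_le act noise (n + 1)).trans (le_of_eq ?_)
    push_cast; ring
  have hlamd : 0 < P.lam ^ d := pow_pos hlam d
  have hd' : (0 : ℝ) < d := by exact_mod_cast hd
  have hv0 : Real.logb 2 (P.lam ^ d) ≤ Real.logb 2 (P.run act noise 0).server.V.det := by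
    refine Real.logb_le_logb_of_le (by norm_num) hlamd ?_
    rw [hs0.server_V]; exact pow_le_det_regCov hlam _
  have hv1 : Real.logb 2 (P.run act noise (n + 1)).server.V.det ≤
      Real.logb 2 (P.lam ^ d) + d * Real.logb 2 (1 + ((K + n + 1 : ℕ) : ℝ) / (P.lam * d)) := by
    have hb : (0 : ℝ) < 1 + ((K + n + 1 : ℕ) : ℝ) / (P.lam * d) := by positivity
    rw [← Real.logb_pow, ← Real.logb_mul hlamd.ne' (pow_pos hb d).ne']
    refine Real.logb_le_logb_of_le (by norm_num) ?_ ?_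
    · rw [hs.server_V]; exact (posDef_regCov hlam _).det_pos
    · rw [hs.server_V]
      refine (det_regCov_le hd hlam hx _).trans ?_
      have := count_server_le (P := P) act noise (n + 1)
      simp only [Stats.count] at this
      have h3 : 0 ≤ ∑ k, ((P.run act noise (n + 1)).server.T k : ℝ) :=
        Finset.sum_nonneg fun _ _ => Nat.cast_nonneg _
      gcongr
      refine this.trans (le_of_eq ?_)
      push_cast; ring
  have hg1 : (0 : ℝ) ≤ M + 1 / P.gamma1 := by positivity
  have hg2 : (0 : ℝ) ≤ M + 1 / P.gamma2 := by positivity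
  have f1 := mul_le_mul_of_nonneg_left hv0 hg1
  have f2 := mul_le_mul_of_nonneg_left hv1 hg1
  have f3 := mul_le_mul_of_nonneg_left hc0 hg2
  have f4 := mul_le_mul_of_nonneg_left hc1 hg2
  simp only [commCost]
  push_cast at *
  nlinarith

end Spec

/-! ### A numerical inequality for the confidence radius

Throughout, `m` is the number of agents, `k` the number of arms, `z` the rescaled number of
observations of the server and `D` the relative determinant of its covariance matrix. -/

theorem log_275_le : Real.log 275 ≤ 5.6195 := by
  have h : Real.log 275 = 8 * Real.log 2 + Real.log (275 / 256) := by
    rw [Real.log_div (by norm_num) (by norm_num), show (256 : ℝ) = 2 ^ 8 by norm_num, Real.log_pow]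
    push_cast; ring
  have h1 := Real.log_le_sub_one_of_pos (show (0 : ℝ) < 275 / 256 by norm_num)
  linarith [Real.log_two_lt_d9]

theorem le_log_three : 1.0983 ≤ Real.log 3 := by
  have h : 5 * Real.log 3 = 8 * Real.log 2 - Real.log (256 / 243) := by
    rw [Real.log_div (by norm_num) (by norm_num), show (256 : ℝ) = 2 ^ 8 by norm_num,
      show (243 : ℝ) = 3 ^ 5 by norm_num, Real.log_pow, Real.log_pow]
    push_cast; ring
  have h1 := Real.log_le_sub_one_of_pos (show (0 : ℝ) < 256 / 243 by norm_num)
  linarith [Real.log_two_gt_d9]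

theorem le_log_five_halves : 0.916 ≤ Real.log (5 / 2) := by
  have h : 3 * Real.log (5 / 2) = 4 * Real.log 2 - Real.log (128 / 125) := by
    rw [Real.log_div (by norm_num) (by norm_num), Real.log_div (by norm_num) (by norm_num),
      show (128 : ℝ) = 2 ^ 7 by norm_num,
      show (125 : ℝ) = 5 ^ 3 by norm_num, Real.log_pow, Real.log_pow]
    push_cast; ring
  have h1 := Real.log_le_sub_one_of_pos (show (0 : ℝ) < 128 / 125 by norm_num)
  linarith [Real.log_two_gt_d9]

theorem log_seven_le : Real.log 7 ≤ 1.946 := by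
  have h : 5 * Real.log 7 = 14 * Real.log 2 + Real.log (16807 / 16384) := by
    rw [Real.log_div (by norm_num) (by norm_num), show (16384 : ℝ) = 2 ^ 14 by norm_num,
      show (16807 : ℝ) = 7 ^ 5 by norm_num, Real.log_pow, Real.log_pow]
    push_cast; ring
  have h1 := Real.log_le_sub_one_of_pos (show (0 : ℝ) < 16807 / 16384 by norm_num)
  linarith [Real.log_two_lt_d9]

/-- The tangent of the logarithm, in terms of the reciprocal of the argument. -/
theorem log_ge_tangent {a b : ℝ} (ha : 0 < a) (hb : 0 < b) :
    Real.log b + 1 - b / a ≤ Real.log a := by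
  have := Real.log_le_sub_one_of_pos (div_pos hb ha)
  rw [Real.log_div hb.ne' ha.ne'] at this
  linarith

/-- The concave function `z ↦ z * log ((1 + z) / z)` lies below its tangent at `z₀`. -/
theorem mul_log_le_tangent {z z₀ : ℝ} (hz : 0 < z) (hz₀ : 0 < z₀) :
    z * (Real.log (1 + z) - Real.log z) ≤
      z * (Real.log (1 + z₀) - Real.log z₀) + (z₀ - z) / (1 + z₀) := by
  have h := Real.log_le_sub_one_of_pos (show 0 < ((1 + z) * z₀) / (z * (1 + z₀)) by positivity)
  rw [Real.log_div (by positivity) (by positivity), Real.log_mul (by positivity) (by positivity),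
    Real.log_mul (by positivity) (by positivity)] at h
  have h2 := mul_le_mul_of_nonneg_left h hz.le
  have : z * ((1 + z) * z₀ / (z * (1 + z₀)) - 1) = (z₀ - z) / (1 + z₀) := by
    field_simp; ring
  rw [this] at h2
  linarith

/-- The case of a single arm of `star_inequality`, with numerical bounds for the logarithms of the
constants. The tangents of the logarithm at `25 / 2` and at `4` are used for large and for small
`m`. -/
theorem star_inequality_aux {m : ℝ} (hm : 2 ≤ m) :
    (1 - 1 / m) ^ 2 * (7.0059 + 2 * Real.log m) + (1 - 1 / m) * (0.6932 + 1.52 * (1 / m)) + 0.45 ≤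
      3.3 * 1.0983 + 3.3 * Real.log m := by
  have hm0 : 0 < m := by linarith
  have hL0 := log_ge_tangent hm0 (show (0 : ℝ) < 25 / 2 by norm_num)
  have hL1 := log_ge_tangent hm0 (show (0 : ℝ) < 4 by norm_num)
  have e1 : Real.log (25 / 2) = 2 * Real.log (5 / 2) + Real.log 2 := by
    rw [← Real.log_rpow (by norm_num), ← Real.log_mul (by norm_num) (by norm_num)]
    norm_num
  have e2 : Real.log 4 = 2 * Real.log 2 := by
    rw [show (4 : ℝ) = 2 ^ 2 by norm_num, Real.log_pow]; norm_num
  have hu : 1 / m ≤ 1 / 2 := one_div_le_one_div_of_le (by norm_num) hm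
  have hu0 : 0 < 1 / m := by positivity
  rw [show 25 / 2 / m = 25 / 2 * (1 / m) by ring] at hL0
  rw [show 4 / m = 4 * (1 / m) by ring] at hL1
  set u := 1 / m
  set L := Real.log m
  have l2 := Real.log_two_gt_d9
  have l5 := le_log_five_halves
  have hL0' : 3.525 - 12.5 * u ≤ L := by linarith
  have hL1' : 2.386 - 4 * u ≤ L := by linarith
  have hc : 0 ≤ 3.3 - 2 * (1 - u) ^ 2 := by nlinarith
  rcases le_total u 0.2 with h | h
  · have := mul_le_mul_of_nonneg_left hL0' hc
    nlinarith [mul_nonneg hu0.le (sub_nonneg.2 h),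
      mul_nonneg (mul_nonneg hu0.le hu0.le) (sub_nonneg.2 h), sq_nonneg (u - 0.1)]
  · have := mul_le_mul_of_nonneg_left hL1' hc
    nlinarith [mul_nonneg (sub_nonneg.2 hu) (sub_nonneg.2 h),
      mul_nonneg (mul_nonneg hu0.le (sub_nonneg.2 hu)) (sub_nonneg.2 h)]

/-- The terms independent of the number of observations: the constants from the factors of the
agents against the constant `M (2 K + 1)` inside the logarithm of the confidence radius. -/
theorem star_inequality {m k : ℝ} (hm : 2 ≤ m) (hk : 1 ≤ k) :
    (1 - 1 / m) ^ 2 * (Real.log 275 + 2 * Real.log 2 + 2 * Real.log (m * k)) +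
      (1 - 1 / m) * (Real.log 2 + 1.52 * (1 / m)) + 0.45 ≤ 3.3 * Real.log (m * (2 * k + 1)) := by
  have hm0 : 0 < m := by linarith
  have hk0 : 0 < k := by linarith
  have h := star_inequality_aux hm
  have hu : 1 / m ≤ 1 / 2 := one_div_le_one_div_of_le (by norm_num) hm
  have hu0 : 0 < 1 / m := by positivity
  rw [Real.log_mul hm0.ne' hk0.ne', Real.log_mul hm0.ne' (by positivity)]
  -- the inequality of arithmetic and geometric means for `k`, `k` and `1`
  have hamgm : Real.log 3 + 2 / 3 * Real.log k ≤ Real.log (2 * k + 1) := by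
    have h3 : Real.log (27 * k ^ 2) ≤ Real.log ((2 * k + 1) ^ 3) := by
      apply Real.log_le_log (by positivity)
      nlinarith [mul_nonneg (sq_nonneg (k - 1)) (by linarith : (0 : ℝ) ≤ 8 * k + 1)]
    rw [Real.log_mul (by norm_num) (by positivity), Real.log_pow, Real.log_pow,
      show (27 : ℝ) = 3 ^ 3 by norm_num, Real.log_pow] at h3
    push_cast at h3
    linarith
  have hlk : 0 ≤ Real.log k := Real.log_nonneg hk
  set u := 1 / m
  have l2 := Real.log_two_lt_d9
  have l3 := le_log_three
  have l275 := log_275_le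
  have hx1 : (1 - u) ^ 2 ≤ 1 := pow_le_one₀ (by linarith) (by linarith)
  have hx0 : 0 ≤ (1 - u) ^ 2 := sq_nonneg _
  have a1 := mul_le_mul_of_nonneg_right hx1 hlk
  have a2 : (1 - u) ^ 2 * (Real.log 275 + 2 * Real.log 2) ≤ (1 - u) ^ 2 * 7.0059 :=
    mul_le_mul_of_nonneg_left (by linarith) hx0
  have a3 : (1 - u) * Real.log 2 ≤ (1 - u) * 0.6932 :=
    mul_le_mul_of_nonneg_left (by linarith) (by linarith)
  nlinarith

/-- A function of the form `q ↦ κ * C + b * q` with `κ ≤ 1 / (1 + q)` is bounded by its value at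
`q = 0` or by what remains if `C` is at most `b * (1 + q)`. -/
theorem mul_add_le_or {κ C b q : ℝ} (hκ : 0 ≤ κ) (hκ1 : κ ≤ 1) (hq : κ * (1 + q) ≤ 1)
    (hb : 0 ≤ b) : κ * C + b * q ≤ C ∨ κ * C + b * q ≤ b + b * q := by
  rcases le_total (b * (1 + q)) C with h | h
  · left
    nlinarith [mul_le_mul_of_nonneg_left h (sub_nonneg.2 hκ1), mul_le_mul_of_nonneg_left hq hb]
  · right
    nlinarith [mul_le_mul_of_nonneg_left h hκ, mul_le_mul_of_nonneg_left hq hb]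

theorem chord_le_log {a b t : ℝ} (ha : 0 < a) (hb : 0 < b) (h0 : 0 ≤ t) (h1 : t ≤ 1) :
    (1 - t) * Real.log a + t * Real.log b ≤ Real.log ((1 - t) * a + t * b) := by
  have := strictConcaveOn_log_Ioi.concaveOn.2 (Set.mem_Ioi.2 ha) (Set.mem_Ioi.2 hb)
    (sub_nonneg.2 h1) h0 (by ring)
  simpa using this

section LogInequality

variable {m k z D : ℝ}

/-- `log_inequality_one` when the relative determinant is at most `z`. -/
theorem log_inequality_large (hm : 2 ≤ m) (hk : 1 ≤ k) (hD : 1 ≤ D) (h : D ≤ z) :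
    (1 - 1 / m) ^ 2 * (Real.log 275 + 2 * Real.log (m * k) +
        2 * Real.log (1 + z) - 2 * Real.log D) + (1 - 1 / m) * Real.log (1 + z) +
      1.52 * Real.log D + 1.52 * (1 / m * (1 - 1 / m)) ≤
    3.3 * Real.log (1 + m * (2 * k + 1) * z) := by
  have hz1 : 1 ≤ z := hD.trans h
  have hz : 0 < z := by linarith
  have hstar := star_inequality hm hk
  have hc : 0 < m * (2 * k + 1) := by positivity
  have h1 : Real.log (1 + z) ≤ Real.log 2 + Real.log z := by
    rw [← Real.log_mul (by norm_num) hz.ne']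
    exact Real.log_le_log (by linarith) (by linarith)
  have h2 : Real.log (m * (2 * k + 1)) + Real.log z ≤ Real.log (1 + m * (2 * k + 1) * z) := by
    rw [← Real.log_mul hc.ne' hz.ne']
    exact Real.log_le_log (by positivity) (by linarith)
  have h3 : 0 ≤ Real.log D := Real.log_nonneg hD
  have h4 : Real.log D ≤ Real.log z := Real.log_le_log (by linarith) h
  have hu : 1 / m ≤ 1 / 2 := one_div_le_one_div_of_le (by norm_num) hm
  have hu0 : 0 < 1 / m := by positivity
  set u := 1 / m
  have hx0 : 0 ≤ (1 - u) ^ 2 := sq_nonneg _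
  have hx1 : (1 - u) ^ 2 ≤ 1 := pow_le_one₀ (by linarith) (by linarith)
  have a1 := mul_le_mul_of_nonneg_left h1 hx0
  have a2 := mul_le_mul_of_nonneg_left h1 (show 0 ≤ 1 - u by linarith)
  have a3 := mul_le_mul_of_nonneg_right hx1 (sub_nonneg.2 h4)
  have a4 : 0 ≤ u * Real.log z := mul_nonneg hu0.le (h3.trans h4)
  nlinarith

/-- `log_inequality_one` when `1 ≤ z ≤ D`. The weight `z / D` decays in `log D - log z`, which
allows to treat `log D` by `mul_add_le_or`. -/
theorem log_inequality_medium (hm : 2 ≤ m) (hk : 1 ≤ k) (hz : 1 ≤ z)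
    (hDz : D ≤ 1 + 2 * k / m * z) (h : z ≤ D) :
    (1 - 1 / m) ^ 2 * (z / D) * (Real.log 275 + 2 * Real.log (m * k) +
        2 * Real.log (1 + z) - 2 * Real.log z) + (1 - 1 / m) * Real.log (1 + z) +
      1.52 * Real.log D + 1.52 * (1 / m * (1 - 1 / m)) * (z / D) ≤
    3.3 * Real.log (1 + m * (2 * k + 1) * z) := by
  have hz0 : 0 < z := by linarith
  have hD0 : 0 < D := by linarith
  have hm0 : 0 < m := by linarith
  have hk0 : 0 < k := by linarith
  have hstar := star_inequality hm hk
  have hc : 0 < m * (2 * k + 1) := by positivity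
  have h1 : Real.log (1 + z) ≤ Real.log 2 + Real.log z := by
    rw [← Real.log_mul (by norm_num) hz0.ne']
    exact Real.log_le_log (by linarith) (by linarith)
  have h2 : Real.log (m * (2 * k + 1)) + Real.log z ≤ Real.log (1 + m * (2 * k + 1) * z) := by
    rw [← Real.log_mul hc.ne' hz0.ne']
    exact Real.log_le_log (by positivity) (by linarith)
  have h3 : 0 ≤ Real.log z := Real.log_nonneg hz
  have h4 : Real.log m + Real.log D ≤ Real.log (m * (2 * k + 1)) + Real.log z := by
    rw [← Real.log_mul hc.ne' hz0.ne', ← Real.log_mul hm0.ne' hD0.ne']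
    apply Real.log_le_log (by positivity)
    calc m * D ≤ m * (1 + 2 * k / m * z) := by gcongr
      _ = m + 2 * k * z := by field_simp
      _ ≤ m * (2 * k + 1) * z := by
        nlinarith [mul_nonneg hm0.le (sub_nonneg.2 hz),
          mul_nonneg (mul_nonneg hk0.le hz0.le) (sub_nonneg.2 hm)]
  have h5 : Real.log 2 ≤ Real.log m := Real.log_le_log (by norm_num) hm
  have h6 : Real.log 2 + Real.log 3 ≤ Real.log (m * (2 * k + 1)) := by
    rw [← Real.log_mul (by norm_num) (by norm_num)]
    exact Real.log_le_log (by norm_num) (by nlinarith)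
  have hκ : z / D * (1 + (Real.log D - Real.log z)) ≤ 1 := by
    rw [← Real.log_div hD0.ne' hz0.ne']
    have := Real.log_le_sub_one_of_pos (div_pos hD0 hz0)
    calc z / D * (1 + Real.log (D / z)) ≤ z / D * (D / z) := by gcongr; linarith
      _ = 1 := by field_simp
  have hu : 1 / m ≤ 1 / 2 := one_div_le_one_div_of_le (by norm_num) hm
  have hu0 : 0 < 1 / m := by positivity
  set u := 1 / m
  have hx0 : 0 ≤ (1 - u) ^ 2 := sq_nonneg _
  have hκ0 : 0 ≤ z / D := by positivity
  have hκ1 : z / D ≤ 1 := (div_le_one hD0).2 h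
  set κ := z / D
  have a1 := mul_le_mul_of_nonneg_left h1 (mul_nonneg hx0 hκ0)
  have a2 := mul_le_mul_of_nonneg_left h1 (show 0 ≤ 1 - u by linarith)
  have a4 : 0 ≤ u * Real.log z := mul_nonneg hu0.le h3
  have l2 := Real.log_two_gt_d9
  have l2' := Real.log_two_lt_d9
  have l3 := le_log_three
  have a5 : 0 ≤ u * Real.log 2 := by positivity
  rcases mul_add_le_or (C := (1 - u) ^ 2 * (Real.log 275 + 2 * Real.log 2 + 2 * Real.log (m * k)) +
    1.52 * (u * (1 - u))) hκ0 hκ1 hκ (show (0 : ℝ) ≤ 1.52 by norm_num) with hcase | hcase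
  · nlinarith
  · nlinarith

/-- `log_inequality_one` for so few observations that the right-hand side is of linear size. The
additive constant `0.04` absorbs the maximum of `z log (1 / z)` minus a multiple of `z`. -/
theorem log_inequality_tiny (hm : 2 ≤ m) (hk : 1 ≤ k) (hz : 0 < z) (hz1 : z ≤ 1) (hD : 1 ≤ D)
    (hDz : D ≤ 1 + 2 * k / m * z) (h : m * (2 * k + 1) * z ≤ 3 / 2) :
    (1 - 1 / m) ^ 2 * (z / D) * (Real.log 275 + 2 * Real.log (m * k) +
        2 * Real.log (1 + z) - 2 * Real.log z) + (1 - 1 / m) * Real.log (1 + z) +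
      1.52 * Real.log D + 1.52 * (1 / m * (1 - 1 / m)) * (z / D) ≤
    3.3 * Real.log (1 + m * (2 * k + 1) * z) + 0.04 := by
  have hD0 : 0 < D := by linarith
  have hm0 : 0 < m := by linarith
  have hk0 : 0 < k := by linarith
  have hu : 1 / m ≤ 1 / 2 := one_div_le_one_div_of_le (by norm_num) hm
  have hu0 : 0 < 1 / m := by positivity
  have hκ : z / D ≤ z := div_le_self hz.le hD
  have hκ0 : 0 ≤ z / D := by positivity
  have hw0 : 0 < m * (2 * k + 1) * z := by positivity
  have hr : 2 * k / m * z ≤ m * (2 * k + 1) * z / 4 := by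
    rw [div_mul_eq_mul_div, div_le_iff₀ hm0]
    have : 4 ≤ m * m := by nlinarith
    nlinarith [mul_pos hk0 hz, mul_nonneg (mul_pos hk0 hz).le (sub_nonneg.2 this)]
  have hlD : Real.log D ≤ m * (2 * k + 1) * z / 4 := by
    linarith [Real.log_le_sub_one_of_pos hD0]
  have hlz : Real.log (1 + z) ≤ z := by
    linarith [Real.log_le_sub_one_of_pos (show 0 < 1 + z by linarith)]
  have hlz0 : 0 ≤ Real.log (1 + z) := Real.log_nonneg (by linarith)
  have hchord : 0.61 * (m * (2 * k + 1) * z) ≤ Real.log (1 + m * (2 * k + 1) * z) := by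
    have := chord_le_log (a := 1) (b := 5 / 2) (t := m * (2 * k + 1) * z / (3 / 2)) one_pos
      (by norm_num) (by positivity) (by linarith)
    rw [Real.log_one] at this
    rw [show (1 - m * (2 * k + 1) * z / (3 / 2)) * 1 + m * (2 * k + 1) * z / (3 / 2) * (5 / 2) =
      1 + m * (2 * k + 1) * z by ring] at this
    nlinarith [le_log_five_halves]
  have htan := mul_log_le_tangent hz (show (0 : ℝ) < 1 / 127 by norm_num)
  have e1 : Real.log (1 + 1 / 127) - Real.log (1 / 127) = 7 * Real.log 2 := by
    rw [← Real.log_div (by norm_num) (by norm_num)]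
    norm_num
    rw [show (128 : ℝ) = 2 ^ 7 by norm_num, Real.log_pow]; norm_num
  rw [e1, show (1 / 127 - z) / (1 + 1 / 127) = 1 / 128 - 127 / 128 * z by ring] at htan
  have hlk := Real.log_le_sub_one_of_pos hk0
  have hlm := Real.log_le_sub_one_of_pos (show 0 < m / 4 by linarith)
  rw [Real.log_div hm0.ne' (by norm_num), show (4 : ℝ) = 2 ^ 2 by norm_num, Real.log_pow] at hlm
  push_cast at hlm
  rw [Real.log_mul hm0.ne' hk0.ne']
  have l2 := Real.log_two_lt_d9
  have l2' := Real.log_two_gt_d9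
  have hlz2 : Real.log z ≤ 0 := Real.log_nonpos hz.le hz1
  have hlm0 : 0 ≤ Real.log m := Real.log_nonneg (by linarith)
  have hlk0 : 0 ≤ Real.log k := Real.log_nonneg hk
  have l275 := log_275_le
  have l275' : 0 ≤ Real.log 275 := Real.log_nonneg (by norm_num)
  have hx : (1 - 1 / m) ^ 2 * (14.12 + m / 2) + 0.38 ≤ 4.38 * m := by
    rcases le_total m 3 with hm3 | hm3
    · have : 1 / 3 ≤ 1 / m := one_div_le_one_div_of_le hm0 hm3
      have hx : (1 - 1 / m) ^ 2 ≤ (2 / 3) ^ 2 := pow_le_pow_left₀ (by linarith) (by linarith) 2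
      have := mul_le_mul_of_nonneg_right hx (show 0 ≤ 14.12 + m / 2 by linarith)
      linarith
    · rcases le_total m 4 with hm4 | hm4
      · have : 1 / 4 ≤ 1 / m := one_div_le_one_div_of_le hm0 hm4
        have hx : (1 - 1 / m) ^ 2 ≤ (3 / 4) ^ 2 := pow_le_pow_left₀ (by linarith) (by linarith) 2
        have := mul_le_mul_of_nonneg_right hx (show 0 ≤ 14.12 + m / 2 by linarith)
        linarith
      · have hx : (1 - 1 / m) ^ 2 ≤ 1 := pow_le_one₀ (by linarith) (by linarith)
        have := mul_le_mul_of_nonneg_right hx (show 0 ≤ 14.12 + m / 2 by linarith)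
        linarith
  set u := 1 / m
  have hx0 : 0 ≤ (1 - u) ^ 2 := sq_nonneg _
  have hx1 : (1 - u) ^ 2 ≤ 1 := pow_le_one₀ (by linarith) (by linarith)
  set x := (1 - u) ^ 2
  have hbr : 0 ≤ x * (Real.log 275 + 2 * (Real.log m + Real.log k) +
        2 * Real.log (1 + z) - 2 * Real.log z) := mul_nonneg hx0 (by linarith)
  have a1 := mul_le_mul_of_nonneg_right hκ hbr
  have a2 : x * (z * (Real.log 275 + 2 * (Real.log m + Real.log k)) +
      2 * (z * (Real.log (1 + z) - Real.log z))) ≤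
      x * (z * (14.12 + m / 2 + 2 * (k - 1)) + 0.02) := by
    refine mul_le_mul_of_nonneg_left ?_ hx0
    have : Real.log 275 + 2 * (Real.log m + Real.log k) + 2 * (7 * Real.log 2) - 2 * (127 / 128)
      ≤ 14.12 + m / 2 + 2 * (k - 1) := by linarith
    have := mul_le_mul_of_nonneg_left this hz.le
    linarith
  have a3 : u * (1 - u) ≤ 1 / 4 := by linarith only [sq_nonneg (u - 1 / 2)]
  have a4 := mul_le_mul a3 hκ hκ0 (by norm_num)
  have a5 : (1 - u) * Real.log (1 + z) ≤ z :=
    (mul_le_of_le_one_left hlz0 (by linarith)).trans hlz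
  have a6 := mul_le_mul_of_nonneg_left hx hz.le
  have a9 : 0 ≤ (k - 1) * z := mul_nonneg (sub_nonneg.2 hk) hz.le
  have a7 : x * (2 * ((k - 1) * z)) ≤ 2 * ((k - 1) * z) := mul_le_of_le_one_left (by linarith) hx1
  have a8 : 0 ≤ (m - 2) * ((k - 1) * z) := mul_nonneg (sub_nonneg.2 hm) a9
  have a10 : 0 ≤ (m - 2) * z := mul_nonneg (sub_nonneg.2 hm) hz.le
  linarith only [a1, a2, a4, a5, a6, a7, a8, a9, a10, hlD, hchord, hx1, hx0, hz]

/-- Concavity of `z ↦ log (1 + c z)` between `3 / (2 c)` and `1`. -/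
theorem log_one_add_mul_ge {c : ℝ} (hc : 6 ≤ c) (hz1 : z ≤ 1) (h : 3 / 2 ≤ c * z) :
    z * Real.log (1 + c) + 0.42 * (1 - z) ≤ Real.log (1 + c * z) := by
  have l5 := le_log_five_halves
  rcases eq_or_lt_of_le hz1 with rfl | hz1
  · simp
  have hz1' : 0 < 1 - 3 / 2 / c := by
    rw [sub_pos, div_lt_one (by linarith)]; linarith
  have hcz : 3 / 2 / c ≤ z := by rw [div_le_iff₀ (by linarith)]; linarith
  have ht0 : 0 ≤ (z - 3 / 2 / c) / (1 - 3 / 2 / c) := div_nonneg (by linarith) hz1'.le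
  have ht1 : (z - 3 / 2 / c) / (1 - 3 / 2 / c) ≤ 1 := (div_le_one hz1').2 (by linarith)
  have hch := chord_le_log (a := 5 / 2) (b := 1 + c) (by norm_num) (by linarith) ht0 ht1
  set t := (z - 3 / 2 / c) / (1 - 3 / 2 / c) with ht
  have hzt : (1 - t) * (3 / 2 / c) + t = z := by
    have : t * (1 - 3 / 2 / c) = z - 3 / 2 / c := div_mul_cancel₀ _ hz1'.ne'
    linarith
  have e1 : (1 - t) * (5 / 2) + t * (1 + c) = 1 + c * z := by
    rw [← hzt]; field_simp; ring
  rw [e1] at hch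
  have hl7 := log_seven_le
  have hlc : Real.log (1 + c) ≤ 1.946 + (c - 6) / 7 := by
    have := Real.log_le_sub_one_of_pos (show 0 < (1 + c) / 7 by linarith)
    rw [Real.log_div (by linarith) (by norm_num)] at this
    linarith
  have h7 : 3 / 2 / c * Real.log (1 + c) ≤ 0.487 := by
    rw [div_mul_eq_mul_div, div_le_iff₀ (by linarith)]; linarith
  have h8 : 3 / 2 / c * Real.log (1 + c) + 0.42 * (1 - 3 / 2 / c) ≤ Real.log (5 / 2) := by
    have : 0 < 3 / 2 / c := by positivity
    linarith
  have := mul_le_mul_of_nonneg_left h8 (sub_nonneg.2 ht1)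
  rw [← hzt]
  rw [← hzt] at hch
  linarith

/-- `log_inequality_one` for `z ≤ 1` away from zero. -/
theorem log_inequality_small (hm : 2 ≤ m) (hk : 1 ≤ k) (hz : 0 < z) (hz1 : z ≤ 1) (hD : 1 ≤ D)
    (hDz : D ≤ 1 + 2 * k / m * z) (h : 3 / 2 ≤ m * (2 * k + 1) * z) :
    (1 - 1 / m) ^ 2 * (z / D) * (Real.log 275 + 2 * Real.log (m * k) +
        2 * Real.log (1 + z) - 2 * Real.log z) + (1 - 1 / m) * Real.log (1 + z) +
      1.52 * Real.log D + 1.52 * (1 / m * (1 - 1 / m)) * (z / D) ≤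
    3.3 * Real.log (1 + m * (2 * k + 1) * z) + 0.04 := by
  have hD0 : 0 < D := by linarith
  have hm0 : 0 < m := by linarith
  have hk0 : 0 < k := by linarith
  have hstar := star_inequality hm hk
  have hu : 1 / m ≤ 1 / 2 := one_div_le_one_div_of_le (by norm_num) hm
  have hu0 : 0 < 1 / m := by positivity
  have hc : 6 ≤ m * (2 * k + 1) := by nlinarith
  have hr : 2 * k / m * z ≤ m * (2 * k + 1) * z / 4 := by
    rw [div_mul_eq_mul_div, div_le_iff₀ hm0]
    have : 4 ≤ m * m := by nlinarith
    nlinarith [mul_pos hk0 hz, mul_nonneg (mul_pos hk0 hz).le (sub_nonneg.2 this)]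
  set c := m * (2 * k + 1) with hcdef
  have hw0 : 0 < c * z := by positivity
  have l2 := Real.log_two_lt_d9
  have l2' := Real.log_two_gt_d9
  have l3 := le_log_three
  have l5 := le_log_five_halves
  have hlD0 : 0 ≤ Real.log D := Real.log_nonneg hD
  have hκ : 1 / D * (1 + Real.log D) ≤ 1 := by
    rw [div_mul_eq_mul_div, one_mul, div_le_one hD0]
    linarith [Real.log_le_sub_one_of_pos hD0]
  have hlz0 : 0 ≤ Real.log (1 + z) := Real.log_nonneg (by linarith)
  have hstarz := mul_le_mul_of_nonneg_left hstar hz.le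
  have hx1 : (1 - 1 / m) ^ 2 ≤ 1 := pow_le_one₀ (by linarith) (by linarith)
  have hx0 : 0 ≤ (1 - 1 / m) ^ 2 := sq_nonneg _
  rcases mul_add_le_or (C := z * ((1 - 1 / m) ^ 2 * (Real.log 275 + 2 * Real.log (m * k) +
    2 * Real.log (1 + z) - 2 * Real.log z) + 1.52 * (1 / m * (1 - 1 / m)))) (κ := 1 / D)
    (q := Real.log D) (by positivity) ((div_le_one hD0).2 hD) hκ
    (show (0 : ℝ) ≤ 1.52 by norm_num) with hcase | hcase
  · have hconc := log_one_add_mul_ge hc hz1 h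
    have hlc : Real.log c ≤ Real.log (1 + c) := Real.log_le_log (by linarith) (by linarith)
    have hlcz := mul_le_mul_of_nonneg_left hlc hz.le
    have htan := mul_log_le_tangent hz (show (0 : ℝ) < 1 / 3 by norm_num)
    have e1 : Real.log (1 + 1 / 3) - Real.log (1 / 3) = 2 * Real.log 2 := by
      rw [← Real.log_div (by norm_num) (by norm_num)]
      norm_num
      rw [show (4 : ℝ) = 2 ^ 2 by norm_num, Real.log_pow]; norm_num
    rw [e1, show (1 / 3 - z) / (1 + 1 / 3) = 1 / 4 - 3 / 4 * z by ring] at htan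
    have hlz : Real.log (1 + z) ≤ 2 * Real.log 2 - Real.log 3 + 3 / 4 * (z - 1 / 3) := by
      have := Real.log_le_sub_one_of_pos (show 0 < (1 + z) * 3 / 4 by linarith)
      rw [Real.log_div (by linarith) (by norm_num), Real.log_mul (by linarith) (by norm_num),
        show (4 : ℝ) = 2 ^ 2 by norm_num, Real.log_pow] at this
      push_cast at this
      linarith
    set u := 1 / m
    set x := (1 - u) ^ 2
    have b1 : x * (z * (Real.log (1 + z) - Real.log z) - z * Real.log 2) ≤ 0.25 - 0.0568 * z := by
      have h1 : z * (Real.log (1 + z) - Real.log z) - z * Real.log 2 ≤ 0.25 - 0.0568 * z := by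
        have := mul_le_mul_of_nonneg_left l2.le hz.le
        linarith
      refine (mul_le_mul_of_nonneg_left h1 hx0).trans (mul_le_of_le_one_left ?_ hx1)
      linarith
    have b2 : (1 - u) * (Real.log (1 + z) - z * Real.log 2) ≤ 0.0381 + 0.057 * z := by
      have h1 : Real.log (1 + z) - z * Real.log 2 ≤ 0.0381 + 0.057 * z := by
        have := mul_le_mul_of_nonneg_left l2'.le hz.le
        linarith
      refine (mul_le_mul_of_nonneg_left h1 (show 0 ≤ 1 - u by linarith)).trans
        (mul_le_of_le_one_left ?_ ?_) <;> linarith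
    rw [show z / D = 1 / D * z by ring]
    generalize 1 / D = κ at *
    have b3 : 0 ≤ (1 - z) := by linarith only [hz1]
    linarith only [hcase, hstarz, hlcz, hconc, b1, b2, b3]
  · have hlD : Real.log D ≤ Real.log (1 + c * z) - 0.45 := by
      have h1 : Real.log D ≤ Real.log (1 + c * z / 4) := Real.log_le_log hD0 (by linarith)
      have h2 := Real.log_le_sub_one_of_pos (show 0 < (1 + c * z / 4) / (1 + c * z) by positivity)
      rw [Real.log_div (by positivity) (by positivity)] at h2
      have h3 : (1 + c * z / 4) / (1 + c * z) ≤ 0.55 := by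
        rw [div_le_iff₀ (by positivity)]; linarith
      linarith
    have ht : Real.log (5 / 2) ≤ Real.log (1 + c * z) :=
      Real.log_le_log (by norm_num) (by linarith)
    have hlz : Real.log (1 + z) ≤ Real.log 2 := Real.log_le_log (by linarith) (by linarith)
    have b2 : (1 - 1 / m) * Real.log (1 + z) ≤ Real.log 2 := by nlinarith
    rw [show z / D = 1 / D * z by ring]
    generalize 1 / D = κ at *
    generalize 1 / m = u at *
    generalize 1 / D = κ at *
    linarith only [hcase, hlD, ht, b2, l2, l5]

/-- The logarithms of the weights and determinants in the two supermartingales against the logarithm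
in the confidence radius, in dimension one. -/
theorem log_inequality_one (hm : 2 ≤ m) (hk : 1 ≤ k) (hz : 0 < z) (hD : 1 ≤ D)
    (hDz : D ≤ 1 + 2 * k / m * z) :
    (1 - 1 / m) ^ 2 * (min D z / D) * (Real.log 275 + 2 * Real.log (m * k) +
        2 * Real.log (1 + z) - 2 * Real.log (min D z)) + (1 - 1 / m) * Real.log (1 + z) +
      1.52 * Real.log D + 1.52 * (1 / m * (1 - 1 / m)) * (min D z / D) ≤
    3.3 * Real.log (1 + m * (2 * k + 1) * z) + 0.04 := by
  rcases le_total D z with h | h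
  · rw [min_eq_left h, div_self (by linarith)]
    linarith [log_inequality_large hm hk hD h]
  · rw [min_eq_right h]
    rcases le_total 1 z with hz1 | hz1
    · linarith [log_inequality_medium hm hk hz1 hDz h]
    · rcases le_total (m * (2 * k + 1) * z) (3 / 2) with hw | hw
      · exact log_inequality_tiny hm hk hz hz1 hD hDz hw
      · exact log_inequality_small hm hk hz hz1 hD hDz hw

end LogInequality

theorem log_eleven_le : Real.log 11 ≤ 2.43 := by
  have h : 2 * Real.log 11 ≤ 7 * Real.log 2 := by
    have := Real.log_le_log (show (0 : ℝ) < 11 ^ 2 by norm_num)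
      (show (11 : ℝ) ^ 2 ≤ 2 ^ 7 by norm_num)
    rw [Real.log_pow, Real.log_pow] at this
    push_cast at this
    linarith
  linarith [Real.log_two_lt_d9]

/-- The part of the relative determinant `D = det V / λ ^ d` which bounds the covariance matrix `V`
from below: in dimension one `V = λ D`, but in higher dimension only `V ≥ λ` in the Loewner
order. -/
def effDet (d : ℕ) (D : ℝ) : ℝ := if d = 1 then D else 1

theorem one_le_effDet {d : ℕ} {D : ℝ} (hD : 1 ≤ D) : 1 ≤ effDet d D := by
  rw [effDet]; split_ifs <;> simp [hD]

theorem effDet_mono {d : ℕ} {D D' : ℝ} (h : D ≤ D') : effDet d D ≤ effDet d D' := by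
  rw [effDet, effDet]; split_ifs <;> simp [h]

/-- `log_inequality_one` in all dimensions. From dimension two on it is reduced to the case `D = 1`
of dimension one, and each further dimension contributes the inequality `hdet` of the proof. -/
theorem log_inequality {d : ℕ} {m k z D : ℝ} (hd : 0 < d) (hm : 2 ≤ m) (hk : 1 ≤ k) (hz : 0 < z)
    (hD : 1 ≤ D) (hDz : Real.log D ≤ d * Real.log (1 + 2 * k / (m * d) * z)) :
    (1 - 1 / m) ^ 2 * (min (effDet d D) z / effDet d D) * (d * Real.log 11 +
        2 * Real.log (5 * (m * k)) +
        2 * Real.log (1 + z) - 2 * Real.log (min (effDet d D) z)) +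
        (1 - 1 / m) * Real.log (1 + z) +
      1.52 * Real.log D + 1.52 * (d * (1 / m * (1 - 1 / m)) * (min (effDet d D) z / effDet d D)) ≤
    3.3 * (d * Real.log (1 + m * (2 * k + 1) * z)) + 0.04 := by
  have hm0 : 0 < m := by linarith
  have hk0 : 0 < k := by linarith
  have e275 : Real.log 275 = Real.log 11 + 2 * Real.log 5 := by
    rw [show (275 : ℝ) = 11 * 5 ^ 2 by norm_num, Real.log_mul (by norm_num) (by norm_num),
      Real.log_pow]; norm_num
  have e5 : Real.log (5 * (m * k)) = Real.log 5 + Real.log (m * k) :=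
    Real.log_mul (by norm_num) (by positivity)
  rw [e5]
  rcases eq_or_ne d 1 with rfl | hd1
  · have hDz' : D ≤ 1 + 2 * k / m * z := by
      rw [← Real.log_le_log_iff (by linarith) (by positivity)]
      simpa using hDz
    have := log_inequality_one hm hk hz hD hDz'
    rw [e275] at this
    simp only [effDet, if_true, Nat.cast_one, one_mul]
    linarith
  · have hd2 : 2 ≤ d := by omega
    have hd2' : (2 : ℝ) ≤ d := by exact_mod_cast hd2
    have h1 := log_inequality_one (D := 1) hm hk hz le_rfl (by
      have : 0 < 2 * k / m * z := by positivity
      linarith)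
    rw [e275, Real.log_one] at h1
    simp only [effDet, if_neg hd1]
    rw [div_one] at h1 ⊢
    set a := m * (2 * k + 1) * z with ha
    have ha0 : 0 < a := by positivity
    have hu : 1 / m ≤ 1 / 2 := one_div_le_one_div_of_le (by norm_num) hm
    have hu0 : 0 < 1 / m := by positivity
    have hmk : 6 ≤ m * (2 * k + 1) := by nlinarith
    have hza : 6 * z ≤ a := mul_le_mul_of_nonneg_right hmk hz.le
    have hDa : Real.log D ≤ 2 * (d - 1) * Real.log (1 + a / 8) := by
      refine hDz.trans ?_
      have hmd : 2 * k / (m * d) * z ≤ a / 8 := by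
        rw [div_mul_eq_mul_div, div_le_iff₀ (by positivity)]
        have : 8 ≤ m * (m * d) := by nlinarith [mul_le_mul hm hm (by norm_num) hm0.le]
        calc 2 * k * z ≤ (m * (m * d) / 8) * ((2 * k + 1) * z) := by
              have h2 : 1 ≤ m * (m * d) / 8 := by linarith
              have h3 : 0 < (2 * k + 1) * z := by positivity
              nlinarith [mul_le_mul_of_nonneg_right h2 h3.le]
          _ = a / 8 * (m * d) := by rw [ha]; ring
      have h2 : Real.log (1 + 2 * k / (m * d) * z) ≤ Real.log (1 + a / 8) :=
        Real.log_le_log (by positivity) (by linarith)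
      have h3 : 0 ≤ Real.log (1 + a / 8) := Real.log_nonneg (by linarith)
      calc (d : ℝ) * Real.log (1 + 2 * k / (m * d) * z) ≤ d * Real.log (1 + a / 8) := by gcongr
        _ ≤ 2 * (d - 1) * Real.log (1 + a / 8) := by
          apply mul_le_mul_of_nonneg_right _ h3; linarith
    have hκ1 : min 1 z ≤ 1 := min_le_left _ _
    have hκz : min 1 z ≤ z := min_le_right _ _
    have hκ0 : 0 < min 1 z := lt_min one_pos hz
    have hdet : 2.43 * min 1 z + 3.04 * Real.log (1 + a / 8) ≤ 3.3 * Real.log (1 + a) := by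
      have h2 := Real.log_le_sub_one_of_pos (show 0 < (1 + a / 8) / (1 + a) by positivity)
      rw [Real.log_div (by positivity) (by positivity)] at h2
      have h3 := Real.log_le_sub_one_of_pos (show 0 < 1 / (1 + a) by positivity)
      rw [Real.log_div (by positivity) (by positivity), Real.log_one] at h3
      have e2 : (1 + a / 8) / (1 + a) - 1 = - (7 / 8) * (a / (1 + a)) := by field_simp; ring
      have e3 : 1 / (1 + a) - 1 = - (a / (1 + a)) := by field_simp; ring
      rw [e2] at h2
      rw [e3] at h3
      have h4 : 2.43 * min 1 z ≤ 2.92 * (a / (1 + a)) := by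
        rw [mul_div_assoc', le_div_iff₀ (by positivity)]
        nlinarith [mul_le_mul_of_nonneg_right hκ1 ha0.le]
      linarith
    have hx : (1 - 1 / m) ^ 2 * Real.log 11 + 1.52 * (1 / m * (1 - 1 / m)) ≤ 2.43 := by
      have := mul_le_mul_of_nonneg_left log_eleven_le (sq_nonneg (1 - 1 / m))
      nlinarith
    have hx' := mul_le_mul_of_nonneg_right hx hκ0.le
    have hfin := mul_le_mul_of_nonneg_left (add_le_add_left hx' (3.04 * Real.log (1 + a / 8)))
      (show (0 : ℝ) ≤ d - 1 by linarith)
    have hfin' := mul_le_mul_of_nonneg_left hdet (show (0 : ℝ) ≤ d - 1 by linarith)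
    linarith only [h1, hfin, hfin', hDa]

/-- The Cauchy–Schwarz inequality for two terms with the weights `c - s` and `s`. -/
theorem sqrt_add_sqrt_le {a b c s R : ℝ} (hs : 0 < s) (hsc : s < c)
    (ha : 0 ≤ a) (hb : 0 ≤ b) (h : a / (c - s) + b / s ≤ R) : √a + √b ≤ √(c * R) := by
  have hcs : 0 < c - s := sub_pos.2 hsc
  apply Real.le_sqrt_of_sq_le
  have h1 : √a ^ 2 = a := Real.sq_sqrt ha
  have h2 : √b ^ 2 = b := Real.sq_sqrt hb
  have h3 := mul_le_mul_of_nonneg_left h (hs.trans hsc).le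
  refine le_trans ?_ h3
  rw [div_add_div _ _ hcs.ne' hs.ne', mul_div_assoc', le_div_iff₀ (by positivity)]
  rw [← h1, ← h2]
  rw [Real.sqrt_sq (Real.sqrt_nonneg a), Real.sqrt_sq (Real.sqrt_nonneg b)]
  nlinarith [sq_nonneg (s * √a - (c - s) * √b)]

/-- A quadratic lower bound for the constant of the confidence radius, `u = 1 / M`. -/
theorem radius_const_ge {u : ℝ} (h0 : 0 ≤ u) (h1 : u ≤ 1 / 2) :
    5.828 + 2.41 * u - 0.36 * u ^ 2 ≤ (√2 + √(1 + u)) ^ 2 := by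
  have h2 : (1.414 + 0.705 * u - 0.18 * u ^ 2) ≤ √2 * √(1 + u) := by
    rw [← Real.sqrt_mul (by norm_num)]
    apply Real.le_sqrt_of_sq_le
    nlinarith [mul_nonneg h0 (sub_nonneg.2 h1), mul_nonneg (mul_nonneg h0 h0) (sub_nonneg.2 h1),
      mul_nonneg (mul_nonneg h0 h0) h0,
      mul_nonneg (mul_nonneg (mul_nonneg h0 h0) h0) (sub_nonneg.2 h1)]
  have h3 : √2 ^ 2 = 2 := Real.sq_sqrt (by norm_num)
  have h4 : √(1 + u) ^ 2 = 1 + u := Real.sq_sqrt (by linarith)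
  nlinarith

theorem radius_const_pos {u : ℝ} (h0 : 0 ≤ u) (h1 : u ≤ 1 / 2) :
    0 < 5.828 + 2.41 * u - 0.36 * u ^ 2 - 3.63 := by nlinarith

/-- The weights of `log D` and of `log (2 / δ)` after the Cauchy–Schwarz inequality with the weight
`3.63 = 1.1 * 3.3` for the unsent data. The second one stays below `1` by enough to absorb the
additive constant of `log_inequality`. -/
theorem radius_weights {u : ℝ} (h0 : 0 ≤ u) (h1 : u ≤ 1 / 2) :
    (1 + u * (1 - u)) / (5.828 + 2.41 * u - 0.36 * u ^ 2 - 3.63) ≤ 76 / 165 ∧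
    2 * ((1 + u * (1 - u)) / (5.828 + 2.41 * u - 0.36 * u ^ 2 - 3.63)) +
      20 / 33 * (u * (1 - u)) ≤ 0.98 := by
  have hcp := radius_const_pos h0 h1
  constructor
  · rw [div_le_iff₀ hcp]; nlinarith
  · have huu : 0 ≤ u * (1 - u) := mul_nonneg h0 (by linarith)
    rw [← le_sub_iff_add_le, mul_div_assoc', div_le_iff₀ hcp]
    nlinarith [sq_nonneg (u - 0.23), mul_nonneg h0 (sq_nonneg (u - 0.23)),
      mul_nonneg (pow_nonneg h0 3) (sub_nonneg.2 h1)]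

/-- The sum of the deviation of all observations, for which the determinant of the pooled data
enters, and of the deviation of the observations which are not yet uploaded is at most the
confidence radius. -/
theorem radius_inequality {M K d : ℕ} {A z D : ℝ} (hM : 2 ≤ M) (hK : 0 < K) (hd : 0 < d)
    (hA : Real.log 2 ≤ A) (hz : 0 < z) (hD : 1 ≤ D)
    (hDz : Real.log D ≤ d * Real.log (1 + 2 * K / (M * d) * z)) {κ T : ℝ}
    (hκ : κ = min (effDet d D) z / effDet d D)
    (hT : T = κ * (d * Real.log 11 + 2 * Real.log (5 * (M * K)) +
        2 * Real.log (1 + z) - 2 * Real.log (min (effDet d D) z)) + Real.log (1 + z))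
    (hT0 : 0 ≤ T) :
    √((1 + 1 / M * (1 - 1 / M) * κ) * (Real.log D + d * (1 / M * (1 - 1 / M) * κ) + 2 * A)) +
      √(1.1 * (1 - 1 / M) * (2 * (1 / M) * A + ((1 - 1 / M) * T + 1 / M * Real.log (1 + z)))) ≤
    (√2 + √(1 + 1 / M)) * √(d * (A + Real.log (1 + M * (2 * K + 1) * z))) := by
  have hM' : (2 : ℝ) ≤ M := by exact_mod_cast hM
  have hK' : (1 : ℝ) ≤ K := by exact_mod_cast hK
  have hd' : (1 : ℝ) ≤ d := by exact_mod_cast hd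
  have hI := log_inequality hd hM' hK' hz hD hDz
  rw [← hκ] at hI
  have hE := one_le_effDet (d := d) hD
  have hκ0 : 0 ≤ κ := by rw [hκ]; exact div_nonneg (le_min (by linarith) hz.le) (by linarith)
  have hκ1 : κ ≤ 1 := by rw [hκ, div_le_one (by linarith)]; exact min_le_left _ _
  have hu : (1 : ℝ) / M ≤ 1 / 2 := one_div_le_one_div_of_le (by norm_num) hM'
  have hu0 : (0 : ℝ) < 1 / M := by positivity
  have hB : 0 ≤ Real.log (1 + M * (2 * K + 1) * z) := Real.log_nonneg (by
    have : 0 < (M : ℝ) * (2 * K + 1) * z := by positivity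
    linarith)
  have hlz : 0 ≤ Real.log (1 + z) := Real.log_nonneg (by linarith)
  have hlD : 0 ≤ Real.log D := Real.log_nonneg hD
  have l2 := Real.log_two_gt_d9
  have hc := radius_const_ge hu0.le hu
  generalize Real.log (1 + z) = ℓ at *
  generalize Real.log D = g at *
  generalize Real.log (1 + M * (2 * K + 1) * z) = B at *
  generalize (1 : ℝ) / M = u at *
  set c₀ := 5.828 + 2.41 * u - 0.36 * u ^ 2 with hc₀
  have hcp : 0 < c₀ - 3.63 := by rw [hc₀]; linarith only [radius_const_pos hu0.le hu]
  have hA0 : 0 ≤ A := by linarith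
  have hG : 0 ≤ d * (A + B) := by positivity
  have hu1 : 0 ≤ 1 - u := by linarith
  rw [← Real.sqrt_sq (show 0 ≤ √2 + √(1 + u) by positivity), ← Real.sqrt_mul (sq_nonneg _)]
  refine (sqrt_add_sqrt_le (c := c₀) (s := 3.63) (R := d * (A + B)) (by norm_num)
    (by linarith only [hcp]) (by positivity) (by positivity) ?_).trans
    (Real.sqrt_le_sqrt (mul_le_mul_of_nonneg_right hc hG))
  have huu : 0 ≤ u * (1 - u) := by positivity
  have hp : 1 + u * (1 - u) * κ ≤ 1 + u * (1 - u) := by nlinarith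
  obtain ⟨hh1, hh2⟩ := radius_weights hu0.le hu
  rw [← hc₀] at hh1 hh2
  set h := (1 + u * (1 - u)) / (c₀ - 3.63) with hh
  have e1 : (1 + u * (1 - u) * κ) * (g + d * (u * (1 - u) * κ) + 2 * A) / (c₀ - 3.63) ≤
      h * (g + d * (u * (1 - u) * κ) + 2 * A) := by
    rw [hh, div_mul_eq_mul_div]
    gcongr
  have e2 := mul_le_mul_of_nonneg_right hh1 (show 0 ≤ g + d * (u * (1 - u) * κ) by positivity)
  have e3 := mul_le_mul_of_nonneg_right hh2 hA0
  have e4 : A ≤ d * A := le_mul_of_one_le_left hA0 hd'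
  rw [hT]
  have e5 : 1.1 * (1 - u) * (2 * u * A + ((1 - u) * (κ * (d * Real.log 11 +
      2 * Real.log (5 * (M * K)) + 2 * ℓ - 2 * Real.log (min (effDet d D) z)) + ℓ) + u * ℓ)) /
      3.63 = 20 / 33 * (u * (1 - u)) * A + ((1 - u) ^ 2 * κ * (d * Real.log 11 +
      2 * Real.log (5 * (M * K)) + 2 * ℓ - 2 * Real.log (min (effDet d D) z)) +
      (1 - u) * ℓ) * (10 / 33) := by ring
  rw [e5]
  clear e5 hh
  generalize (1 + u * (1 - u) * κ) * (g + d * (u * (1 - u) * κ) + 2 * A) / (c₀ - 3.63) = X at *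
  have e6 : h * (g + d * (u * (1 - u) * κ) + 2 * A) + 20 / 33 * (u * (1 - u)) * A ≤
      76 / 165 * (g + d * (u * (1 - u) * κ)) + 0.98 * A := by
    linarith only [e2, e3]
  linarith only [hI, e1, e6, e4, hA, l2]

/-- The case of a single agent, in which there are no unsent data. -/
theorem radius_inequality_one {K d : ℕ} {A z D : ℝ} (hd : 0 < d)
    (hA : 0 ≤ A) (hz : 0 < z) (hDz : Real.log D ≤ d * Real.log (1 + 2 * K / d * z)) :
    √(Real.log D + 2 * A) ≤ (√2 + √(1 + 1)) * √(d * (A + Real.log (1 + (2 * K + 1) * z))) := by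
  have hd' : (1 : ℝ) ≤ d := by exact_mod_cast hd
  have h1 : Real.log D ≤ d * Real.log (1 + (2 * K + 1) * z) := by
    refine hDz.trans ?_
    gcongr
    exact (div_le_self (by positivity) hd').trans (by linarith)
  have h2 : 0 ≤ Real.log (1 + (2 * K + 1) * z) := Real.log_nonneg (by
    have : 0 < (2 * (K : ℝ) + 1) * z := by positivity
    linarith)
  have h3 : √2 + √(1 + 1) = √8 := by
    rw [show (8 : ℝ) = 2 ^ 2 * 2 by norm_num, Real.sqrt_mul (by norm_num),
      Real.sqrt_sq (by norm_num)]
    norm_num; ring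
  rw [h3, ← Real.sqrt_mul (by norm_num)]
  apply Real.sqrt_le_sqrt
  nlinarith

/-! ### The factors of the agents -/

/-- The determinant of `A ≥ c` grows at most exponentially in the trace of the update. -/
theorem det_add_le_mul_exp_trace {d : ℕ} {A B : Matrix (Fin d) (Fin d) ℝ} {c : ℝ} (hc : 0 < c)
    (hA : A.PosDef) (hAc : ∀ v, c * (v ⬝ᵥ v) ≤ v ⬝ᵥ (A *ᵥ v)) (hB : B.PosSemidef) :
    (A + B).det ≤ A.det * Real.exp (B.trace / c) := by
  obtain ⟨m, v, rfl⟩ := Matrix.posSemidef_iff_eq_sum_vecMulVec.1 hB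
  simp only [star_trivial]
  have key : ∀ u : Finset (Fin m), (A + ∑ i ∈ u, Matrix.vecMulVec (v i) (v i)).PosDef ∧
      (∀ w, c * (w ⬝ᵥ w) ≤ w ⬝ᵥ ((A + ∑ i ∈ u, Matrix.vecMulVec (v i) (v i)) *ᵥ w)) ∧
      (A + ∑ i ∈ u, Matrix.vecMulVec (v i) (v i)).det ≤
        A.det * Real.exp ((∑ i ∈ u, Matrix.vecMulVec (v i) (v i)).trace / c) := by
    intro u
    induction u using Finset.induction_on with
    | empty => simpa using ⟨hA, hAc⟩
    | insert i u hi ih =>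
      obtain ⟨ih1, ih2, ih3⟩ := ih
      rw [Finset.sum_insert hi, add_comm (Matrix.vecMulVec (v i) (v i)), ← add_assoc]
      refine ⟨posDef_add_vecMulVec ih1 _, fun w => ?_, ?_⟩
      · rw [Matrix.add_mulVec, dotProduct_add, quad_vecMulVec]
        nlinarith [ih2 w, sq_nonneg (v i ⬝ᵥ w)]
      · rw [det_add_vecMulVec ih1, Matrix.trace_add, Matrix.trace_vecMulVec, add_div, Real.exp_add,
          ← mul_assoc]
        have h1 : invSq (A + ∑ i ∈ u, Matrix.vecMulVec (v i) (v i)) (v i) ≤ (v i ⬝ᵥ v i) / c := by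
          have := invSq_le_of_quad_le (A := c • (1 : Matrix (Fin d) (Fin d) ℝ))
            (Matrix.PosDef.one.smul hc) ih1 one_pos (fun w => by
            rw [Matrix.smul_mulVec, Matrix.one_mulVec, dotProduct_smul, smul_eq_mul, one_mul]
            exact ih2 w) (v i)
          refine this.trans (le_of_eq ?_)
          have hinv : (c • (1 : Matrix (Fin d) (Fin d) ℝ))⁻¹ = c⁻¹ • 1 := by
            apply Matrix.inv_eq_right_inv
            rw [smul_mul_smul_comm, mul_inv_cancel₀ hc.ne', one_mul, one_smul]
          rw [invSq, hinv, Matrix.smul_mulVec, Matrix.one_mulVec, dotProduct_smul, smul_eq_mul]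
          ring
        have h2 : 1 + invSq (A + ∑ i ∈ u, Matrix.vecMulVec (v i) (v i)) (v i) ≤
            Real.exp ((v i ⬝ᵥ v i) / c) := by
          linarith [Real.add_one_le_exp ((v i ⬝ᵥ v i) / c)]
        exact mul_le_mul ih3 h2 (by linarith [invSq_nonneg ih1 (v i)])
          (mul_nonneg hA.det_pos.le (Real.exp_pos _).le)
  exact (key Finset.univ).2.2

namespace Spec

variable {M K d : ℕ} {P : Spec M K d}

/-- The assumptions on the instance and the parameters under which the confidence radius is
valid. -/
structure Tuned (P : Spec M K d) : Prop where
  M_pos : 0 < M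
  K_pos : 0 < K
  d_pos : 0 < d
  norm_x : ∀ k, P.x k ⬝ᵥ P.x k ≤ 1
  norm_theta : P.theta ⬝ᵥ P.theta ≤ 1
  sigma_pos : 0 < P.sigma
  delta_pos : 0 < P.delta
  delta_lt : P.delta < 1
  gamma1_eq : P.gamma1 = 1 / (M : ℝ) ^ 2
  gamma2_eq : P.gamma2 = 1 / (2 * (M : ℝ) * (K : ℝ))
  lam_pos : 0 < P.lam

/-- The matrix of a data set is the regularized covariance matrix of its counts, and every arm has
been pulled. -/
structure Regular (P : Spec M K d) (S : Stats K d) : Prop where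
  V_eq : S.V = P.regCov S.T
  one_le : ∀ k, 1 ≤ S.T k

theorem Consistent.regular_server {s : State M K d} (hs : P.Consistent s) : P.Regular s.server :=
  ⟨hs.server_V, hs.one_le_server⟩

theorem Consistent.regular_agent {s : State M K d} (hs : P.Consistent s) (m : Fin M) :
    P.Regular (s.agent m) := ⟨hs.agent_V m, hs.one_le m⟩

theorem Regular.posDef {S : Stats K d} (h : P.Regular S) (hP : P.Tuned) : S.V.PosDef := by
  rw [h.V_eq]; exact posDef_regCov hP.lam_pos _

theorem Regular.add {S L : Stats K d} (h : P.Regular S) (hL : L.V = P.cov L.T) :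
    P.Regular (S.add L) := by
  refine ⟨?_, fun k => (h.one_le k).trans (by simp [Stats.add])⟩
  simp only [Stats.add, regCov_add, h.V_eq, hL]

/-- The rescaled number of observations in a snapshot. -/
def load (P : Spec M K d) (S : Stats K d) : ℝ := M * S.count / (2 * K * P.lam)

/-- The determinant of the covariance matrix relative to that without data. -/
def detRatio (P : Spec M K d) (S : Stats K d) : ℝ := S.V.det / P.lam ^ d

/-- A number `E` with `V ≥ λ E` for the covariance matrix `V` of the snapshot, see `effDet`. -/
def eff (P : Spec M K d) (S : Stats K d) : ℝ := effDet d (P.detRatio S)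

/-- The value to which the factor of an agent is reset at a download, up to a small part. -/
def resetValue (P : Spec M K d) (S : Stats K d) : ℝ := (√(1 + P.load S))⁻¹

/-- The weight of the mixture in the factor of an agent with snapshot `S`. It is so small that it is
paid for by the decrease of `resetValue` at a communication. -/
def weight (P : Spec M K d) (S : Stats K d) : ℝ :=
  min (P.eff S) (P.load S) / (5 * (M * K)) * ((1 + P.load S) * √(1 + P.load S))⁻¹

/-- The scale of the regularization in the mixture of an agent with snapshot `S`, relative to the
covariance matrix of the snapshot: a tenth of what the unsent data can reach before a trigger. -/
def scale (P : Spec M K d) (S : Stats K d) : ℝ :=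
  P.gamma1 * (min (P.eff S) (P.load S) / P.eff S) / 10

/-- The factor of an agent with snapshot `S` and unsent data `L` in the supermartingale for the
unsent data. Between communications the mixture is a supermartingale; at a communication the factor
drops to `resetValue + weight` of the new snapshot, which is at most `resetValue` of the old one.
Thus the product of the factors is a supermartingale over all rounds, and no union bound over the
communications is needed. -/
def factor (P : Spec M K d) (S L : Stats K d) : ℝ :=
  P.resetValue S + P.weight S *
    mixture P.sigma (P.scale S • S.V) (P.scale S • S.V + L.V) (P.dev L)

section Basic

theorem Tuned.M_pos' (hP : P.Tuned) : (0 : ℝ) < M := by exact_mod_cast hP.M_pos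

theorem Tuned.K_pos' (hP : P.Tuned) : (0 : ℝ) < K := by exact_mod_cast hP.K_pos

theorem Tuned.d_pos' (hP : P.Tuned) : (0 : ℝ) < d := by exact_mod_cast hP.d_pos

theorem Tuned.gamma1_pos (hP : P.Tuned) : 0 < P.gamma1 := by
  rw [hP.gamma1_eq]; have := hP.M_pos'; positivity

theorem Tuned.gamma2_pos (hP : P.Tuned) : 0 < P.gamma2 := by
  rw [hP.gamma2_eq]; have := hP.M_pos'; have := hP.K_pos'; positivity

theorem Tuned.consistent_run (hP : P.Tuned) (act : ℕ → Fin M) (noise : ℕ → ℝ) (n : ℕ) :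
    P.Consistent (P.run act noise n) :=
  Spec.consistent_run hP.gamma1_pos.le hP.gamma2_pos.le hP.lam_pos act noise n

variable {S : Stats K d}

theorem load_pos (hP : P.Tuned) (h : P.Regular S) : 0 < P.load S := by
  have := hP.M_pos'; have := hP.K_pos'; have := hP.lam_pos
  have := one_le_count hP.K_pos h.one_le
  unfold load; positivity

theorem count_eq_load (hP : P.Tuned) (S : Stats K d) :
    S.count / P.lam = 2 * K / M * P.load S := by
  have := hP.M_pos'.ne'; have := hP.K_pos'.ne'; have := hP.lam_pos.ne'
  unfold load; field_simp

theorem one_le_detRatio (hP : P.Tuned) (h : P.Regular S) : 1 ≤ P.detRatio S := by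
  rw [detRatio, le_div_iff₀ (pow_pos hP.lam_pos d), one_mul, h.V_eq]
  exact pow_le_det_regCov hP.lam_pos _

theorem one_le_eff (hP : P.Tuned) (h : P.Regular S) : 1 ≤ P.eff S :=
  one_le_effDet (one_le_detRatio hP h)

theorem min_eff_load_pos (hP : P.Tuned) (h : P.Regular S) : 0 < min (P.eff S) (P.load S) :=
  lt_min (by linarith [one_le_eff hP h]) (load_pos hP h)

theorem resetValue_pos (hP : P.Tuned) (h : P.Regular S) : 0 < P.resetValue S := by
  have := load_pos hP h
  unfold resetValue; positivity

theorem weight_pos (hP : P.Tuned) (h : P.Regular S) : 0 < P.weight S := by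
  have := load_pos hP h
  have := min_eff_load_pos hP h
  have := hP.M_pos'; have := hP.K_pos'
  unfold weight; positivity

theorem scale_pos (hP : P.Tuned) (h : P.Regular S) : 0 < P.scale S := by
  have := one_le_eff hP h
  have := min_eff_load_pos hP h
  have := hP.gamma1_pos
  unfold scale; positivity

theorem factor_empty (hP : P.Tuned) (h : P.Regular S) :
    P.factor S (Stats.empty K d) = P.resetValue S + P.weight S := by
  rw [factor, dev_empty]
  simp only [Stats.empty, add_zero]
  rw [mixture_self_zero _ ((h.posDef hP).smul (scale_pos hP h)), mul_one]

theorem detRatio_mono (hP : P.Tuned) {S S' : Stats K d} (h : P.Regular S) (h' : P.Regular S')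
    (hT : S.T ≤ S'.T) : P.detRatio S ≤ P.detRatio S' := by
  have := pow_pos hP.lam_pos d
  rw [detRatio, detRatio, h.V_eq, h'.V_eq]
  gcongr
  exact det_regCov_mono hP.lam_pos hT

theorem load_mono (hP : P.Tuned) {S S' : Stats K d} (hT : S.T ≤ S'.T) : P.load S ≤ P.load S' := by
  have := hP.lam_pos
  unfold load
  gcongr
  exact count_mono hT

/-- Convexity of `t ↦ 1 / √t`. -/
theorem inv_sqrt_sub_ge {a b : ℝ} (ha : 0 < a) (hab : a ≤ b) :
    (b - a) / 2 * (b * √b)⁻¹ ≤ (√a)⁻¹ - (√b)⁻¹ := by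
  have hb := ha.trans_le hab
  have hp := Real.sqrt_pos.2 ha
  have hq := Real.sqrt_pos.2 hb
  have hpq := Real.sqrt_le_sqrt hab
  have ea : √a ^ 2 = a := Real.sq_sqrt ha.le
  have eb : √b ^ 2 = b := Real.sq_sqrt hb.le
  set p := √a
  set q := √b
  rw [← ea, ← eb, inv_sub_inv hp.ne' hq.ne', ← div_eq_mul_inv, div_le_div_iff₀ (by positivity)
    (by positivity)]
  have : 0 ≤ (q - p) * (2 * q ^ 2 - p * q - p ^ 2) :=
    mul_nonneg (by linarith) (by nlinarith)
  nlinarith [mul_nonneg this hq.le]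

/-- The weight is paid for by an increase of the load from `z₀`. -/
theorem weight_le_of_load {z₀ : ℝ} (hP : P.Tuned) (h : P.Regular S) (hz₀ : 0 ≤ z₀)
    (hle : z₀ ≤ P.load S)
    (hmin : min (P.eff S) (P.load S) / (5 * (M * K)) ≤ (P.load S - z₀) / 2) :
    P.resetValue S + P.weight S ≤ (√(1 + z₀))⁻¹ := by
  have hz := load_pos hP h
  have h1 := inv_sqrt_sub_ge (a := 1 + z₀) (b := 1 + P.load S) (by linarith) (by linarith)
  have h2 : P.weight S ≤ (P.load S - z₀) / 2 * ((1 + P.load S) * √(1 + P.load S))⁻¹ := by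
    unfold weight; gcongr
  rw [show 1 + P.load S - (1 + z₀) = P.load S - z₀ by ring] at h1
  rw [resetValue]
  linarith

theorem resetValue_add_weight_le_one (hP : P.Tuned) (h : P.Regular S) :
    P.resetValue S + P.weight S ≤ 1 := by
  have hz := load_pos hP h
  have hM : (1 : ℝ) ≤ M := by exact_mod_cast hP.M_pos
  have hK : (1 : ℝ) ≤ K := by exact_mod_cast hP.K_pos
  have := weight_le_of_load hP h le_rfl hz.le (by
    rw [div_le_iff₀ (by positivity)]
    have : 1 ≤ (M : ℝ) * K := one_le_mul_of_one_le_of_one_le hM hK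
    have := min_le_right (P.eff S) (P.load S)
    nlinarith)
  simpa using this

theorem lam_mul_le_quad_regCov (T : Fin K → ℕ) (v : Fin d → ℝ) :
    P.lam * (v ⬝ᵥ v) ≤ v ⬝ᵥ (P.regCov T *ᵥ v) := by
  rw [quad_regCov]
  linarith [quad_nonneg (posSemidef_cov (P := P) T) v]

theorem trace_cov_le (hP : P.Tuned) (L : Stats K d) (hL : L.V = P.cov L.T) :
    L.V.trace ≤ L.count := by
  rw [hL, cov, Matrix.trace_sum, Stats.count]
  gcongr with k
  rw [Matrix.trace_smul, Matrix.trace_vecMulVec, smul_eq_mul]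
  exact mul_le_of_le_one_right (Nat.cast_nonneg _) (hP.norm_x k)

/-- In dimension one the relative determinant grows at most as fast as the relative number of
observations. -/
theorem detRatio_sub_le {P : Spec M K 1} (hP : P.Tuned) {S S' : Stats K 1} (h : P.Regular S)
    (h' : P.Regular S') (hT : S.T ≤ S'.T) :
    P.detRatio S' - P.detRatio S ≤ (S'.count - S.count) / P.lam := by
  have hlam := hP.lam_pos
  rw [detRatio, detRatio, pow_one, ← sub_div, h.V_eq, h'.V_eq]
  refine div_le_div_of_nonneg_right ?_ hlam.le
  rw [Matrix.det_fin_one, Matrix.det_fin_one, regCov, regCov, cov, cov, Stats.count, Stats.count]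
  simp only [Matrix.add_apply, Matrix.sum_apply, Matrix.smul_apply, Matrix.vecMulVec_apply,
    smul_eq_mul]
  rw [add_sub_add_left_eq_sub, ← Finset.sum_sub_distrib, ← Finset.sum_sub_distrib]
  refine Finset.sum_le_sum fun k _ => ?_
  rw [← sub_mul]
  have h1 := hP.norm_x k
  simp only [dotProduct, Fin.sum_univ_one] at h1
  have h2 : (S.T k : ℝ) ≤ S'.T k := by exact_mod_cast hT k
  exact mul_le_of_le_one_right (by linarith) h1

end Basic

theorem gamma1_le (hP : P.Tuned) (hM : 2 ≤ M) : P.gamma1 ≤ 1 / 4 := by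
  have hM' : (2 : ℝ) ≤ M := by exact_mod_cast hM
  rw [hP.gamma1_eq]
  exact one_div_le_one_div_of_le (by norm_num) (by nlinarith)

/-- A trigger fires only after enough new observations: the count trigger by definition, and the
determinant trigger since `n` observations increase the determinant at most by `n / λ` in dimension
one, and at most by the factor `exp (n / λ)` in general. -/
theorem load_sub_ge_of_trigger (hP : P.Tuned) (hM : 2 ≤ M) {S S' L : Stats K d}
    (h : P.Regular S) (h' : P.Regular S') (hL : L.V = P.cov L.T) (hle : S.T + L.T ≤ S'.T)
    (ht : P.Trigger S L) :
    min (P.eff S') (P.load S') / (5 * (M * K)) ≤ (P.load S' - P.load S) / 2 := by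
  have hM' : (2 : ℝ) ≤ M := by exact_mod_cast hM
  have hK' : (1 : ℝ) ≤ K := by exact_mod_cast hP.K_pos
  have hlam := hP.lam_pos
  have hg := gamma1_le hP hM
  have hg0 := hP.gamma1_pos
  have hMK : 2 ≤ (M : ℝ) * K := by nlinarith
  have hadd := h.add hL
  have hcount : S.count + L.count ≤ S'.count := by
    rw [← Stats.count_add]; exact count_mono hle
  have hz := load_pos hP h
  have hload : P.load S' - P.load S = M / (2 * K) * ((S'.count - S.count) / P.lam) := by
    unfold load; field_simp
  rcases (trigger_iff _ _).1 ht with ht | ht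
  · have hSL : (S.V + L.V).det ≤ S'.V.det := by
      have e : S.V + L.V = (S.add L).V := rfl
      rw [e, hadd.V_eq, h'.V_eq]
      exact det_regCov_mono hlam hle
    rcases eq_or_ne d 1 with rfl | hd1
    · have h1 := detRatio_sub_le hP h h' (le_trans (by intro k; simp) hle)
      have h2 : (1 + P.gamma1) * P.detRatio S ≤ P.detRatio S' := by
        rw [detRatio, detRatio, mul_div_assoc']
        gcongr
        linarith
      have h3 : P.detRatio S' * (4 / 5 * P.gamma1) ≤ P.detRatio S' - P.detRatio S := by
        have h4 := one_le_detRatio hP h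
        have h5 := mul_le_mul_of_nonneg_right h2 (show 0 ≤ 1 - 4 / 5 * P.gamma1 by linarith)
        have h6 : 0 ≤ P.detRatio S * (P.gamma1 * (1 / 4 - P.gamma1)) :=
          mul_nonneg (by linarith) (mul_nonneg hg0.le (by linarith))
        linarith
      have h4 : min (P.eff S') (P.load S') ≤ P.detRatio S' := by
        refine (min_le_left _ _).trans (le_of_eq ?_)
        simp [eff, effDet]
      rw [hload]
      calc min (P.eff S') (P.load S') / (5 * (M * K)) ≤ P.detRatio S' / (5 * (M * K)) := by gcongr
        _ = M / (2 * K) * (P.detRatio S' * (4 / 5 * P.gamma1)) / 2 := by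
          rw [hP.gamma1_eq]; field_simp; ring
        _ ≤ M / (2 * K) * ((S'.count - S.count) / P.lam) / 2 := by
          gcongr
          exact h3.trans h1
    · have h1 : min (P.eff S') (P.load S') ≤ 1 := by
        refine (min_le_left _ _).trans (le_of_eq ?_)
        simp [eff, effDet, hd1]
      have h2 : (S.V + L.V).det ≤ S.V.det * Real.exp (L.count / P.lam) := by
        have hS := h.posDef hP
        refine (det_add_le_mul_exp_trace hlam hS (fun v => ?_)
          (by rw [hL]; exact posSemidef_cov _)).trans ?_
        · rw [h.V_eq]; exact lam_mul_le_quad_regCov _ v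
        · have := trace_cov_le hP L hL
          have := hS.det_pos
          gcongr
      have h3 : 1 + P.gamma1 ≤ Real.exp (L.count / P.lam) := by
        have hS := (h.posDef hP).det_pos
        have : S.V.det * (1 + P.gamma1) ≤ S.V.det * Real.exp (L.count / P.lam) := by linarith
        exact le_of_mul_le_mul_left this hS
      have h4 : 4 / 5 * P.gamma1 ≤ L.count / P.lam := by
        have e1 : Real.log (1 + P.gamma1) ≤ L.count / P.lam :=
          (Real.log_le_iff_le_exp (by linarith)).2 h3
        have e2 := Real.one_sub_inv_le_log_of_pos (show 0 < 1 + P.gamma1 by linarith)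
        have e3 : 4 / 5 * P.gamma1 ≤ 1 - (1 + P.gamma1)⁻¹ := by
          rw [le_sub_iff_add_le, ← le_sub_iff_add_le', inv_eq_one_div, div_le_iff₀ (by linarith)]
          nlinarith
        linarith
      have h5 : L.count / P.lam ≤ (S'.count - S.count) / P.lam := by
        gcongr; linarith
      rw [hload]
      calc min (P.eff S') (P.load S') / (5 * (M * K)) ≤ 1 / (5 * (M * K)) := by gcongr
        _ = M / (2 * K) * (4 / 5 * P.gamma1) / 2 := by
          rw [hP.gamma1_eq]; field_simp; ring
        _ ≤ M / (2 * K) * ((S'.count - S.count) / P.lam) / 2 := by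
          gcongr
          exact h4.trans h5
  · have h1 : (1 + P.gamma2) * P.load S ≤ P.load S' := by
      unfold load
      rw [mul_div_assoc']
      refine div_le_div_of_nonneg_right ?_ (by positivity)
      calc (1 + P.gamma2) * (M * S.count) = M * ((1 + P.gamma2) * S.count) := by ring
        _ ≤ M * S'.count := by gcongr; linarith
    have h2 : min (P.eff S') (P.load S') ≤ P.load S' := min_le_right _ _
    rw [hP.gamma2_eq] at h1
    have h3 : (2 * (M * K) + 1) * P.load S ≤ 2 * (M * K) * P.load S' := by
      have e : (2 * (M * K) + 1) * P.load S = 2 * (M * K) * ((1 + 1 / (2 * M * K)) * P.load S) := by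
        field_simp
      rw [e]; gcongr
    have hz' := load_pos hP h'
    rw [div_le_iff₀ (by positivity)]
    nlinarith [mul_nonneg (sub_nonneg.2 hMK) hz'.le]

/-- At a communication the factor of the agent does not increase. -/
theorem factor_reset_le (hP : P.Tuned) (hM : 2 ≤ M) {S S' L : Stats K d}
    (h : P.Regular S) (h' : P.Regular S') (hL : L.V = P.cov L.T) (hle : S.T + L.T ≤ S'.T)
    (ht : P.Trigger S L) :
    P.factor S' (Stats.empty K d) ≤ P.resetValue S := by
  rw [factor_empty hP h']
  exact weight_le_of_load hP h' (load_pos hP h).le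
    (load_mono hP (le_trans (by intro k; simp) hle)) (load_sub_ge_of_trigger hP hM h h' hL hle ht)

end Spec

/-! ### Deviation bounds from the supermartingales -/

/-- The function `y ↦ y * (c - 2 * log y)` is increasing up to `exp (c / 2 - 1)`. -/
theorem mul_sub_log_mono {y Y c : ℝ} (hy : 0 < y) (hyY : y ≤ Y) (hc : 2 * Real.log Y + 2 ≤ c) :
    y * (c - 2 * Real.log y) ≤ Y * (c - 2 * Real.log Y) := by
  have hY := hy.trans_le hyY
  have h1 := Real.log_le_sub_one_of_pos (div_pos hY hy)
  rw [Real.log_div hY.ne' hy.ne'] at h1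
  have h2 := mul_le_mul_of_nonneg_left h1 hy.le
  rw [show y * (Y / y - 1) = Y - y by field_simp] at h2
  nlinarith [mul_nonneg (sub_nonneg.2 hyY) (sub_nonneg.2 hc)]

theorem det_smul_add_le {d : ℕ} {A B : Matrix (Fin d) (Fin d) ℝ} {c : ℝ}
    (hA : A.PosDef) (hB : B.PosSemidef) (h : ∀ v, v ⬝ᵥ (B *ᵥ v) ≤ c * (v ⬝ᵥ (A *ᵥ v)))
    (hc : 0 ≤ c) : (A + B).det ≤ (1 + c) ^ d * A.det := by
  have := det_le_det_of_quad_le (hA.add_posSemidef hB)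
    (hA.smul (show 0 < 1 + c by linarith)) fun v => by
      rw [Matrix.add_mulVec, dotProduct_add, Matrix.smul_mulVec, dotProduct_smul, smul_eq_mul]
      linarith [h v]
  rwa [Matrix.det_smul, Fintype.card_fin] at this

namespace Spec

variable {M K d : ℕ} {P : Spec M K d}

/-- Without a trigger the unsent data are small compared with the snapshot: the determinant trigger
bounds them by `γ₁ V`, and the count trigger by `γ₁ z λ`, where `V` is the covariance matrix and `z`
the load of the snapshot. -/
theorem quad_loc_le (hP : P.Tuned) {S L : Stats K d} (h : P.Regular S) (hL : L.V = P.cov L.T)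
    (ht : ¬ P.Trigger S L) (v : Fin d → ℝ) :
    v ⬝ᵥ (L.V *ᵥ v) ≤
      P.gamma1 * (min (P.eff S) (P.load S) / P.eff S) * (v ⬝ᵥ (S.V *ᵥ v)) := by
  rw [trigger_iff, not_or, not_lt, not_lt] at ht
  have hS := h.posDef hP
  have hE := one_le_eff hP h
  have hq := quad_nonneg hS.posSemidef v
  have hlam := hP.lam_pos
  have hg := hP.gamma1_pos
  rw [← min_div_div_right (by linarith : 0 ≤ P.eff S), div_self (by linarith : P.eff S ≠ 0)]
  rw [mul_min_of_nonneg _ _ hg.le, min_mul_of_nonneg _ _ hq]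
  refine le_min ?_ ?_
  · rw [mul_one]
    have h1 := one_add_quad_div_le_det_div hS (B := L.V) (by rw [hL]; exact posSemidef_cov _) v
    have h2 : S.V.det * (v ⬝ᵥ (L.V *ᵥ v)) ≤ S.V.det * (P.gamma1 * (v ⬝ᵥ (S.V *ᵥ v))) := by
      nlinarith [ht.1]
    exact le_of_mul_le_mul_left h2 hS.det_pos
  · have h1 : v ⬝ᵥ (L.V *ᵥ v) ≤ L.count * (v ⬝ᵥ v) := by
      rw [hL]; exact quad_cov_le hP.norm_x _ v
    have h2 : P.lam * P.eff S * (v ⬝ᵥ v) ≤ v ⬝ᵥ (S.V *ᵥ v) := by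
      rcases eq_or_ne d 1 with rfl | hd1
      · rw [eff, effDet, if_pos rfl, detRatio, pow_one, mul_div_cancel₀ _ hlam.ne',
          Matrix.det_fin_one]
        simp only [dotProduct, Matrix.mulVec, Fin.sum_univ_one]
        exact le_of_eq (by ring)
      · rw [eff, effDet, if_neg hd1, mul_one, h.V_eq]
        exact lam_mul_le_quad_regCov _ v
    have h3 : L.count / P.lam ≤ P.gamma1 * P.load S := by
      have e : P.gamma1 * P.load S = P.gamma2 * S.count / P.lam := by
        have := hP.M_pos'; have := hP.K_pos'
        rw [hP.gamma1_eq, hP.gamma2_eq, load]; field_simp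
      rw [e]
      have := ht.2
      gcongr
      linarith
    have hv : 0 ≤ v ⬝ᵥ v := by simpa using dotProduct_star_self_nonneg v
    calc v ⬝ᵥ (L.V *ᵥ v) ≤ L.count * (v ⬝ᵥ v) := h1
      _ = L.count / P.lam * (P.lam * (v ⬝ᵥ v)) := by field_simp
      _ ≤ P.gamma1 * P.load S * (P.lam * (v ⬝ᵥ v)) := by gcongr
      _ = P.gamma1 * (P.load S / P.eff S) * (P.lam * P.eff S * (v ⬝ᵥ v)) := by field_simp
      _ ≤ P.gamma1 * (P.load S / P.eff S) * (v ⬝ᵥ (S.V *ᵥ v)) := by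
        have := load_pos hP h
        gcongr

/-- The covariance matrix grows at least as fast as `eff`. -/
theorem quad_div_eff_le (hP : P.Tuned) {S S' : Stats K d} (h : P.Regular S) (h' : P.Regular S')
    (hT : S.T ≤ S'.T) (v : Fin d → ℝ) :
    (v ⬝ᵥ (S.V *ᵥ v)) / P.eff S ≤ (v ⬝ᵥ (S'.V *ᵥ v)) / P.eff S' := by
  have hE := one_le_eff hP h
  have hE' := one_le_eff hP h'
  rcases eq_or_ne d 1 with rfl | hd1
  · have e : ∀ S : Stats K 1, v ⬝ᵥ (S.V *ᵥ v) = P.eff S * (P.lam * (v ⬝ᵥ v)) := by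
      intro S
      rw [eff, effDet, if_pos rfl, detRatio, pow_one, ← mul_assoc, div_mul_cancel₀ _ hP.lam_pos.ne',
        Matrix.det_fin_one]
      simp only [dotProduct, Matrix.mulVec, Fin.sum_univ_one]
      ring
    rw [e S, e S', mul_div_cancel_left₀ _ (by linarith), mul_div_cancel_left₀ _ (by linarith)]
  · simp only [eff, effDet, if_neg hd1, div_one]
    rw [h.V_eq, h'.V_eq, quad_regCov, quad_regCov]
    linarith [quad_cov_mono (P := P) hT v]

theorem log_factor_ge (hP : P.Tuned) {S L : Stats K d} (h : P.Regular S) (hL : L.V = P.cov L.T) :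
    - (1 / 2) * Real.log (1 + P.load S) ≤ Real.log (P.factor S L) := by
  have hz := load_pos hP h
  have e : - (1 / 2) * Real.log (1 + P.load S) = Real.log (P.resetValue S) := by
    rw [resetValue, Real.log_inv, Real.log_sqrt (by linarith)]; ring
  rw [e]
  refine Real.log_le_log (resetValue_pos hP h) ?_
  have hV := (h.posDef hP).smul (scale_pos hP h)
  have hLp : L.V.PosSemidef := by rw [hL]; exact posSemidef_cov _
  exact le_add_of_nonneg_right (mul_nonneg (weight_pos hP h).le
    (mixture_pos _ hV (hV.add_posSemidef hLp) _).le)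

theorem factor_pos (hP : P.Tuned) {S L : Stats K d} (h : P.Regular S) (hL : L.V = P.cov L.T) :
    0 < P.factor S L := by
  have hV := (h.posDef hP).smul (scale_pos hP h)
  have hLp : L.V.PosSemidef := by rw [hL]; exact posSemidef_cov _
  exact add_pos_of_pos_of_nonneg (resetValue_pos hP h) (mul_nonneg (weight_pos hP h).le
    (mixture_pos _ hV (hV.add_posSemidef hLp) _).le)

/-- The determinants in the mixture cost at most a factor `11 ^ (-d / 2)`, since the unsent data are
at most ten times the regularization. -/
theorem log_mixture_loc_ge (hP : P.Tuned) {S L : Stats K d} (h : P.Regular S)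
    (hL : L.V = P.cov L.T) (ht : ¬ P.Trigger S L) :
    invSq (P.scale S • S.V + L.V) (P.dev L) / (2 * P.sigma ^ 2) - d * Real.log 11 / 2 ≤
      Real.log (mixture P.sigma (P.scale S • S.V) (P.scale S • S.V + L.V) (P.dev L)) := by
  have hV := (h.posDef hP).smul (scale_pos hP h)
  have hLp : L.V.PosSemidef := by rw [hL]; exact posSemidef_cov _
  have hW := hV.add_posSemidef hLp
  have hdet := det_smul_add_le hV hLp (c := 10) (fun v => by
    rw [Matrix.smul_mulVec, dotProduct_smul, smul_eq_mul]
    refine (quad_loc_le hP h hL ht v).trans (le_of_eq ?_)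
    rw [scale]; ring) (by norm_num)
  rw [mixture, Real.log_mul (Real.sqrt_pos.2 (div_pos hV.det_pos hW.det_pos)).ne'
    (Real.exp_pos _).ne', Real.log_exp, Real.log_sqrt (div_pos hV.det_pos hW.det_pos).le,
    Real.log_div hV.det_pos.ne' hW.det_pos.ne']
  have h1 := Real.log_le_log hW.det_pos hdet
  rw [Real.log_mul (by positivity) hV.det_pos.ne', Real.log_pow] at h1
  rw [show (1 : ℝ) + 10 = 11 by norm_num] at h1
  linarith

/-- The deviation of the unsent data of one agent is controlled by the factor of the agent; `E` and
`z` belong to the data of the server. -/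
theorem loc_deviation_le (hP : P.Tuned) {S L : Stats K d} (h : P.Regular S)
    (hL : L.V = P.cov L.T) (ht : ¬ P.Trigger S L) {E z : ℝ} (hE : P.eff S ≤ E)
    (hz : P.load S ≤ z) (hM : 2 ≤ M) :
    min (P.eff S) (P.load S) / E * invSq (P.scale S • S.V + L.V) (P.dev L) ≤ P.sigma ^ 2 *
      (2 * Real.log (P.factor S L) + (min E z / E * (d * Real.log 11 +
        2 * Real.log (5 * (M * K)) + 2 * Real.log (1 + z) - 2 * Real.log (min E z)) +
          Real.log (1 + z))) := by
  have hE1 := one_le_eff hP h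
  have hz0 := load_pos hP h
  have hY0 := min_eff_load_pos hP h
  have hM' : (2 : ℝ) ≤ M := by exact_mod_cast hM
  have hK' : (1 : ℝ) ≤ K := by exact_mod_cast hP.K_pos
  have hMK : 10 ≤ 5 * ((M : ℝ) * K) := by nlinarith
  have hσ := hP.sigma_pos
  have hR := log_factor_ge hP h hL
  have hmix := log_mixture_loc_ge hP h hL ht
  have hV := (h.posDef hP).smul (scale_pos hP h)
  have hLp : L.V.PosSemidef := by rw [hL]; exact posSemidef_cov _
  have hmixpos := mixture_pos P.sigma hV (hV.add_posSemidef hLp) (P.dev L)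
  have hF : Real.log (P.weight S) +
      Real.log (mixture P.sigma (P.scale S • S.V) (P.scale S • S.V + L.V) (P.dev L)) ≤
      Real.log (P.factor S L) := by
    rw [← Real.log_mul (weight_pos hP h).ne' hmixpos.ne']
    refine Real.log_le_log (mul_pos (weight_pos hP h) hmixpos) ?_
    exact le_add_of_nonneg_left (resetValue_pos hP h).le
  have hw : Real.log (P.weight S) = Real.log (min (P.eff S) (P.load S)) -
      Real.log (5 * (M * K)) - 3 / 2 * Real.log (1 + P.load S) := by
    have e : Real.log ((1 + P.load S) * √(1 + P.load S)) = 3 / 2 * Real.log (1 + P.load S) := by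
      rw [Real.log_mul (by positivity) (by positivity), Real.log_sqrt (by positivity)]
      ring
    rw [weight, Real.log_mul (by positivity) (by positivity), Real.log_div hY0.ne' (by positivity),
      Real.log_inv, e]
    ring
  have hlz : Real.log (1 + P.load S) ≤ Real.log (1 + z) := Real.log_le_log (by linarith)
    (by linarith)
  have hmono : min (P.eff S) (P.load S) * (d * Real.log 11 + 2 * Real.log (5 * (M * K)) +
      2 * Real.log (1 + z) - 2 * Real.log (min (P.eff S) (P.load S))) ≤
      min E z * (d * Real.log 11 + 2 * Real.log (5 * (M * K)) +
      2 * Real.log (1 + z) - 2 * Real.log (min E z)) := by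
    refine mul_sub_log_mono hY0 (min_le_min hE hz) ?_
    have h1 : Real.log (min E z) ≤ Real.log (1 + z) :=
      Real.log_le_log (lt_min (by linarith) (by linarith)) ((min_le_right _ _).trans (by linarith))
    have h2 : 1 ≤ Real.log (5 * (M * K)) := by
      rw [Real.le_log_iff_exp_le (by linarith)]
      linarith [Real.exp_one_lt_d9]
    have h3 : 0 ≤ Real.log 11 := Real.log_nonneg (by norm_num)
    have h4 : 0 ≤ d * Real.log 11 := by positivity
    linarith
  set Y := min (P.eff S) (P.load S)
  have hEp : 0 < E := by linarith
  have hη0 : 0 ≤ Y / E := by positivity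
  have hη1 : Y / E ≤ 1 := (div_le_one hEp).2 ((min_le_left _ _).trans hE)
  have hmono' : Y / E * (d * Real.log 11 + 2 * Real.log (5 * (M * K)) +
      2 * Real.log (1 + z) - 2 * Real.log Y) ≤
      min E z / E * (d * Real.log 11 + 2 * Real.log (5 * (M * K)) +
      2 * Real.log (1 + z) - 2 * Real.log (min E z)) := by
    rw [div_mul_eq_mul_div, div_mul_eq_mul_div]
    gcongr
  set q := invSq (P.scale S • S.V + L.V) (P.dev L)
  have hq : Y / E * q ≤ P.sigma ^ 2 * (2 * (Y / E * (q / (2 * P.sigma ^ 2)))) := by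
    apply le_of_eq; field_simp
  refine hq.trans (mul_le_mul_of_nonneg_left ?_ (sq_nonneg _))
  generalize q / (2 * P.sigma ^ 2) = r at *
  generalize Y / E = t at *
  -- the factor bounds the mixture with weight `t`, and `resetValue` with weight `1 - t`
  rw [hw] at hF
  have f1 := mul_le_mul_of_nonneg_left (hF.trans' (add_le_add_right hmix _)) hη0
  have f2 := mul_le_mul_of_nonneg_left hR (sub_nonneg.2 hη1)
  have f3 := mul_le_mul_of_nonneg_left hlz hη0
  linarith only [f1, f2, f3, hmono', hlz]

end Spec

theorem mul_sqrt_eq {a : ℝ} (ha : 0 ≤ a) (x : ℝ) : a * √x = √(a ^ 2 * x) := by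
  rw [Real.sqrt_mul (sq_nonneg _), Real.sqrt_sq ha]

namespace Spec

variable {M K d : ℕ} {P : Spec M K d}

/-- Passage from the norm of the mixture of an agent to the norm of the server. -/
theorem invSq_dev_loc_le (hP : P.Tuned) {S S' L : Stats K d} (h : P.Regular S)
    (h' : P.Regular S') (hT : S.T ≤ S'.T)
    (hL : L.V = P.cov L.T) (ht : ¬ P.Trigger S L) :
    invSq S'.V (P.dev L) ≤ 1.1 * P.gamma1 * (min (P.eff S) (P.load S) / P.eff S' *
      invSq (P.scale S • S.V + L.V) (P.dev L)) := by
  have hE := one_le_eff hP h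
  have hE' := one_le_eff hP h'
  have hY := min_eff_load_pos hP h
  have hg := hP.gamma1_pos
  have hV := (h.posDef hP).smul (scale_pos hP h)
  have hLp : L.V.PosSemidef := by rw [hL]; exact posSemidef_cov _
  rw [← mul_assoc]
  refine invSq_le_of_quad_le (hV.add_posSemidef hLp) (h'.posDef hP) (by positivity)
    (fun v => ?_) _
  have h1 := quad_loc_le hP h hL ht v
  have h2 := mul_le_mul_of_nonneg_left (quad_div_eff_le hP h h' hT v)
    (show 0 ≤ 1.1 * P.gamma1 * min (P.eff S) (P.load S) by positivity)
  rw [Matrix.add_mulVec, dotProduct_add, Matrix.smul_mulVec, dotProduct_smul, smul_eq_mul, scale]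
  calc _ ≤ 1.1 * P.gamma1 * (min (P.eff S) (P.load S) / P.eff S) * (v ⬝ᵥ (S.V *ᵥ v)) := by
        linarith
    _ = 1.1 * P.gamma1 * min (P.eff S) (P.load S) * (v ⬝ᵥ (S.V *ᵥ v) / P.eff S) := by ring
    _ ≤ 1.1 * P.gamma1 * min (P.eff S) (P.load S) * (v ⬝ᵥ (S'.V *ᵥ v) / P.eff S') := h2
    _ = _ := by ring

theorem quad_loc_le_server (hP : P.Tuned) {S S' L : Stats K d} (h : P.Regular S)
    (h' : P.Regular S') (hT : S.T ≤ S'.T)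
    (hL : L.V = P.cov L.T) (ht : ¬ P.Trigger S L) (v : Fin d → ℝ) :
    v ⬝ᵥ (L.V *ᵥ v) ≤
      P.gamma1 * (min (P.eff S') (P.load S') / P.eff S') * (v ⬝ᵥ (S'.V *ᵥ v)) := by
  have hE := one_le_eff hP h
  have hE' := one_le_eff hP h'
  have hg := hP.gamma1_pos
  have hY := min_eff_load_pos hP h
  have hV := quad_nonneg (h'.posDef hP).posSemidef v
  have hY' : min (P.eff S) (P.load S) ≤ min (P.eff S') (P.load S') :=
    min_le_min (effDet_mono (detRatio_mono hP h h' hT)) (load_mono hP hT)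
  calc _ ≤ P.gamma1 * (min (P.eff S) (P.load S) / P.eff S) * (v ⬝ᵥ (S.V *ᵥ v)) :=
        quad_loc_le hP h hL ht v
    _ = P.gamma1 * min (P.eff S) (P.load S) * (v ⬝ᵥ (S.V *ᵥ v) / P.eff S) := by ring
    _ ≤ P.gamma1 * min (P.eff S') (P.load S') * (v ⬝ᵥ (S'.V *ᵥ v) / P.eff S') := by
        have := div_nonneg (quad_nonneg (h.posDef hP).posSemidef v) (by linarith : 0 ≤ P.eff S)
        have := quad_div_eff_le hP h h' hT v
        have := hY.le.trans hY'
        gcongr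
    _ = _ := by ring

/-- The bound on twice the logarithm of a factor which enters the deviation of the unsent data. -/
def localLog (P : Spec M K d) (S : Stats K d) : ℝ :=
  min (P.eff S) (P.load S) / P.eff S * (d * Real.log 11 + 2 * Real.log (5 * (M * K)) +
    2 * Real.log (1 + P.load S) - 2 * Real.log (min (P.eff S) (P.load S))) +
      Real.log (1 + P.load S)

section Deviation

variable {s : State M K d} {a : Fin M}

theorem sum_erase_eq {G : Type*} [AddCommMonoid G] (a : Fin M) (f : Fin M → G) (h : f a = 0) :
    ∑ m, f m = ∑ m ∈ Finset.univ.erase a, f m := by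
  rw [← Finset.add_sum_erase _ _ (Finset.mem_univ a), h, zero_add]

theorem card_erase_eq (hP : P.Tuned) (a : Fin M) :
    ((Finset.univ.erase a).card : ℝ) = M - 1 := by
  rw [Finset.card_erase_of_mem (Finset.mem_univ a), Finset.card_univ, Fintype.card_fin,
    Nat.cast_sub hP.M_pos, Nat.cast_one]

/-- The deviation of the data not known to the server. -/
theorem sqrt_invSq_sum_dev_le (hP : P.Tuned) (hM : 2 ≤ M) (hs : P.Consistent s)
    (ha : s.agent a = s.server) (hla : s.loc a = Stats.empty K d) {A : ℝ}
    (hG : ∏ m, P.factor (s.agent m) (s.loc m) ≤ Real.exp A) :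
    √(invSq s.server.V (∑ m, P.dev (s.loc m))) ≤ P.sigma *
      √(1.1 * (1 - 1 / M) * (2 * (1 / M) * A + ((1 - 1 / M) * P.localLog s.server +
        1 / M * Real.log (1 + P.load s.server)))) := by
  have hV := hs.regular_server.posDef hP
  have hM0 := hP.M_pos'
  have hM1 : (2 : ℝ) ≤ M := by exact_mod_cast hM
  have hσ := hP.sigma_pos
  have hg := hP.gamma1_pos
  rw [sum_erase_eq a _ (by rw [hla, dev_empty])]
  have h1 := sqrt_invSq_sum_le hV (Finset.univ.erase a) fun m => P.dev (s.loc m)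
  refine h1.trans ?_
  rw [mul_sqrt_eq hσ.le]
  apply Real.le_sqrt_of_sq_le
  refine sq_sum_le_card_mul_sum_sq.trans ?_
  have h2 : ∀ m ∈ Finset.univ.erase a, √(invSq s.server.V (P.dev (s.loc m))) ^ 2 ≤
      1.1 * P.gamma1 * (P.sigma ^ 2 * (2 * Real.log (P.factor (s.agent m) (s.loc m)) +
        P.localLog s.server)) := by
    intro m _
    rw [Real.sq_sqrt (invSq_nonneg hV _)]
    refine (invSq_dev_loc_le hP (hs.regular_agent m) hs.regular_server (hs.agent_le m)
      (hs.loc_V m) (hs.not_trigger m)).trans ?_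
    refine mul_le_mul_of_nonneg_left ?_ (by positivity)
    exact loc_deviation_le hP (hs.regular_agent m) (hs.loc_V m) (hs.not_trigger m)
      (effDet_mono (detRatio_mono hP (hs.regular_agent m) hs.regular_server (hs.agent_le m)))
      (load_mono hP (hs.agent_le m)) hM
  have h3 : ∑ m ∈ Finset.univ.erase a, Real.log (P.factor (s.agent m) (s.loc m)) ≤
      A + 1 / 2 * Real.log (1 + P.load s.server) := by
    have hpos : ∀ m, 0 < P.factor (s.agent m) (s.loc m) := fun m =>
      factor_pos hP (hs.regular_agent m) (hs.loc_V m)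
    have h4 : ∑ m, Real.log (P.factor (s.agent m) (s.loc m)) ≤ A := by
      rw [← Real.log_prod fun m _ => (hpos m).ne',
        Real.log_le_iff_le_exp (Finset.prod_pos fun m _ => hpos m)]
      exact hG
    rw [← Finset.add_sum_erase _ _ (Finset.mem_univ a)] at h4
    have h5 := log_factor_ge hP (hs.regular_agent a) (hs.loc_V a)
    rw [ha] at h5 h4
    linarith
  have h6 := Finset.sum_le_sum h2
  rw [← Finset.mul_sum, ← Finset.mul_sum, Finset.sum_add_distrib, ← Finset.mul_sum,
    Finset.sum_const, nsmul_eq_mul] at h6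
  rw [card_erase_eq hP] at h6 ⊢
  have h7 : 1.1 * P.gamma1 * (P.sigma ^ 2 * (2 * ∑ m ∈ Finset.univ.erase a,
      Real.log (P.factor (s.agent m) (s.loc m)) + (M - 1) * P.localLog s.server)) ≤
      1.1 * P.gamma1 * (P.sigma ^ 2 * (2 * (A + 1 / 2 * Real.log (1 + P.load s.server)) +
        (M - 1) * P.localLog s.server)) := by gcongr
  refine (mul_le_mul_of_nonneg_left (h6.trans h7) (by linarith)).trans (le_of_eq ?_)
  rw [hP.gamma1_eq]
  field_simp
  ring

theorem quad_sum_loc_le (hP : P.Tuned) (hs : P.Consistent s) (hla : s.loc a = Stats.empty K d)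
    (v : Fin d → ℝ) :
    v ⬝ᵥ ((∑ m, (s.loc m).V) *ᵥ v) ≤ 1 / M * (1 - 1 / M) *
      (min (P.eff s.server) (P.load s.server) / P.eff s.server) * (v ⬝ᵥ (s.server.V *ᵥ v)) := by
  have hM0 := hP.M_pos'
  rw [sum_erase_eq a _ (by rw [hla]; rfl), Matrix.sum_mulVec, dotProduct_sum]
  have := Finset.sum_le_sum fun m (_ : m ∈ Finset.univ.erase a) =>
    quad_loc_le_server hP (hs.regular_agent m) hs.regular_server (hs.agent_le m)
      (hs.loc_V m) (hs.not_trigger m) v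
  rw [Finset.sum_const, nsmul_eq_mul, card_erase_eq hP] at this
  refine this.trans (le_of_eq ?_)
  rw [hP.gamma1_eq]
  field_simp

/-- The deviation of all data. -/
theorem sqrt_invSq_total_le (hP : P.Tuned) (hs : P.Consistent s)
    (hla : s.loc a = Stats.empty K d) {A κ : ℝ}
    (hκ : κ = min (P.eff s.server) (P.load s.server) / P.eff s.server) (Z : Fin d → ℝ)
    (hX : mixture P.sigma (P.lam • 1) (s.server.V + ∑ m, (s.loc m).V) Z ≤ Real.exp A) :
    √(invSq s.server.V Z) ≤ P.sigma * √((1 + 1 / M * (1 - 1 / M) * κ) *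
      (Real.log (P.detRatio s.server) + d * (1 / M * (1 - 1 / M) * κ) + 2 * A)) := by
  have hV := hs.regular_server.posDef hP
  have hM1 : (1 : ℝ) ≤ M := by exact_mod_cast hP.M_pos
  have hσ := hP.sigma_pos
  have hlam := hP.lam_pos
  have hκ0 : 0 ≤ κ := by
    rw [hκ]
    exact div_nonneg (min_eff_load_pos hP hs.regular_server).le
      (by linarith [one_le_eff hP hs.regular_server])
  have hu : 1 / (M : ℝ) ≤ 1 := (div_le_one (by linarith)).2 hM1
  have hu0 : 0 < 1 / (M : ℝ) := by positivity
  have hL : (∑ m, (s.loc m).V).PosSemidef := Matrix.posSemidef_sum _ fun m _ => by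
    rw [hs.loc_V]; exact posSemidef_cov _
  have hW := hV.add_posSemidef hL
  have hquad := quad_sum_loc_le hP hs hla
  rw [← hκ] at hquad
  have huκ : 0 ≤ 1 / (M : ℝ) * (1 - 1 / M) * κ := by
    have : 0 ≤ 1 - 1 / (M : ℝ) := by linarith
    positivity
  generalize 1 / (M : ℝ) * (1 - 1 / M) * κ = c at *
  have h0 : (P.lam • (1 : Matrix (Fin d) (Fin d) ℝ)).PosDef := posDef_smul_one hlam
  have hdet0 : (P.lam • (1 : Matrix (Fin d) (Fin d) ℝ)).det = P.lam ^ d := by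
    simp
  have hlog : invSq (s.server.V + ∑ m, (s.loc m).V) Z ≤ P.sigma ^ 2 *
      (Real.log ((s.server.V + ∑ m, (s.loc m).V).det / P.lam ^ d) + 2 * A) := by
    have h1 : Real.log (mixture P.sigma (P.lam • 1) (s.server.V + ∑ m, (s.loc m).V) Z) ≤ A :=
      (Real.log_le_iff_le_exp (mixture_pos _ h0 hW _)).2 hX
    rw [mixture, Real.log_mul (Real.sqrt_pos.2 (div_pos h0.det_pos hW.det_pos)).ne'
      (Real.exp_pos _).ne', Real.log_exp, Real.log_sqrt (div_pos h0.det_pos hW.det_pos).le, hdet0,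
      ← inv_div (s.server.V + ∑ m, (s.loc m).V).det (P.lam ^ d), Real.log_inv] at h1
    have h2 := mul_le_mul_of_nonneg_left h1 (show 0 ≤ 2 * P.sigma ^ 2 by positivity)
    rw [mul_add, mul_div_cancel₀ _ (by positivity : 2 * P.sigma ^ 2 ≠ 0)] at h2
    linarith
  have hdet : Real.log ((s.server.V + ∑ m, (s.loc m).V).det / P.lam ^ d) ≤
      Real.log (P.detRatio s.server) + d * c := by
    have h1 := det_smul_add_le hV hL hquad huκ
    have h2 : (s.server.V + ∑ m, (s.loc m).V).det / P.lam ^ d ≤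
        (1 + c) ^ d * P.detRatio s.server := by
      rw [detRatio, mul_div_assoc']
      gcongr
    have hD := one_le_detRatio hP hs.regular_server
    refine (Real.log_le_log (div_pos hW.det_pos (by positivity)) h2).trans ?_
    rw [Real.log_mul (by positivity) (by linarith), Real.log_pow, add_comm]
    gcongr
    linarith [Real.log_le_sub_one_of_pos (show 0 < 1 + c by linarith)]
  have hinv : invSq s.server.V Z ≤ (1 + c) * invSq (s.server.V + ∑ m, (s.loc m).V) Z := by
    refine invSq_le_of_quad_le hW hV (by linarith) (fun v => ?_) Z
    rw [Matrix.add_mulVec, dotProduct_add]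
    linarith [hquad v]
  rw [mul_sqrt_eq hσ.le]
  apply Real.sqrt_le_sqrt
  refine hinv.trans ?_
  calc (1 + c) * invSq (s.server.V + ∑ m, (s.loc m).V) Z ≤ (1 + c) * (P.sigma ^ 2 *
      (Real.log ((s.server.V + ∑ m, (s.loc m).V).det / P.lam ^ d) + 2 * A)) := by gcongr
    _ ≤ (1 + c) * (P.sigma ^ 2 * (Real.log (P.detRatio s.server) + d * c + 2 * A)) := by gcongr
    _ = _ := by ring

/-- The determinant is controlled by the load. -/
theorem log_detRatio_le (hP : P.Tuned) {S : Stats K d} (h : P.Regular S) :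
    Real.log (P.detRatio S) ≤ d * Real.log (1 + 2 * K / (M * d) * P.load S) := by
  have hD := one_le_detRatio hP h
  have hlam := hP.lam_pos
  have hd := hP.d_pos'
  rw [← Real.log_pow]
  refine Real.log_le_log (by linarith) ?_
  rw [detRatio, div_le_iff₀ (by positivity), mul_comm, h.V_eq]
  refine (det_regCov_le hP.d_pos hlam hP.norm_x S.T).trans (le_of_eq ?_)
  have e : S.count / (P.lam * d) = 2 * K / (M * d) * P.load S := by
    rw [← div_div, count_eq_load hP]; field_simp
  rw [← e, Stats.count]

/-- The confidence radius for the chosen `γ₁` and `γ₂`. -/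
theorem radius_eq (hP : P.Tuned) (S : Stats K d) :
    P.radius S = √P.lam + (√2 + √(1 + 1 / M)) * (P.sigma * √(d * (Real.log (2 / P.delta) +
      Real.log (1 + M * (2 * K + 1) * P.load S)))) := by
  have hM := hP.M_pos'
  have hM1 : (1 : ℝ) ≤ M := by exact_mod_cast hP.M_pos
  have hK := hP.K_pos'
  have hlam := hP.lam_pos
  have hc : 0 ≤ P.load S := by
    have := S.count_nonneg
    unfold load; positivity
  have e1 : √(2 * P.gamma1) * M = √2 := by
    rw [hP.gamma1_eq, Real.sqrt_mul (by norm_num), Real.sqrt_div (by norm_num), Real.sqrt_one,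
      Real.sqrt_sq hM.le]
    field_simp
  have e2 : P.gamma1 * M = 1 / M := by rw [hP.gamma1_eq]; field_simp
  have e3 : min P.gamma1 1 = P.gamma1 := by
    rw [hP.gamma1_eq]
    exact min_eq_left ((div_le_one (by positivity)).2 (by nlinarith))
  have e4 : (1 + P.gamma2 * M) * (∑ k, (S.T k : ℝ)) / (P.gamma1 * P.lam) =
      M * (2 * K + 1) * P.load S := by
    rw [hP.gamma1_eq, hP.gamma2_eq, load, Stats.count]; field_simp
  have hδ := hP.delta_pos
  rw [radius, e1, e2, e3, e4, Real.log_mul (by positivity) (by positivity)]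

/-- The bias of the ridge estimator. -/
theorem sqrt_invSq_theta_le (hP : P.Tuned) {S : Stats K d} (h : P.Regular S) :
    √(invSq S.V (P.lam • P.theta)) ≤ √P.lam := by
  have hlam := hP.lam_pos
  apply Real.sqrt_le_sqrt
  have h1 := invSq_le_of_quad_le (posDef_smul_one (d := d) hlam) (h.posDef hP) one_pos (fun v => by
    rw [quad_smul_one, one_mul, h.V_eq]; exact lam_mul_le_quad_regCov _ v) (P.lam • P.theta)
  have h2 : (P.lam • (1 : Matrix (Fin d) (Fin d) ℝ))⁻¹ = P.lam⁻¹ • 1 := by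
    apply Matrix.inv_eq_right_inv
    rw [smul_mul_smul_comm, mul_inv_cancel₀ hlam.ne', one_mul, one_smul]
  have h3 : invSq (P.lam • (1 : Matrix (Fin d) (Fin d) ℝ)) (P.lam • P.theta) =
      P.lam * (P.theta ⬝ᵥ P.theta) := by
    rw [invSq, h2, Matrix.smul_mulVec, Matrix.one_mulVec, smul_smul, inv_mul_cancel₀ hlam.ne',
      one_smul, smul_dotProduct, smul_eq_mul]
  rw [one_mul, h3] at h1
  nlinarith [hP.norm_theta]

theorem localLog_nonneg (hP : P.Tuned) {S : Stats K d} (h : P.Regular S) : 0 ≤ P.localLog S := by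
  have hz := load_pos hP h
  have hE := one_le_eff hP h
  have hY := min_eff_load_pos hP h
  have h1 : Real.log (min (P.eff S) (P.load S)) ≤ Real.log (1 + P.load S) :=
    Real.log_le_log hY ((min_le_right _ _).trans (by linarith))
  have h2 : 0 ≤ Real.log (1 + P.load S) := Real.log_nonneg (by linarith)
  have h3 : 0 ≤ Real.log 11 := Real.log_nonneg (by norm_num)
  have hM1 : (1 : ℝ) ≤ M := by exact_mod_cast hP.M_pos
  have hK1 : (1 : ℝ) ≤ K := by exact_mod_cast hP.K_pos
  have h4 : 0 ≤ Real.log (5 * (M * K)) := Real.log_nonneg (by nlinarith)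
  have h5 : 0 ≤ d * Real.log 11 := by positivity
  refine add_nonneg (mul_nonneg (div_nonneg hY.le (by linarith)) ?_) h2
  linarith

/-- If both supermartingales are at most `2 / δ`, the confidence radius is valid for the data of the
server at a time when some agent has downloaded them and has no unsent data. The noise sum of the
server is that of all data, `Z`, minus that of the unsent data, and minus the bias. -/
theorem abs_dotProduct_thetaHat_sub_le (hP : P.Tuned) (hs : P.Consistent s)
    (ha : s.agent a = s.server) (hla : s.loc a = Stats.empty K d) (Z : Fin d → ℝ)
    (hZ : Z = P.dev s.server + P.lam • P.theta + ∑ m, P.dev (s.loc m))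
    (hX : mixture P.sigma (P.lam • 1) (s.server.V + ∑ m, (s.loc m).V) Z ≤ 2 / P.delta)
    (hG : 2 ≤ M → ∏ m, P.factor (s.agent m) (s.loc m) ≤ 2 / P.delta) (y : Fin d → ℝ) :
    |y ⬝ᵥ (P.thetaHat s.server - P.theta)| ≤
      P.radius s.server * √(y ⬝ᵥ (s.server.V⁻¹ *ᵥ y)) := by
  have hV := hs.regular_server.posDef hP
  have hσ := hP.sigma_pos
  have hδ := hP.delta_pos
  have hδ' := hP.delta_lt
  have hexp : 2 / P.delta = Real.exp (Real.log (2 / P.delta)) :=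
    (Real.exp_log (by positivity)).symm
  have hA : Real.log 2 ≤ Real.log (2 / P.delta) := by
    refine Real.log_le_log (by norm_num) ?_
    rw [le_div_iff₀ hδ]; linarith
  have hA0 : 0 ≤ Real.log (2 / P.delta) := (Real.log_nonneg (by norm_num)).trans hA
  rw [hexp] at hX hG
  have hz := load_pos hP hs.regular_server
  have hD := one_le_detRatio hP hs.regular_server
  have hDz := log_detRatio_le hP hs.regular_server
  have htot := sqrt_invSq_total_le hP hs hla rfl Z hX
  have hdiff : P.thetaHat s.server - P.theta = s.server.V⁻¹ *ᵥ P.dev s.server := by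
    rw [thetaHat, dev, Matrix.mulVec_sub, inv_mulVec_mulVec hV]
  rw [hdiff]
  refine (dotProduct_inv_le hV y _).trans ?_
  rw [mul_comm]
  refine mul_le_mul_of_nonneg_right ?_ (Real.sqrt_nonneg _)
  have hdev : P.dev s.server = Z + (-(∑ m, P.dev (s.loc m)) + -(P.lam • P.theta)) := by
    rw [hZ]; abel
  have h1 : √(invSq s.server.V (P.dev s.server)) ≤ √(invSq s.server.V Z) +
      (√(invSq s.server.V (∑ m, P.dev (s.loc m))) + √P.lam) := by
    rw [hdev]
    refine (sqrt_invSq_add_le hV _ _).trans (add_le_add_right ?_ _)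
    refine (sqrt_invSq_add_le hV _ _).trans ?_
    rw [invSq_neg, invSq_neg]
    exact add_le_add_right (sqrt_invSq_theta_le hP hs.regular_server) _
  refine h1.trans ?_
  rw [radius_eq hP]
  rcases Nat.lt_or_ge M 2 with hM | hM
  · have hM1 : M = 1 := by have := hP.M_pos; omega
    subst hM1
    have hsum : ∑ m, P.dev (s.loc m) = 0 := by
      rw [sum_erase_eq a _ (by rw [hla, dev_empty])]
      rw [Finset.sum_eq_zero fun m hm => absurd (Subsingleton.elim m a) (Finset.ne_of_mem_erase hm)]
    rw [hsum, invSq_zero, Real.sqrt_zero]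
    have h2 := radius_inequality_one (K := K) (A := Real.log (2 / P.delta)) hP.d_pos hA0 hz
      (D := P.detRatio s.server) (by simpa using hDz)
    have h3 := mul_le_mul_of_nonneg_left h2 hσ.le
    norm_num at h3 htot ⊢
    linarith
  · have h2 := radius_inequality hM hP.K_pos hP.d_pos hA hz hD hDz rfl rfl
      (localLog_nonneg hP hs.regular_server)
    have h3 := sqrt_invSq_sum_dev_le hP hM hs ha hla (hG hM)
    have h4 := mul_le_mul_of_nonneg_left h2 hσ.le
    simp only [localLog, eff] at h3 h4 htot ⊢
    linarith

end Deviation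

end Spec

/-! ### Measurability of the states -/

section Measurability

variable {Ω : Type*} {m : MeasurableSpace Ω} {M K d : ℕ}

theorem measurable_select {ι β : Type*} [MeasurableSpace ι] [Countable ι]
    [MeasurableSingletonClass ι] [MeasurableSpace β] {f : ι → Ω → β} {a : Ω → ι}
    (hf : ∀ i, Measurable (f i)) (ha : Measurable a) : Measurable fun ω => f (a ω) ω :=
  (measurable_from_prod_countable_right (f := fun p : ι × Ω => f p.1 p.2) hf).comp
    (ha.prodMk measurable_id)

theorem measurable_det_of_entries {W : Ω → Matrix (Fin d) (Fin d) ℝ}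
    (hW : ∀ i j, Measurable fun ω => W ω i j) : Measurable fun ω => (W ω).det := by
  simp only [Matrix.det_apply']
  exact Finset.measurable_sum _ fun σ _ =>
    measurable_const.mul (Finset.measurable_prod _ fun i _ => hW _ _)

theorem measurable_inv_of_entries {W : Ω → Matrix (Fin d) (Fin d) ℝ}
    (hW : ∀ i j, Measurable fun ω => W ω i j) (i j : Fin d) :
    Measurable fun ω => (W ω)⁻¹ i j := by
  simp only [Matrix.inv_def, Ring.inverse_eq_inv', Matrix.smul_apply, smul_eq_mul,
    Matrix.adjugate_apply]
  refine (measurable_det_of_entries hW).inv.mul (measurable_det_of_entries fun k l => ?_)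
  simp only [Matrix.updateRow_apply]
  split_ifs
  · exact measurable_const
  · exact hW _ _

/-- All components of a random data set are measurable. -/
structure Stats.IsMeasurable (m : MeasurableSpace Ω) (S : Ω → Stats K d) : Prop where
  V : ∀ i j, Measurable[m] fun ω => (S ω).V i j
  b : ∀ i, Measurable[m] fun ω => (S ω).b i
  T : ∀ k, Measurable[m] fun ω => (S ω).T k

/-- All components of a random state are measurable. -/
structure State.IsMeasurable (m : MeasurableSpace Ω) (s : Ω → State M K d) : Prop where
  server : Stats.IsMeasurable m fun ω => (s ω).server
  agent : ∀ a, Stats.IsMeasurable m fun ω => (s ω).agent a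
  loc : ∀ a, Stats.IsMeasurable m fun ω => (s ω).loc a

namespace Stats.IsMeasurable

variable {S L : Ω → Stats K d}

theorem mono {m' : MeasurableSpace Ω} (h : m ≤ m') (hS : Stats.IsMeasurable m S) :
    Stats.IsMeasurable m' S :=
  ⟨fun i j => (hS.V i j).mono h le_rfl, fun i => (hS.b i).mono h le_rfl,
    fun k => (hS.T k).mono h le_rfl⟩

theorem const (S : Stats K d) : Stats.IsMeasurable m fun _ : Ω => S :=
  ⟨fun _ _ => measurable_const, fun _ => measurable_const, fun _ => measurable_const⟩

theorem add (hS : Stats.IsMeasurable m S) (hL : Stats.IsMeasurable m L) :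
    Stats.IsMeasurable m fun ω => (S ω).add (L ω) :=
  ⟨fun i j => (hS.V i j).add (hL.V i j), fun i => (hS.b i).add (hL.b i),
    fun k => (hS.T k).add (hL.T k)⟩

theorem ite {p : Ω → Prop} [DecidablePred p] (hp : MeasurableSet {ω | p ω})
    (hS : Stats.IsMeasurable m S) (hL : Stats.IsMeasurable m L) :
    Stats.IsMeasurable m fun ω => if p ω then S ω else L ω := by
  refine ⟨fun i j => ?_, fun i => ?_, fun k => ?_⟩
  · have h : Measurable fun ω => if p ω then (S ω).V i j else (L ω).V i j :=
      Measurable.ite hp (hS.V i j) (hL.V i j)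
    simpa only [apply_ite (fun S : Stats K d => S.V i j)] using h
  · have h : Measurable fun ω => if p ω then (S ω).b i else (L ω).b i :=
      Measurable.ite hp (hS.b i) (hL.b i)
    simpa only [apply_ite (fun S : Stats K d => S.b i)] using h
  · have h : Measurable fun ω => if p ω then (S ω).T k else (L ω).T k :=
      Measurable.ite hp (hS.T k) (hL.T k)
    simpa only [apply_ite (fun S : Stats K d => S.T k)] using h

theorem select {S : Fin M → Ω → Stats K d} (hS : ∀ a, Stats.IsMeasurable m (S a)) {a : Ω → Fin M}
    (ha : Measurable a) : Stats.IsMeasurable m fun ω => S (a ω) ω :=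
  ⟨fun i j => measurable_select (fun a => (hS a).V i j) ha,
    fun i => measurable_select (fun a => (hS a).b i) ha,
    fun k => measurable_select (fun a => (hS a).T k) ha⟩

theorem count (hS : Stats.IsMeasurable m S) : Measurable fun ω => (S ω).count :=
  Finset.measurable_sum _ fun k _ => (measurable_of_countable (fun n : ℕ => (n : ℝ))).comp (hS.T k)

theorem det (hS : Stats.IsMeasurable m S) : Measurable fun ω => (S ω).V.det :=
  measurable_det_of_entries hS.V

theorem inv (hS : Stats.IsMeasurable m S) (i j : Fin d) : Measurable fun ω => (S ω).V⁻¹ i j :=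
  measurable_inv_of_entries hS.V i j

variable {P : Spec M K d}

theorem dev (hS : Stats.IsMeasurable m S) : Measurable fun ω => P.dev (S ω) := by
  refine measurable_pi_lambda _ fun i => ?_
  exact (hS.b i).sub ((measurable_pi_apply i).comp
    (measurable_mulVec hS.V (measurable_const (a := P.theta))))

theorem obs {k : Ω → Fin K} {e : Ω → ℝ} (hk : Measurable k) (he : Measurable e) :
    Stats.IsMeasurable m fun ω => P.obs (k ω) (e ω) := by
  refine ⟨fun i j => ?_, fun i => ?_, fun j => ?_⟩
  · exact (measurable_of_countable fun k => Matrix.vecMulVec (P.x k) (P.x k) i j).comp hk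
  · exact (((measurable_of_countable fun k => P.x k ⬝ᵥ P.theta).comp hk).add he).mul
      ((measurable_of_countable fun k => P.x k i).comp hk)
  · exact (measurable_of_countable fun k => (Pi.single k 1 : Fin K → ℕ) j).comp hk

theorem thetaHat (hS : Stats.IsMeasurable m S) : Measurable fun ω => P.thetaHat (S ω) :=
  measurable_mulVec hS.inv (measurable_pi_lambda _ hS.b)

theorem radius (hS : Stats.IsMeasurable m S) : Measurable fun ω => P.radius (S ω) := by
  have h := hS.count
  simp only [Stats.count] at h
  simp only [Spec.radius]
  exact measurable_const.add (measurable_const.mul (measurable_const.mul (measurable_const.mul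
    (measurable_const.mul (measurable_const.add ((measurable_const.mul h).div_const _))).log).sqrt))

theorem best (hb : IsArgmaxRule P.bestRule) (hS : Stats.IsMeasurable m S) :
    Measurable fun ω => P.best (S ω) :=
  hb.1.comp (measurable_pi_lambda _ fun _ => measurable_dotProduct measurable_const hS.thetaHat)

theorem challenger (hb : IsArgmaxRule P.bestRule) (hc : IsArgmaxRule P.challengerRule)
    (hS : Stats.IsMeasurable m S) : Measurable fun ω => P.challenger (S ω) := by
  refine hc.1.comp (measurable_pi_lambda _ fun j => ?_)
  refine measurable_select (f := fun i ω => P.gapHat (S ω) j i + P.bonus (S ω) i j) (fun i => ?_)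
    (hS.best hb)
  exact (measurable_dotProduct measurable_const hS.thetaHat).add (hS.radius.mul
    (measurable_dotProduct measurable_const (measurable_mulVec hS.inv measurable_const)).sqrt)

theorem pull (hb : IsArgmaxRule P.bestRule) (hc : IsArgmaxRule P.challengerRule)
    (hS : Stats.IsMeasurable m S) : Measurable fun ω => P.pull (S ω) :=
  (measurable_of_countable fun q : Fin K × Fin K × (Fin K → ℕ) => P.armRule q.1 q.2.1 q.2.2).comp
    ((hS.best hb).prodMk ((hS.challenger hb hc).prodMk (measurable_pi_lambda _ hS.T)))

theorem measurableSet_trigger (hS : Stats.IsMeasurable m S) (hL : Stats.IsMeasurable m L) :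
    MeasurableSet {ω | P.Trigger (S ω) (L ω)} := by
  simp only [Spec.trigger_iff]
  exact (measurableSet_lt (measurable_const.mul hS.det)
    (measurable_det_of_entries fun i j => (hS.V i j).add (hL.V i j))).union
    (measurableSet_lt (measurable_const.mul hS.count) (hS.count.add hL.count))

theorem load (hS : Stats.IsMeasurable m S) : Measurable fun ω => P.load (S ω) :=
  (measurable_const.mul hS.count).div_const _

theorem eff (hS : Stats.IsMeasurable m S) : Measurable fun ω => P.eff (S ω) := by
  simp only [Spec.eff, effDet]
  split_ifs
  · exact hS.det.div_const _
  · exact measurable_const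

theorem resetValue (hS : Stats.IsMeasurable m S) : Measurable fun ω => P.resetValue (S ω) :=
  (measurable_const.add hS.load).sqrt.inv

theorem weight (hS : Stats.IsMeasurable m S) : Measurable fun ω => P.weight (S ω) :=
  ((hS.eff.min hS.load).div_const _).mul
    ((measurable_const.add hS.load).mul (measurable_const.add hS.load).sqrt).inv

theorem scale (hS : Stats.IsMeasurable m S) : Measurable fun ω => P.scale (S ω) :=
  (measurable_const.mul ((hS.eff.min hS.load).div hS.eff)).div_const _

end Stats.IsMeasurable

theorem measurable_mixture {W₀ W : Ω → Matrix (Fin d) (Fin d) ℝ} {s : Ω → Fin d → ℝ} {sigma : ℝ}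
    (h₀ : ∀ i j, Measurable fun ω => W₀ ω i j) (h : ∀ i j, Measurable fun ω => W ω i j)
    (hs : Measurable s) : Measurable fun ω => mixture sigma (W₀ ω) (W ω) (s ω) := by
  have h1 := measurable_invSq (measurable_inv_of_entries h) hs
  simp only [mixture]
  exact ((measurable_det_of_entries h₀).div (measurable_det_of_entries h)).sqrt.mul
    (h1.div_const _).exp

namespace State.IsMeasurable

variable {P : Spec M K d} {s : Ω → State M K d}

theorem newLoc (hb : IsArgmaxRule P.bestRule) (hc : IsArgmaxRule P.challengerRule)
    (hs : State.IsMeasurable m s) {a : Ω → Fin M} (ha : Measurable a) {e : Ω → ℝ}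
    (he : Measurable e) : Stats.IsMeasurable m fun ω => P.newLoc (s ω) (a ω) (e ω) :=
  (Stats.IsMeasurable.select hs.loc ha).add
    (Stats.IsMeasurable.obs ((Stats.IsMeasurable.select hs.agent ha).pull hb hc) he)

theorem mono {m' : MeasurableSpace Ω} (h : m ≤ m') (hs : State.IsMeasurable m s) :
    State.IsMeasurable m' s :=
  ⟨hs.server.mono h, fun a => (hs.agent a).mono h, fun a => (hs.loc a).mono h⟩

theorem step (hb : IsArgmaxRule P.bestRule) (hc : IsArgmaxRule P.challengerRule)
    (hs : State.IsMeasurable m s) {a : Ω → Fin M} (ha : Measurable a) {e : Ω → ℝ}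
    (he : Measurable e) : State.IsMeasurable m fun ω => P.step (s ω) (a ω) (e ω) := by
  classical
  have hL := newLoc hb hc hs ha he
  have hT := (Stats.IsMeasurable.select hs.agent ha).measurableSet_trigger (P := P) hL
  have hA : ∀ j, MeasurableSet {ω | j = a ω} := fun j =>
    measurableSet_eq_fun measurable_const ha
  have hSL := hs.server.add hL
  refine ⟨?_, fun j => ?_, fun j => ?_⟩
  · convert Stats.IsMeasurable.ite hT hSL hs.server using 2 with ω
    by_cases h : P.Trigger ((s ω).agent (a ω)) (P.newLoc (s ω) (a ω) (e ω))
    · rw [Spec.step_of_trigger h, if_pos h]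
    · rw [Spec.step_of_not_trigger h, if_neg h]
  · convert Stats.IsMeasurable.ite hT (Stats.IsMeasurable.ite (hA j) hSL (hs.agent j))
      (hs.agent j) using 2 with ω
    by_cases h : P.Trigger ((s ω).agent (a ω)) (P.newLoc (s ω) (a ω) (e ω))
    · rw [Spec.step_of_trigger h, if_pos h]
      simp [Function.update_apply]
    · rw [Spec.step_of_not_trigger h, if_neg h]
  · convert Stats.IsMeasurable.ite (hA j) (Stats.IsMeasurable.ite hT
      (Stats.IsMeasurable.const (Stats.empty K d)) hL) (hs.loc j) using 2 with ω
    by_cases h : P.Trigger ((s ω).agent (a ω)) (P.newLoc (s ω) (a ω) (e ω))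
    · rw [Spec.step_of_trigger h, if_pos h]
      simp [Function.update_apply]
    · rw [Spec.step_of_not_trigger h, if_neg h]
      simp [Function.update_apply]

theorem init {η : ℕ → Ω → ℝ} (hη : ∀ k < K, Measurable (η k)) :
    State.IsMeasurable m fun ω => P.init fun t => η t ω := by
  have hobs : ∀ k : Fin K, Stats.IsMeasurable m fun ω => P.obs k (η k ω) := fun k =>
    Stats.IsMeasurable.obs measurable_const (hη k k.2)
  have hS : Stats.IsMeasurable m fun ω => (P.init fun t => η t ω).server := by
    refine ⟨fun i j => ?_, fun i => ?_, fun k => ?_⟩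
    · simp only [Spec.init, Matrix.add_apply, Matrix.sum_apply]
      exact measurable_const.add (Finset.measurable_sum _ fun k _ => (hobs k).V i j)
    · simp only [Spec.init, Finset.sum_apply]
      exact Finset.measurable_sum _ fun k _ => (hobs k).b i
    · simp only [Spec.init, Finset.sum_apply]
      exact Finset.measurable_sum _ fun l _ => (hobs l).T k
  exact ⟨hS, fun _ => hS, fun _ => Stats.IsMeasurable.const _⟩

theorem factor (hs : State.IsMeasurable m s) (a : Fin M) :
    Measurable fun ω => P.factor ((s ω).agent a) ((s ω).loc a) := by
  have hS := hs.agent a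
  have hL := hs.loc a
  have h0 : ∀ i j, Measurable fun ω => (P.scale ((s ω).agent a) • ((s ω).agent a).V) i j :=
    fun i j => hS.scale.mul (hS.V i j)
  exact hS.resetValue.add (hS.weight.mul (measurable_mixture h0
    (fun i j => (h0 i j).add (hL.V i j)) hL.dev))

end State.IsMeasurable

end Measurability

variable {Ω : Type*} {mΩ : MeasurableSpace Ω} {μ : Measure Ω} {M K d : ℕ}

/-! ### The supermartingales of a run -/

/-- The supermartingale inequality of the mixture on an event known in advance. -/
theorem setLIntegral_mul_mixture_add_le [IsFiniteMeasure μ] {ℱ : Filtration ℕ mΩ} {η : ℕ → Ω → ℝ}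
    {sigma : ℝ} (hsigma : 0 < sigma) (hη : IsCondSubGaussian μ ℱ η sigma) (t : ℕ) {d : ℕ}
    {W₀ W : Ω → Matrix (Fin d) (Fin d) ℝ} {s x : Ω → Fin d → ℝ} {H : Ω → ℝ≥0∞}
    (h₀ : ∀ ω, (W₀ ω).PosDef) (h : ∀ ω, (W ω).PosDef)
    (hW₀m : ∀ i j, Measurable[ℱ t] fun ω => W₀ ω i j)
    (hWm : ∀ i j, Measurable[ℱ t] fun ω => W ω i j)
    (hs : Measurable[ℱ t] s) (hx : Measurable[ℱ t] x) (hH : Measurable[ℱ t] H)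
    {A : Set Ω} (hA : MeasurableSet[ℱ t] A) :
    ∫⁻ ω in A, H ω * ENNReal.ofReal (mixture sigma (W₀ ω) (W ω + Matrix.vecMulVec (x ω) (x ω))
      (s ω + η t ω • x ω)) ∂μ ≤
      ∫⁻ ω in A, H ω * ENNReal.ofReal (mixture sigma (W₀ ω) (W ω) (s ω)) ∂μ := by
  have hA' := ℱ.le t _ hA
  rw [← lintegral_indicator hA', ← lintegral_indicator hA']
  have := lintegral_mul_mixture_add_le hsigma hη t h₀ h (measurable_inv_of_entries hWm)
    ((measurable_det_of_entries hW₀m).div (measurable_det_of_entries hWm)) hs hx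
    (hH.indicator hA)
  simpa only [Set.indicator_mul_left] using this

namespace Spec

variable {P : Spec M K d} {ℱ : Filtration ℕ mΩ} {act : ℕ → Ω → Fin M} {η : ℕ → Ω → ℝ}

/-- The random state of the system after `K + n` rounds. -/
def state (P : Spec M K d) (act : ℕ → Ω → Fin M) (η : ℕ → Ω → ℝ) (n : ℕ) (ω : Ω) : State M K d :=
  P.run (fun t => act t ω) (fun t => η t ω) n

/-- The state after `K + n` rounds is known before the noise of round `K + n`. -/
theorem isMeasurable_state (hb : IsArgmaxRule P.bestRule) (hc : IsArgmaxRule P.challengerRule)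
    (hact : ∀ t, Measurable[ℱ t] (act t)) (hη : ∀ t, Measurable[ℱ (t + 1)] (η t)) (n : ℕ) :
    State.IsMeasurable (ℱ (K + n)) (P.state act η n) := by
  induction n with
  | zero => exact State.IsMeasurable.init fun k hk => (hη k).mono (ℱ.mono hk) le_rfl
  | succ n ih =>
    have hle : ℱ (K + n) ≤ ℱ (K + (n + 1)) := ℱ.mono (by omega)
    exact State.IsMeasurable.step hb hc (ih.mono hle) ((hact _).mono hle le_rfl) (hη (K + n))

/-- The supermartingale for all data, uploaded or not. The summand `P.lam • P.theta` removes the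
regularization from `P.dev s.server`, so that only noise remains. -/
def globalWealth (P : Spec M K d) (s : State M K d) : ℝ :=
  mixture P.sigma (P.lam • 1) (s.server.V + ∑ m, (s.loc m).V)
    (P.dev s.server + P.lam • P.theta + ∑ m, P.dev (s.loc m))

/-- The supermartingale for the unsent data: the product of the factors of the agents. -/
def localWealth (P : Spec M K d) (s : State M K d) : ℝ :=
  ∏ m, P.factor (s.agent m) (s.loc m)

theorem globalWealth_step (s : State M K d) (a : Fin M) (e : ℝ) :
    P.globalWealth (P.step s a e) = mixture P.sigma (P.lam • 1)
      (s.server.V + ∑ m, (s.loc m).V +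
        Matrix.vecMulVec (P.x (P.pull (s.agent a))) (P.x (P.pull (s.agent a))))
      (P.dev s.server + P.lam • P.theta + ∑ m, P.dev (s.loc m) +
        e • P.x (P.pull (s.agent a))) := by
  have h1 := total_step (P := P) (fun S => S.V) (fun _ _ => rfl) rfl s a e
  have h2 := total_step (P := P) P.dev dev_add dev_empty s a e
  rw [dev_obs] at h2
  rw [globalWealth, h1, add_right_comm (P.dev _), h2]
  congr 1
  abel

section Global

theorem posDef_total (hP : P.Tuned) {s : State M K d} (hs : P.Consistent s) :
    (s.server.V + ∑ m, (s.loc m).V).PosDef :=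
  (hs.regular_server.posDef hP).add_posSemidef (Matrix.posSemidef_sum _ fun m _ => by
    rw [hs.loc_V]; exact posSemidef_cov _)

theorem measurable_total_V {m : MeasurableSpace Ω} {s : Ω → State M K d}
    (hs : State.IsMeasurable m s) (i j : Fin d) :
    Measurable fun ω => ((s ω).server.V + ∑ m, ((s ω).loc m).V) i j := by
  simp only [Matrix.add_apply, Matrix.sum_apply]
  exact (hs.server.V i j).add (Finset.measurable_sum _ fun a _ => (hs.loc a).V i j)

theorem measurable_total_dev {m : MeasurableSpace Ω} {s : Ω → State M K d}
    (hs : State.IsMeasurable m s) : Measurable fun ω =>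
      P.dev (s ω).server + P.lam • P.theta + ∑ m, P.dev ((s ω).loc m) :=
  (hs.server.dev.add measurable_const).add (Finset.measurable_sum _ fun a _ => (hs.loc a).dev)

theorem measurable_globalWealth {m : MeasurableSpace Ω} {s : Ω → State M K d}
    (hs : State.IsMeasurable m s) : Measurable fun ω => P.globalWealth (s ω) :=
  measurable_mixture (fun _ _ => measurable_const) (measurable_total_V hs) (measurable_total_dev hs)

theorem setLIntegral_globalWealth_succ_le [IsProbabilityMeasure μ] (hP : P.Tuned)
    (hb : IsArgmaxRule P.bestRule) (hc : IsArgmaxRule P.challengerRule)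
    (hact : ∀ t, Measurable[ℱ t] (act t)) (hη : IsCondSubGaussian μ ℱ η P.sigma) (n : ℕ)
    {A : Set Ω} (hA : MeasurableSet[ℱ (K + n)] A) :
    ∫⁻ ω in A, ENNReal.ofReal (P.globalWealth (P.state act η (n + 1) ω)) ∂μ ≤
      ∫⁻ ω in A, ENNReal.ofReal (P.globalWealth (P.state act η n ω)) ∂μ := by
  have hs := isMeasurable_state hb hc hact (fun t => (hη t).1) n
  have hx : Measurable[ℱ (K + n)] fun ω =>
      P.x (P.pull ((P.state act η n ω).agent (act (K + n) ω))) :=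
    (measurable_of_countable P.x).comp
      ((Stats.IsMeasurable.select hs.agent (hact _)).pull hb hc)
  have := setLIntegral_mul_mixture_add_le (H := fun _ => 1) hP.sigma_pos hη (K + n)
    (W₀ := fun _ => P.lam • 1) (fun _ => posDef_smul_one hP.lam_pos)
    (fun ω => posDef_total hP (hP.consistent_run (fun t => act t ω) (fun t => η t ω) n))
    (fun _ _ => measurable_const) (measurable_total_V hs) (measurable_total_dev (P := P) hs) hx
    measurable_const hA
  simp only [one_mul] at this
  simp only [state, run, globalWealth_step] at this ⊢
  exact this

/-- The first `K` rounds, in which the arms are pulled one after the other. -/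
theorem lintegral_globalWealth_zero_le [IsProbabilityMeasure μ] (hP : P.Tuned)
    (hη : IsCondSubGaussian μ ℱ η P.sigma) :
    ∫⁻ ω, ENNReal.ofReal (P.globalWealth (P.state act η 0 ω)) ∂μ ≤ 1 := by
  set c : ℕ → Fin d → ℝ := fun i => if h : i < K then P.x ⟨i, h⟩ else 0 with hc
  have key : ∀ j : ℕ, (P.lam • (1 : Matrix (Fin d) (Fin d) ℝ) +
      ∑ i ∈ Finset.range j, Matrix.vecMulVec (c i) (c i)).PosDef ∧
      (Measurable[ℱ j] fun ω => ∑ i ∈ Finset.range j, η i ω • c i) ∧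
      ∫⁻ ω, ENNReal.ofReal (mixture P.sigma (P.lam • 1) (P.lam • (1 : Matrix (Fin d) (Fin d) ℝ) +
        ∑ i ∈ Finset.range j, Matrix.vecMulVec (c i) (c i))
          (∑ i ∈ Finset.range j, η i ω • c i)) ∂μ ≤ 1 := by
    intro j
    induction j with
    | zero =>
      refine ⟨by simpa using posDef_smul_one hP.lam_pos, by simp, ?_⟩
      simp [mixture_self_zero P.sigma (posDef_smul_one (d := d) hP.lam_pos)]
    | succ j ih =>
      obtain ⟨ih1, ih2, ih3⟩ := ih
      simp only [Finset.sum_range_succ, ← add_assoc]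
      refine ⟨posDef_add_vecMulVec ih1 _, ?_, ?_⟩
      · exact (ih2.mono (ℱ.mono (by omega)) le_rfl).add ((hη j).1.smul_const _)
      · have := setLIntegral_mul_mixture_add_le (H := fun _ => 1) hP.sigma_pos hη j
          (W₀ := fun _ => P.lam • 1) (fun _ => posDef_smul_one hP.lam_pos)
          (W := fun _ => P.lam • (1 : Matrix (Fin d) (Fin d) ℝ) +
            ∑ i ∈ Finset.range j, Matrix.vecMulVec (c i) (c i)) (x := fun _ => c j)
          (fun _ => ih1) (fun _ _ => measurable_const) (fun _ _ => measurable_const) ih2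
          measurable_const measurable_const MeasurableSet.univ
        simp only [one_mul, Measure.restrict_univ] at this
        exact this.trans ih3
  refine le_trans (le_of_eq (lintegral_congr fun ω => ?_)) (key K).2.2
  have hloc : ∀ m, (P.state act η 0 ω).loc m = Stats.empty K d := fun _ => rfl
  have hcx : ∀ k : Fin K, c k = P.x k := fun k => by simp [hc]
  have hV : (P.state act η 0 ω).server.V = P.lam • (1 : Matrix (Fin d) (Fin d) ℝ) +
      ∑ i ∈ Finset.range K, Matrix.vecMulVec (c i) (c i) := by
    rw [Finset.sum_range fun i => Matrix.vecMulVec (c i) (c i)]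
    simp only [hcx]
    rfl
  have hdev : P.dev (P.state act η 0 ω).server + P.lam • P.theta =
      ∑ i ∈ Finset.range K, η i ω • c i := by
    rw [Finset.sum_range fun i => η i ω • c i]
    simp only [hcx, ← dev_obs]
    simp only [state, run, init, dev, Matrix.add_mulVec, Matrix.sum_mulVec, Matrix.smul_mulVec,
      Matrix.one_mulVec, Finset.sum_sub_distrib]
    abel
  rw [globalWealth, hdev, hV]
  simp only [hloc, dev_empty, Finset.sum_const_zero, add_zero]
  congr 2
  simp [Stats.empty]

end Global

section Local

theorem localWealth_zero_le (hP : P.Tuned) (ω : Ω) :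
    P.localWealth (P.state act η 0 ω) ≤ 1 := by
  have hs : P.Consistent (P.state act η 0 ω) :=
    hP.consistent_run (fun t => act t ω) (fun t => η t ω) 0
  refine Finset.prod_le_one (fun m _ => (factor_pos hP (hs.regular_agent m) (hs.loc_V m)).le)
    fun m _ => ?_
  have hloc : (P.state act η 0 ω).loc m = Stats.empty K d := rfl
  rw [hloc, factor_empty hP (hs.regular_agent m)]
  exact resetValue_add_weight_le_one hP (hs.regular_agent m)

open Classical in
/-- In a round of agent `a` either its factor is reset, or its mixture takes a step. Whether the
trigger fires does not depend on the noise, so it may be evaluated with noise `0`. -/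
theorem localWealth_step_le (hP : P.Tuned) (hM : 2 ≤ M) {s : State M K d} (hs : P.Consistent s)
    (a : Fin M) (e : ℝ) :
    P.localWealth (P.step s a e) ≤
      (∏ m ∈ Finset.univ.erase a, P.factor (s.agent m) (s.loc m)) * P.resetValue (s.agent a) +
      (if P.Trigger (s.agent a) (P.newLoc s a 0) then 0 else
        (∏ m ∈ Finset.univ.erase a, P.factor (s.agent m) (s.loc m)) * P.weight (s.agent a)) *
      mixture P.sigma (P.scale (s.agent a) • (s.agent a).V)
        (P.scale (s.agent a) • (s.agent a).V + (s.loc a).V +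
          Matrix.vecMulVec (P.x (P.pull (s.agent a))) (P.x (P.pull (s.agent a))))
        (P.dev (s.loc a) + e • P.x (P.pull (s.agent a))) := by
  have hpos : ∀ m, 0 < P.factor (s.agent m) (s.loc m) := fun m =>
    factor_pos hP (hs.regular_agent m) (hs.loc_V m)
  have hrest : 0 ≤ ∏ m ∈ Finset.univ.erase a, P.factor (s.agent m) (s.loc m) :=
    Finset.prod_nonneg fun m _ => (hpos m).le
  have hT : P.Trigger (s.agent a) (P.newLoc s a 0) ↔ P.Trigger (s.agent a) (P.newLoc s a e) :=
    Iff.rfl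
  rw [localWealth, ← Finset.mul_prod_erase _ _ (Finset.mem_univ a)]
  by_cases h : P.Trigger (s.agent a) (P.newLoc s a e)
  · rw [if_pos (hT.2 h), zero_mul, add_zero, mul_comm, step_of_trigger h]
    simp only [Function.update_self]
    rw [Finset.prod_congr rfl fun m hm => by
      rw [Function.update_of_ne (Finset.ne_of_mem_erase hm),
        Function.update_of_ne (Finset.ne_of_mem_erase hm)]]
    refine mul_le_mul_of_nonneg_left ?_ hrest
    refine factor_reset_le hP hM (hs.regular_agent a)
      (hs.regular_server.add (newLoc_V hs a e)) (newLoc_V hs a e) ?_ h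
    exact add_le_add_left (hs.agent_le a) _
  · rw [if_neg (mt hT.1 h), step_of_not_trigger h]
    simp only [Function.update_self]
    rw [Finset.prod_congr rfl fun m hm => by
      rw [Function.update_of_ne (Finset.ne_of_mem_erase hm)]]
    have h1 : (P.newLoc s a e).V = (s.loc a).V +
        Matrix.vecMulVec (P.x (P.pull (s.agent a))) (P.x (P.pull (s.agent a))) := rfl
    have h2 : P.dev (P.newLoc s a e) = P.dev (s.loc a) + e • P.x (P.pull (s.agent a)) := by
      rw [newLoc, dev_add, dev_obs]
    rw [factor, h1, h2, ← add_assoc]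
    exact le_of_eq (by ring)

theorem setLIntegral_localWealth_succ_le [IsProbabilityMeasure μ] (hP : P.Tuned) (hM : 2 ≤ M)
    (hb : IsArgmaxRule P.bestRule) (hc : IsArgmaxRule P.challengerRule)
    (hact : ∀ t, Measurable[ℱ t] (act t)) (hη : IsCondSubGaussian μ ℱ η P.sigma) (n : ℕ)
    {A : Set Ω} (hA : MeasurableSet[ℱ (K + n)] A) :
    ∫⁻ ω in A, ENNReal.ofReal (P.localWealth (P.state act η (n + 1) ω)) ∂μ ≤
      ∫⁻ ω in A, ENNReal.ofReal (P.localWealth (P.state act η n ω)) ∂μ := by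
  classical
  have hs := isMeasurable_state hb hc hact (fun t => (hη t).1) n
  have hcons : ∀ ω, P.Consistent (P.state act η n ω) := fun ω =>
    hP.consistent_run (fun t => act t ω) (fun t => η t ω) n
  have ha := hact (K + n)
  have hSa := Stats.IsMeasurable.select hs.agent ha
  have hLa := Stats.IsMeasurable.select hs.loc ha
  set S : Ω → Stats K d := fun ω => (P.state act η n ω).agent (act (K + n) ω)
  set L : Ω → Stats K d := fun ω => (P.state act η n ω).loc (act (K + n) ω)
  have hx : Measurable[ℱ (K + n)] fun ω => P.x (P.pull (S ω)) :=
    (measurable_of_countable P.x).comp (hSa.pull hb hc)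
  set rest : Ω → ℝ := fun ω => ∏ m ∈ Finset.univ.erase (act (K + n) ω),
    P.factor ((P.state act η n ω).agent m) ((P.state act η n ω).loc m) with hrest
  have hrestm : Measurable[ℱ (K + n)] rest :=
    measurable_select (f := fun (a : Fin M) ω => ∏ m ∈ Finset.univ.erase a,
      P.factor ((P.state act η n ω).agent m) ((P.state act η n ω).loc m))
      (fun a => Finset.measurable_prod _ fun m _ => hs.factor m) ha
  have hrest0 : ∀ ω, 0 ≤ rest ω := fun ω => Finset.prod_nonneg fun m _ =>
    (factor_pos hP ((hcons ω).regular_agent m) ((hcons ω).loc_V m)).le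
  have htrig : MeasurableSet[ℱ (K + n)]
      {ω | P.Trigger (S ω) (P.newLoc (P.state act η n ω) (act (K + n) ω) 0)} :=
    hSa.measurableSet_trigger (State.IsMeasurable.newLoc hb hc hs ha measurable_const)
  set h : Ω → ℝ := fun ω => if P.Trigger (S ω) (P.newLoc (P.state act η n ω) (act (K + n) ω) 0)
    then 0 else rest ω * P.weight (S ω) with hh
  have hm : Measurable[ℱ (K + n)] h :=
    Measurable.ite htrig measurable_const (hrestm.mul hSa.weight)
  have hw0 : ∀ ω, 0 ≤ rest ω * P.weight (S ω) := fun ω =>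
    mul_nonneg (hrest0 ω) (weight_pos hP ((hcons ω).regular_agent _)).le
  have hh0 : ∀ ω, 0 ≤ h ω := fun ω => by
    simp only [hh]; split_ifs
    · exact le_rfl
    · exact hw0 ω
  have hr0 : ∀ ω, 0 ≤ rest ω * P.resetValue (S ω) := fun ω =>
    mul_nonneg (hrest0 ω) (resetValue_pos hP ((hcons ω).regular_agent _)).le
  have hV0 : ∀ ω, (P.scale (S ω) • (S ω).V).PosDef := fun ω =>
    (((hcons ω).regular_agent _).posDef hP).smul (scale_pos hP ((hcons ω).regular_agent _))
  have hLp : ∀ ω, (L ω).V.PosSemidef := fun ω => by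
    simp only [L]; rw [(hcons ω).loc_V]; exact posSemidef_cov _
  have hV : ∀ ω, (P.scale (S ω) • (S ω).V + (L ω).V).PosDef := fun ω =>
    (hV0 ω).add_posSemidef (hLp ω)
  have hV0m : ∀ i j, Measurable[ℱ (K + n)] fun ω => (P.scale (S ω) • (S ω).V) i j :=
    fun i j => hSa.scale.mul (hSa.V i j)
  have hkey := setLIntegral_mul_mixture_add_le (H := fun ω => ENNReal.ofReal (h ω)) hP.sigma_pos hη
    (K + n) hV0 hV hV0m (fun i j => (hV0m i j).add (hLa.V i j)) (hLa.dev (P := P)) hx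
    hm.ennreal_ofReal hA
  have hCm : Measurable fun ω => ENNReal.ofReal (rest ω * P.resetValue (S ω)) :=
    ((hrestm.mul hSa.resetValue).ennreal_ofReal).mono (ℱ.le _) le_rfl
  calc ∫⁻ ω in A, ENNReal.ofReal (P.localWealth (P.state act η (n + 1) ω)) ∂μ
      ≤ ∫⁻ ω in A, (ENNReal.ofReal (rest ω * P.resetValue (S ω)) + ENNReal.ofReal (h ω) *
        ENNReal.ofReal (mixture P.sigma (P.scale (S ω) • (S ω).V)
          (P.scale (S ω) • (S ω).V + (L ω).V +
            Matrix.vecMulVec (P.x (P.pull (S ω))) (P.x (P.pull (S ω))))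
          (P.dev (L ω) + η (K + n) ω • P.x (P.pull (S ω))))) ∂μ := by
        refine lintegral_mono fun ω => ?_
        rw [← ENNReal.ofReal_mul (hh0 ω), ← ENNReal.ofReal_add (hr0 ω)
          (mul_nonneg (hh0 ω) (mixture_pos _ (hV0 ω) (posDef_add_vecMulVec (hV ω) _) _).le)]
        exact ENNReal.ofReal_le_ofReal (localWealth_step_le hP hM (hcons ω) _ _)
    _ ≤ ∫⁻ ω in A, (ENNReal.ofReal (rest ω * P.resetValue (S ω)) + ENNReal.ofReal (h ω) *
        ENNReal.ofReal (mixture P.sigma (P.scale (S ω) • (S ω).V)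
          (P.scale (S ω) • (S ω).V + (L ω).V) (P.dev (L ω)))) ∂μ := by
        rw [lintegral_add_left hCm, lintegral_add_left hCm]
        exact add_le_add_right hkey _
    _ ≤ ∫⁻ ω in A, ENNReal.ofReal (P.localWealth (P.state act η n ω)) ∂μ := by
        refine lintegral_mono fun ω => ?_
        have hmix := (mixture_pos P.sigma (hV0 ω) (hV ω) (P.dev (L ω))).le
        rw [← ENNReal.ofReal_mul (hh0 ω), ← ENNReal.ofReal_add (hr0 ω)
          (mul_nonneg (hh0 ω) hmix)]
        refine ENNReal.ofReal_le_ofReal ?_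
        have hle : h ω ≤ rest ω * P.weight (S ω) := by
          simp only [hh]; split_ifs
          · exact hw0 ω
          · exact le_rfl
        have e : P.localWealth (P.state act η n ω) = P.factor (S ω) (L ω) * rest ω := by
          rw [localWealth, ← Finset.mul_prod_erase _ _ (Finset.mem_univ (act (K + n) ω))]
        rw [e, factor]
        nlinarith [mul_le_mul_of_nonneg_right hle hmix]

end Local

/-- Both supermartingales stay below `2 / δ` at all times. -/
def Good (P : Spec M K d) (act : ℕ → Fin M) (noise : ℕ → ℝ) : Prop :=
  ∀ n, P.globalWealth (P.run act noise n) ≤ 2 / P.delta ∧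
    (2 ≤ M → P.localWealth (P.run act noise n) ≤ 2 / P.delta)

/-- Ville's inequality at the level `2 / δ`. -/
theorem measure_exists_le [IsProbabilityMeasure μ] (hP : P.Tuned) {X : ℕ → Ω → ℝ}
    (hX : ∀ n, Measurable[ℱ (K + n)] (X n))
    (hstep : ∀ n A, MeasurableSet[ℱ (K + n)] A →
      ∫⁻ ω in A, ENNReal.ofReal (X (n + 1) ω) ∂μ ≤ ∫⁻ ω in A, ENNReal.ofReal (X n ω) ∂μ)
    (h0 : ∫⁻ ω, ENNReal.ofReal (X 0 ω) ∂μ ≤ 1) :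
    μ {ω | ∃ n, 2 / P.delta ≤ X n ω} ≤ ENNReal.ofReal (P.delta / 2) := by
  have hδ := hP.delta_pos
  have h := (ville (μ := μ) (ℱ := fun n => (ℱ (K + n) : MeasurableSpace Ω))
    (fun i j hij => ℱ.mono (by omega)) (fun n => ℱ.le _)
    (fun n => (hX n).ennreal_ofReal) hstep (ENNReal.ofReal (2 / P.delta))).trans h0
  have hsub : {ω | ∃ n, 2 / P.delta ≤ X n ω} ⊆
      {ω | ∃ n, ENNReal.ofReal (2 / P.delta) ≤ ENNReal.ofReal (X n ω)} :=
    fun ω ⟨n, hn⟩ => ⟨n, ENNReal.ofReal_le_ofReal hn⟩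
  refine (measure_mono hsub).trans ?_
  have hpos : 0 < 2 / P.delta := by positivity
  have hinv : ENNReal.ofReal (P.delta / 2) * ENNReal.ofReal (2 / P.delta) = 1 := by
    rw [← ENNReal.ofReal_mul (by positivity), div_mul_div_comm, mul_comm P.delta,
      div_self (by positivity), ENNReal.ofReal_one]
  calc _ = ENNReal.ofReal (P.delta / 2) * (ENNReal.ofReal (2 / P.delta) * _) := by
        rw [← mul_assoc, hinv, one_mul]
    _ ≤ ENNReal.ofReal (P.delta / 2) * 1 := mul_le_mul_right h _
    _ = _ := mul_one _

/-- The good event has probability at least `1 - δ`. -/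
theorem measure_good_ge [IsProbabilityMeasure μ] (hP : P.Tuned)
    (hb : IsArgmaxRule P.bestRule) (hc : IsArgmaxRule P.challengerRule)
    (hact : ∀ t, Measurable[ℱ t] (act t)) (hη : IsCondSubGaussian μ ℱ η P.sigma) :
    ENNReal.ofReal (1 - P.delta) ≤ μ {ω | P.Good (fun t => act t ω) (fun t => η t ω)} := by
  have hδ := hP.delta_pos
  have hs := isMeasurable_state (P := P) hb hc hact (fun t => (hη t).1)
  have h1 := measure_exists_le hP (fun n => measurable_globalWealth (hs n))
    (fun n A hA => setLIntegral_globalWealth_succ_le hP hb hc hact hη n hA)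
    (lintegral_globalWealth_zero_le hP hη)
  have h2 : 2 ≤ M → μ {ω | ∃ n, 2 / P.delta ≤ P.localWealth (P.state act η n ω)} ≤
      ENNReal.ofReal (P.delta / 2) := fun hM =>
    measure_exists_le hP
      (fun n => Finset.measurable_prod _ fun m _ => (hs n).factor m)
      (fun n A hA => setLIntegral_localWealth_succ_le hP hM hb hc hact hη n hA)
      ((lintegral_mono fun ω => ENNReal.ofReal_le_ofReal (localWealth_zero_le hP ω)).trans
        (by simp))
  have h3 : μ {ω | 2 ≤ M ∧ ∃ n, 2 / P.delta ≤ P.localWealth (P.state act η n ω)} ≤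
      ENNReal.ofReal (P.delta / 2) := by
    by_cases hM : 2 ≤ M
    · simpa [hM] using h2 hM
    · simp [hM]
  have hcover : (Set.univ : Set Ω) ⊆ {ω | P.Good (fun t => act t ω) (fun t => η t ω)} ∪
      ({ω | ∃ n, 2 / P.delta ≤ P.globalWealth (P.state act η n ω)} ∪
        {ω | 2 ≤ M ∧ ∃ n, 2 / P.delta ≤ P.localWealth (P.state act η n ω)}) := by
    intro ω _
    by_contra hω
    simp only [Set.mem_union, Set.mem_ofPred_eq, not_or, not_exists, not_and, not_le] at hω
    exact hω.1 fun n => ⟨(hω.2.1 n).le, fun hM => (hω.2.2 hM n).le⟩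
  have h4 : 1 ≤ μ {ω | P.Good (fun t => act t ω) (fun t => η t ω)} + ENNReal.ofReal P.delta := by
    calc (1 : ℝ≥0∞) = μ Set.univ := measure_univ.symm
      _ ≤ _ := measure_mono hcover
      _ ≤ _ := measure_union_le _ _
      _ ≤ μ {ω | P.Good (fun t => act t ω) (fun t => η t ω)} + (ENNReal.ofReal (P.delta / 2) +
          ENNReal.ofReal (P.delta / 2)) :=
        add_le_add_right ((measure_union_le _ _).trans (add_le_add h1 h3)) _
      _ = _ := by
        rw [← ENNReal.ofReal_add (by positivity) (by positivity), add_halves]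
  rw [ENNReal.ofReal_sub _ hδ.le, ENNReal.ofReal_one]
  exact tsub_le_iff_right.2 h4

end Spec

namespace Spec

variable {M K d : ℕ} {P : Spec M K d} {S : Stats K d}

/-! ### Pulls with a valid confidence radius -/

/-- The confidence radius is valid for the data `S`, in all directions. -/
def Confident (P : Spec M K d) (S : Stats K d) : Prop :=
  ∀ y, |y ⬝ᵥ (P.thetaHat S - P.theta)| ≤ P.radius S * √(y ⬝ᵥ (S.V⁻¹ *ᵥ y))

/-- Right after a communication the active agent holds the data of the server, and nothing else. -/
theorem confident_of_communicates (hP : P.Tuned) {act : ℕ → Fin M} {noise : ℕ → ℝ}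
    (hgood : P.Good act noise) {n : ℕ} (hn : P.Communicates act noise n) :
    P.Confident (P.run act noise (n + 1)).server := by
  have hg := hgood (n + 1)
  have hstep : P.run act noise (n + 1) = _ := step_of_trigger hn
  refine abs_dotProduct_thetaHat_sub_le hP (hP.consistent_run act noise (n + 1))
    (a := act (K + n)) ?_ ?_ _ rfl hg.1 hg.2
  · rw [hstep]; simp
  · rw [hstep]; simp

theorem bonus_comm (i j : Fin K) : P.bonus S i j = P.bonus S j i := by
  have h : P.y i j = -P.y j i := by simp [y]
  rw [bonus, bonus, h, Matrix.mulVec_neg, neg_dotProduct_neg]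

theorem gapHat_swap (i j : Fin K) : P.gapHat S i j = -P.gapHat S j i := by
  have h : P.y i j = -P.y j i := by simp [y]
  rw [gapHat, gapHat, h, neg_dotProduct]

theorem gap_add_gap (i j l : Fin K) : P.gap i j + P.gap j l = P.gap i l := by
  simp only [gap, y, sub_dotProduct]; ring

theorem Confident.gap_le (h : P.Confident S) (i j : Fin K) :
    P.gap i j ≤ P.gapHat S i j + P.bonus S i j := by
  have := (abs_le.1 (h (P.y i j))).1
  rw [dotProduct_sub] at this
  simp only [gap, gapHat, bonus]
  linarith

theorem gapHat_add_bonus_le_breakIndex (hc : IsArgmaxRule P.challengerRule) (S : Stats K d)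
    (l : Fin K) : P.gapHat S l (P.best S) + P.bonus S (P.best S) l ≤ P.breakIndex S :=
  hc.2 (fun j => P.gapHat S j (P.best S) + P.bonus S (P.best S) j) l

theorem gapHat_best_nonpos (hb : IsArgmaxRule P.bestRule) (S : Stats K d) (l : Fin K) :
    P.gapHat S l (P.best S) ≤ 0 := by
  have := hb.2 (fun k => P.x k ⬝ᵥ P.thetaHat S) l
  rw [gapHat, y, sub_dotProduct]
  exact sub_nonpos.2 this

/-- The breaking index bounds the suboptimality of the empirically best arm. -/
theorem Confident.gap_best_le (h : P.Confident S) (hc : IsArgmaxRule P.challengerRule)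
    (k : Fin K) : P.gap k (P.best S) ≤ P.breakIndex S := by
  have h1 := h.gap_le k (P.best S)
  rw [bonus_comm] at h1
  exact h1.trans (gapHat_add_bonus_le_breakIndex hc S k)

/-- As long as the breaking condition fails, the bonus of the compared pair of arms exceeds its
threshold in the problem complexity. -/
theorem Confident.max_le_bonus (h : P.Confident S) (hb : IsArgmaxRule P.bestRule)
    (hc : IsArgmaxRule P.challengerRule) (heps : 0 < P.eps) (hS : P.eps < P.breakIndex S)
    (k : Fin K) :
    max (max ((P.gap k (P.best S) + P.eps) / 3) ((P.gap k (P.challenger S) + P.eps) / 3)) P.eps ≤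
      P.bonus S (P.best S) (P.challenger S) := by
  have h1 := h.gap_best_le hc k
  have h2 := gapHat_best_nonpos hb S (P.challenger S)
  have h3 := h.gap_le (P.best S) (P.challenger S)
  rw [gapHat_swap] at h3
  have h4 := gap_add_gap (P := P) k (P.best S) (P.challenger S)
  have h5 : P.breakIndex S = P.gapHat S (P.challenger S) (P.best S) +
    P.bonus S (P.best S) (P.challenger S) := rfl
  refine max_le (max_le ?_ ?_) ?_ <;> linarith

theorem designCost_nonneg {w p : Fin K → ℝ} (hp : ∀ k, 0 ≤ p k) : 0 ≤ designCost w p :=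
  Finset.sum_nonneg fun k _ => div_nonneg (sq_nonneg _) (hp k)

theorem rho_nonneg (x : Fin K → Fin d → ℝ) (v : Fin d → ℝ) : 0 ≤ rho x v := by
  refine Real.sInf_nonneg ?_
  rintro c ⟨w, p, h, rfl⟩
  exact designCost_nonneg h.2.2.1

/-- With the counts `T` of a regular data set, `‖v‖²_{V⁻¹} ≤ ∑ k, w k ^ 2 / T k` for every
representation `v = ∑ k, w k • x k`. -/
theorem invSq_le_sum_div (hP : P.Tuned) (h : P.Regular S) (w : Fin K → ℝ) :
    invSq S.V (∑ k, w k • P.x k) ≤ ∑ k, w k ^ 2 / S.T k := by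
  set v := ∑ k, w k • P.x k with hv
  set u := S.V⁻¹ *ᵥ v with hu
  have hV := h.posDef hP
  have h1 : v ⬝ᵥ u = ∑ k, w k * (P.x k ⬝ᵥ u) := by
    rw [hv, sum_dotProduct]
    simp only [smul_dotProduct, smul_eq_mul]
  have h2 : u ⬝ᵥ (S.V *ᵥ u) = v ⬝ᵥ u := by
    rw [hu, mulVec_inv_mulVec hV, dotProduct_comm]
  have h3 : ∑ k, (S.T k : ℝ) * (P.x k ⬝ᵥ u) ^ 2 ≤ u ⬝ᵥ (S.V *ᵥ u) := by
    rw [h.V_eq, quad_regCov, ← quad_cov]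
    have : 0 ≤ u ⬝ᵥ u := by simpa using dotProduct_star_self_nonneg u
    linarith [mul_nonneg hP.lam_pos.le this]
  have h4 : ∀ k, 2 * (w k * (P.x k ⬝ᵥ u)) ≤ w k ^ 2 / S.T k + S.T k * (P.x k ⬝ᵥ u) ^ 2 := by
    intro k
    have hT : (0 : ℝ) < S.T k := by exact_mod_cast h.one_le k
    have : w k ^ 2 / S.T k + S.T k * (P.x k ⬝ᵥ u) ^ 2 - 2 * (w k * (P.x k ⬝ᵥ u)) =
        (w k - S.T k * (P.x k ⬝ᵥ u)) ^ 2 / S.T k := by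
      field_simp; ring
    have h0 : 0 ≤ (w k - S.T k * (P.x k ⬝ᵥ u)) ^ 2 / S.T k := by positivity
    linarith
  have h5 := Finset.sum_le_sum fun k (_ : k ∈ Finset.univ) => h4 k
  rw [Finset.sum_add_distrib, ← Finset.mul_sum, ← h1] at h5
  have h6 : invSq S.V v = v ⬝ᵥ u := rfl
  linarith

/-- The allocation rule keeps the uncertainty of the compared direction at the level
`ρ(y) p_k / T_k` of the pulled arm `k`. -/
theorem invSq_le_of_pull (hP : P.Tuned) (h : P.Regular S) {i j : Fin K}
    (hp : IsOptimalAllocation P.x (P.y i j) (P.p i j)) {k : Fin K}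
    (hk : ∀ l, 0 < P.p i j l → (S.T k : ℝ) / P.p i j k ≤ (S.T l : ℝ) / P.p i j l)
    (hpk : 0 < P.p i j k) :
    S.T k * invSq S.V (P.y i j) ≤ rho P.x (P.y i j) * P.p i j k := by
  obtain ⟨w, ⟨hy, -, hp0, hw⟩, hcost⟩ := hp
  have hTk : (0 : ℝ) < S.T k := by exact_mod_cast h.one_le k
  have h1 := invSq_le_sum_div hP h w
  rw [← hy] at h1
  refine (mul_le_mul_of_nonneg_left h1 hTk.le).trans ?_
  rw [← hcost, designCost, Finset.mul_sum, Finset.sum_mul]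
  refine Finset.sum_le_sum fun l _ => ?_
  have hTl : (0 : ℝ) < S.T l := by exact_mod_cast h.one_le l
  rcases (hp0 l).eq_or_lt with h0 | h0
  · simp [hw l h0.symm]
  · have h2 := hk l h0
    rw [div_le_div_iff₀ hpk h0] at h2
    have e : w l ^ 2 / P.p i j l * P.p i j k - S.T k * (w l ^ 2 / S.T l) =
        w l ^ 2 * (S.T l * P.p i j k - S.T k * P.p i j l) / (P.p i j l * S.T l) := by
      field_simp
    have h3 : 0 ≤ w l ^ 2 * (S.T l * P.p i j k - S.T k * P.p i j l) / (P.p i j l * S.T l) :=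
      div_nonneg (mul_nonneg (sq_nonneg _) (by linarith)) (by positivity)
    linarith

/-- The contribution of arm `k` to the problem complexity. -/
def armComplexity (P : Spec M K d) (kstar k : Fin K) : ℝ :=
  ⨆ ij : Fin K × Fin K, rho P.x (P.y ij.1 ij.2) * P.p ij.1 ij.2 k /
    max (max ((P.gap kstar ij.1 + P.eps) / 3) ((P.gap kstar ij.2 + P.eps) / 3)) P.eps ^ 2

theorem armComplexity_nonneg (hp : ∀ i j, IsOptimalAllocation P.x (P.y i j) (P.p i j))
    (kstar k : Fin K) : 0 ≤ P.armComplexity kstar k := by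
  refine Real.iSup_nonneg fun ij => ?_
  obtain ⟨w, ⟨-, -, hp0, -⟩, -⟩ := hp ij.1 ij.2
  exact div_nonneg (mul_nonneg (rho_nonneg _ _) (hp0 k)) (sq_nonneg _)

/-- As long as the breaking condition fails, the pulled arm has been pulled rarely. -/
theorem Confident.count_pull_le (h : P.Confident S) (hP : P.Tuned) (hS : P.Regular S)
    (hb : IsArgmaxRule P.bestRule) (hc : IsArgmaxRule P.challengerRule)
    (harm : IsAllocationRule P.p P.armRule)
    (hp : ∀ i j, IsOptimalAllocation P.x (P.y i j) (P.p i j)) (heps : 0 < P.eps)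
    (hB : P.eps < P.breakIndex S) (kstar : Fin K) :
    (S.T (P.pull S) : ℝ) ≤ P.radius S ^ 2 * P.armComplexity kstar (P.pull S) := by
  have hmax := h.max_le_bonus hb hc heps hB kstar
  obtain ⟨hpk, hk⟩ := harm (P.best S) (P.challenger S) S.T
  have hquad := invSq_le_of_pull hP hS (hp (P.best S) (P.challenger S)) hk hpk
  change (S.T (P.pull S) : ℝ) * _ ≤ _ * P.p _ _ (P.pull S) at hquad
  set k := P.pull S
  set i := P.best S
  set j := P.challenger S
  set D := max (max ((P.gap kstar i + P.eps) / 3) ((P.gap kstar j + P.eps) / 3)) P.eps with hD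
  have hD0 : 0 < D := heps.trans_le (le_max_right _ _)
  have hsup : rho P.x (P.y i j) * P.p i j k / D ^ 2 ≤ P.armComplexity kstar k :=
    le_ciSup (f := fun ij : Fin K × Fin K => rho P.x (P.y ij.1 ij.2) * P.p ij.1 ij.2 k /
      max (max ((P.gap kstar ij.1 + P.eps) / 3) ((P.gap kstar ij.2 + P.eps) / 3)) P.eps ^ 2)
      (Set.finite_range _).bddAbove (i, j)
  refine le_trans ?_ (mul_le_mul_of_nonneg_left hsup (sq_nonneg _))
  rw [← mul_div_assoc, le_div_iff₀ (by positivity)]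
  have hbonus : P.bonus S i j ^ 2 = P.radius S ^ 2 * invSq S.V (P.y i j) := by
    rw [bonus, mul_pow, ← invSq, Real.sq_sqrt (invSq_nonneg (hS.posDef hP) _)]
  calc (S.T k : ℝ) * D ^ 2 ≤ S.T k * P.bonus S i j ^ 2 := by gcongr
    _ = P.radius S ^ 2 * (S.T k * invSq S.V (P.y i j)) := by rw [hbonus]; ring
    _ ≤ _ := by gcongr

/-- The logarithmic term of the confidence radius after `t` observations. -/
def logTerm (P : Spec M K d) (t : ℝ) : ℝ :=
  Real.log (2 / P.delta) + Real.log (1 + (1 + 1 / (2 * (K : ℝ))) / (P.lam / (M : ℝ) ^ 2) * t)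

theorem rate_pos (hP : P.Tuned) : 0 < (1 + 1 / (2 * (K : ℝ))) / (P.lam / (M : ℝ) ^ 2) := by
  have := hP.K_pos'; have := hP.M_pos'; have := hP.lam_pos
  positivity

theorem log_delta_pos (hP : P.Tuned) : 0 < Real.log (2 / P.delta) := by
  refine Real.log_pos ?_
  rw [lt_div_iff₀ hP.delta_pos]
  linarith [hP.delta_lt]

theorem logTerm_mono (hP : P.Tuned) {s t : ℝ} (hs : 0 ≤ s) (hst : s ≤ t) :
    P.logTerm s ≤ P.logTerm t := by
  have := rate_pos hP
  unfold logTerm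
  gcongr

theorem logTerm_nonneg (hP : P.Tuned) {t : ℝ} (ht : 0 ≤ t) : 0 ≤ P.logTerm t := by
  have h0 := (log_delta_pos hP).le
  have h2 := rate_pos hP
  exact add_nonneg h0 (Real.log_nonneg (le_add_of_nonneg_right (by positivity)))

/-- The upper bound on `λ` makes the bias at most as large as the rest of the radius. -/
theorem radius_sq_le (hP : P.Tuned)
    (hlam : P.lam ≤ P.sigma ^ 2 * (√(1 + P.gamma1 * M) + √(2 * P.gamma1) * M) ^ 2 *
      Real.log (2 / P.delta)) (S : Stats K d) :
    P.radius S ^ 2 ≤ (√2 + √(1 + 1 / (M : ℝ))) ^ 2 * (4 * P.sigma ^ 2 * d) *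
      P.logTerm S.count := by
  have hM := hP.M_pos'
  have hK := hP.K_pos'
  have hl := hP.lam_pos
  have hσ := hP.sigma_pos
  have hd : (1 : ℝ) ≤ d := by exact_mod_cast hP.d_pos
  have hA := log_delta_pos hP
  have e1 : √(2 * P.gamma1) * M = √2 := by
    rw [hP.gamma1_eq, Real.sqrt_mul (by norm_num), Real.sqrt_div (by norm_num), Real.sqrt_one,
      Real.sqrt_sq hM.le]
    field_simp
  have e2 : P.gamma1 * M = 1 / M := by rw [hP.gamma1_eq]; field_simp
  rw [e1, e2, add_comm √(1 + 1 / (M : ℝ))] at hlam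
  have e3 : (M : ℝ) * (2 * K + 1) * P.load S =
      (1 + 1 / (2 * (K : ℝ))) / (P.lam / (M : ℝ) ^ 2) * S.count := by
    rw [load]; field_simp
  set c := √2 + √(1 + 1 / (M : ℝ)) with hc
  have hc0 : 0 ≤ c := by positivity
  have hR : P.radius S = √P.lam + c * (P.sigma * √(d * P.logTerm S.count)) := by
    rw [radius_eq hP, e3, logTerm]
  have hL := logTerm_nonneg hP S.count_nonneg
  have hAL : Real.log (2 / P.delta) ≤ d * P.logTerm S.count := by
    have h0 : Real.log (2 / P.delta) ≤ P.logTerm S.count :=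
      le_add_of_nonneg_right (Real.log_nonneg (le_add_of_nonneg_right
        (mul_nonneg (rate_pos hP).le S.count_nonneg)))
    nlinarith
  have h1 : √P.lam ≤ c * (P.sigma * √(d * P.logTerm S.count)) := by
    refine Real.sqrt_le_iff.2 ⟨by positivity, hlam.trans ?_⟩
    rw [mul_pow, mul_pow, Real.sq_sqrt (by positivity)]
    calc P.sigma ^ 2 * c ^ 2 * Real.log (2 / P.delta) ≤
        P.sigma ^ 2 * c ^ 2 * (d * P.logTerm S.count) := by gcongr
      _ = _ := by ring
  calc P.radius S ^ 2 ≤ (2 * (c * (P.sigma * √(d * P.logTerm S.count)))) ^ 2 := by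
        rw [hR]
        refine pow_le_pow_left₀ (by positivity) (by linarith) 2
    _ = 4 * c ^ 2 * P.sigma ^ 2 * √(d * P.logTerm S.count) ^ 2 := by ring
    _ = _ := by rw [Real.sq_sqrt (by positivity)]; ring

end Spec

namespace Spec

variable {M K d : ℕ} {P : Spec M K d} {act : ℕ → Fin M} {noise : ℕ → ℝ}

/-! ### The number of rounds -/

/-- The bound `x` on the counts of the pulled arm passes to the data of the server: beyond `x`, the
server gains data of an arm only from agents whose snapshot is old, and at most `c` from each. -/
structure Bounded (s : State M K d) (k : Fin K) (x c : ℝ) : Prop where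
  server_le : (s.server.T k : ℝ) ≤
    x + ((Finset.univ.filter fun m => x < ((s.agent m).T k : ℝ)).card : ℝ) * c
  loc_eq : ∀ m, x < ((s.agent m).T k : ℝ) → (s.loc m).T k = 0

theorem newLoc_T (s : State M K d) (a : Fin M) (e : ℝ) (k : Fin K) :
    (P.newLoc s a e).T k = (s.loc a).T k + if k = P.pull (s.agent a) then 1 else 0 := by
  simp [newLoc, Stats.add, obs, Pi.single_apply]

theorem T_le_count (S : Stats K d) (k : Fin K) : (S.T k : ℝ) ≤ S.count :=
  Finset.single_le_sum (f := fun k => (S.T k : ℝ)) (fun _ _ => Nat.cast_nonneg _)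
    (Finset.mem_univ k)

/-- An upload which lifts the count of arm `k` comes from an agent whose snapshot has at most `x`
counts of `k`. If the count of the server then exceeds `x`, so does the count in the new snapshot of
this agent, which therefore does not pull `k` again. -/
theorem Bounded.step {s : State M K d} {k : Fin K} {x c : ℝ} (h : Bounded s k x c)
    (hc : 0 ≤ c) (a : Fin M) (e : ℝ)
    (hpull : k = P.pull (s.agent a) → ((s.agent a).T k : ℝ) ≤ x)
    (hnew : (P.newLoc s a e).count ≤ c) : Bounded (P.step s a e) k x c := by
  classical
  have hloc : x < ((s.agent a).T k : ℝ) → (P.newLoc s a e).T k = 0 := by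
    intro hx
    rw [newLoc_T, h.loc_eq a hx, if_neg fun hk => (hpull hk).not_gt hx]
  by_cases ht : P.Trigger (s.agent a) (P.newLoc s a e)
  · rw [step_of_trigger ht]
    set S' := s.server.add (P.newLoc s a e) with hS'
    have hT' : (S'.T k : ℝ) = s.server.T k + (P.newLoc s a e).T k := by
      simp [hS', Stats.add]
    refine ⟨?_, fun m hm => ?_⟩
    · change (S'.T k : ℝ) ≤ x + _
      rcases le_or_gt (S'.T k : ℝ) x with hle | hlt
      · exact le_add_of_le_of_nonneg hle (by positivity)
      · rcases le_or_gt ((s.agent a).T k : ℝ) x with ha | ha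
        · have hcard : (Finset.univ.filter fun m =>
              x < ((Function.update s.agent a S' m).T k : ℝ)) =
              insert a (Finset.univ.filter fun m => x < ((s.agent m).T k : ℝ)) := by
            ext m
            by_cases hm : m = a
            · subst hm; simp [hlt]
            · simp [hm]
          rw [hcard, Finset.card_insert_of_notMem (by simpa using ha)]
          have := T_le_count (P.newLoc s a e) k
          push_cast
          linarith [h.server_le]
        · have hcard : (Finset.univ.filter fun m =>
              x < ((Function.update s.agent a S' m).T k : ℝ)) =
              Finset.univ.filter fun m => x < ((s.agent m).T k : ℝ) := by
            ext m
            by_cases hm : m = a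
            · subst hm; simp [hlt, ha]
            · simp [hm]
          rw [hcard, hT', hloc ha, Nat.cast_zero, add_zero]
          exact h.server_le
    · by_cases hma : m = a
      · subst hma; simp [Stats.empty]
      · simp only [Function.update_of_ne hma] at hm ⊢
        exact h.loc_eq m hm
  · rw [step_of_not_trigger ht]
    refine ⟨h.server_le, fun m hm => ?_⟩
    by_cases hma : m = a
    · subst hma
      simpa using hloc hm
    · simp only [Function.update_of_ne hma]
      exact h.loc_eq m hm

theorem init_T (noise : ℕ → ℝ) (k : Fin K) : (P.init noise).server.T k = 1 := by
  simp only [init, sum_obs_T]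

theorem Consistent.loc_count_le {s : State M K d} (hs : P.Consistent s) (m : Fin M) :
    (s.loc m).count ≤ P.gamma2 * (s.agent m).count := by
  have h := hs.not_trigger m
  rw [trigger_iff, not_or, not_lt, not_lt] at h
  linarith [h.2]

/-- As long as the algorithm has not terminated, every agent holds data with few counts of the arm
it is about to pull. -/
theorem count_pull_agent_le (hP : P.Tuned) (hgood : P.Good act noise)
    (hb : IsArgmaxRule P.bestRule) (hc : IsArgmaxRule P.challengerRule)
    (harm : IsAllocationRule P.p P.armRule)
    (hp : ∀ i j, IsOptimalAllocation P.x (P.y i j) (P.p i j)) (heps : 0 < P.eps)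
    (hlam : P.lam ≤ P.sigma ^ 2 * (√(1 + P.gamma1 * M) + √(2 * P.gamma1) * M) ^ 2 *
      Real.log (2 / P.delta)) (kstar : Fin K) {n : ℕ} (hn : ∀ l < n, ¬ P.Breaks act noise l)
    (m : Fin M) :
    (((P.run act noise n).agent m).T (P.pull ((P.run act noise n).agent m)) : ℝ) ≤
      1 + (√2 + √(1 + 1 / (M : ℝ))) ^ 2 * (4 * P.sigma ^ 2 * d) *
        P.logTerm (P.run act noise n).server.count *
        P.armComplexity kstar (P.pull ((P.run act noise n).agent m)) := by
  have hA := armComplexity_nonneg hp kstar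
  have hmono : ∀ l, (P.run act noise l).server.count ≤ (P.run act noise (l + 1)).server.count :=
    fun l => count_mono (server_T_step _ _ _)
  have hL : ∀ l, 0 ≤ P.logTerm (P.run act noise l).server.count := fun l =>
    logTerm_nonneg hP (Stats.count_nonneg _)
  induction n with
  | zero =>
    change (((P.init noise).server.T _ : ℕ) : ℝ) ≤ _
    rw [init_T, Nat.cast_one]
    have h1 := hA (P.pull ((P.run act noise 0).agent m))
    have h2 := hL 0
    exact le_add_of_nonneg_right (by positivity)
  | succ n ih =>
    have ih := ih fun l hl => hn l (by omega)
    have hcons := hP.consistent_run act noise (n + 1)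
    have hold : (P.run act noise (n + 1)).agent m = (P.run act noise n).agent m →
        (((P.run act noise (n + 1)).agent m).T (P.pull ((P.run act noise (n + 1)).agent m)) : ℝ) ≤
        1 + (√2 + √(1 + 1 / (M : ℝ))) ^ 2 * (4 * P.sigma ^ 2 * d) *
          P.logTerm (P.run act noise (n + 1)).server.count *
          P.armComplexity kstar (P.pull ((P.run act noise (n + 1)).agent m)) := by
      intro h
      rw [h]
      refine ih.trans ?_
      have h1 := hA (P.pull ((P.run act noise n).agent m))
      have h2 := logTerm_mono hP (Stats.count_nonneg _) (hmono n)
      gcongr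
    by_cases h : P.Communicates act noise n
    · have hstep : P.run act noise (n + 1) = _ := step_of_trigger h
      by_cases hm : m = act (K + n)
      · have hag : (P.run act noise (n + 1)).agent m = (P.run act noise (n + 1)).server := by
          rw [hstep, hm]; simp
        have hB : P.eps < P.breakIndex (P.run act noise (n + 1)).server := by
          by_contra hB
          exact hn n (by omega) ⟨h, not_lt.1 hB⟩
        have h1 := (confident_of_communicates hP hgood h).count_pull_le hP hcons.regular_server
          hb hc harm hp heps hB kstar
        rw [hag]
        refine h1.trans ((mul_le_mul_of_nonneg_right (radius_sq_le hP hlam _) (hA _)).trans ?_)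
        linarith
      · refine hold ?_
        rw [hstep]; simp [hm]
    · refine hold ?_
      rw [show P.run act noise (n + 1) = _ from step_of_not_trigger h]

/-- The implicit bound on the number `τ = K + n + 1` of rounds: the counts of the arms are bounded
in terms of the confidence radius, which depends on `τ` logarithmically. -/
theorem rounds_le (hP : P.Tuned) (hgood : P.Good act noise)
    (hb : IsArgmaxRule P.bestRule) (hc : IsArgmaxRule P.challengerRule)
    (harm : IsAllocationRule P.p P.armRule)
    (hp : ∀ i j, IsOptimalAllocation P.x (P.y i j) (P.p i j)) (heps : 0 < P.eps)
    (hlam : P.lam ≤ P.sigma ^ 2 * (√(1 + P.gamma1 * M) + √(2 * P.gamma1) * M) ^ 2 *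
      Real.log (2 / P.delta)) (kstar : Fin K) {n : ℕ} (hn : ∀ l < n, ¬ P.Breaks act noise l) :
    ((K + n + 1 : ℕ) : ℝ) ≤ P.boundFactor kstar *
      Real.log (1 + (1 + 1 / (2 * (K : ℝ))) / (P.lam / (M : ℝ) ^ 2) * ((K + n + 1 : ℕ) : ℝ)) +
        P.boundGamma kstar := by
  classical
  have hM := hP.M_pos'
  have hK := hP.K_pos'
  have hg2 := hP.gamma2_pos
  set N := (P.run act noise (n + 1)).server.count with hN
  have hN0 : 0 ≤ N := Stats.count_nonneg _
  set c := P.gamma2 * N + 1 with hc'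
  have hc0 : 0 ≤ c := by positivity
  set Q := (√2 + √(1 + 1 / (M : ℝ))) ^ 2 * (4 * P.sigma ^ 2 * d) * P.logTerm N with hQ
  have hQ0 : 0 ≤ Q := by
    have := logTerm_nonneg hP hN0
    positivity
  have hA := armComplexity_nonneg hp kstar
  have hmono : ∀ l ≤ n + 1, (P.run act noise l).server.count ≤ N := fun l hl =>
    count_mono (server_T_mono act noise hl)
  have hagent : ∀ l ≤ n + 1, ∀ m, ((P.run act noise l).agent m).count ≤ N := fun l hl m =>
    (count_mono ((hP.consistent_run act noise l).agent_le m)).trans (hmono l hl)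
  have hbdd : ∀ k, ∀ l ≤ n + 1,
      Bounded (P.run act noise l) k (1 + Q * P.armComplexity kstar k) c := by
    intro k l
    induction l with
    | zero =>
      intro _
      have hx : ((1 : ℕ) : ℝ) ≤ 1 + Q * P.armComplexity kstar k := by
        rw [Nat.cast_one]
        exact le_add_of_nonneg_right (mul_nonneg hQ0 (hA k))
      refine ⟨?_, fun m _ => rfl⟩
      change (((P.init noise).server.T k : ℕ) : ℝ) ≤ _
      rw [init_T]
      exact le_add_of_le_of_nonneg hx (by positivity)
    | succ l ih =>
      intro hl
      have hcons := hP.consistent_run act noise l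
      refine (ih (by omega)).step hc0 _ _ (fun hk => ?_) ?_
      · have h1 := count_pull_agent_le hP hgood hb hc harm hp heps hlam kstar (n := l)
          (fun j hj => hn j (by omega)) (act (K + l))
        rw [← hk] at h1
        refine h1.trans ?_
        have h2 := logTerm_mono hP (Stats.count_nonneg _) (hmono l (by omega))
        have h3 := hA k
        rw [hQ]
        gcongr
      · rw [newLoc, Stats.count_add, count_obs, hc']
        have h1 := hcons.loc_count_le (act (K + l))
        have h2 := mul_le_mul_of_nonneg_left (hagent l (by omega) (act (K + l))) hg2.le
        linarith
  have hcons := hP.consistent_run act noise (n + 1)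
  -- every agent contributes at most one upload of size `c` beyond the bound for each arm
  have hserver : N ≤ K + Q * P.complexity kstar + K * (M * c) := by
    have h1 : ∀ k, ((P.run act noise (n + 1)).server.T k : ℝ) ≤
        1 + Q * P.armComplexity kstar k + M * c := by
      intro k
      refine (hbdd k (n + 1) le_rfl).server_le.trans ?_
      gcongr
      exact (Finset.card_le_univ _).trans (by simp)
    have h2 := Finset.sum_le_sum fun k (_ : k ∈ Finset.univ) => h1 k
    rw [Finset.sum_add_distrib, Finset.sum_add_distrib, ← Finset.mul_sum] at h2
    rw [hN, Stats.count]
    simpa [complexity, armComplexity] using h2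
  have hg2K : P.gamma2 * K * M = 1 / 2 := by rw [hP.gamma2_eq]; field_simp
  have hfac : (1 + P.gamma2 * M) / (1 - P.gamma2 * K * M) = 2 * (1 + P.gamma2 * M) := by
    rw [hg2K]; ring
  -- `γ₂ K M = 1 / 2`, so the uploads beyond the bound amount to half of the data
  have hhalf : N ≤ 2 * (Q * P.complexity kstar + K * (M + 1)) := by
    have : K * (M * c) = P.gamma2 * K * M * N + K * M := by rw [hc']; ring
    rw [this, hg2K] at hserver
    linarith
  have htotal := count_total (P := P) act noise (n + 1)
  have hlocs : ∑ m, ((P.run act noise (n + 1)).loc m).count ≤ P.gamma2 * M * N := by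
    calc ∑ m, ((P.run act noise (n + 1)).loc m).count ≤ ∑ _m : Fin M, P.gamma2 * N :=
          Finset.sum_le_sum fun m _ => (hcons.loc_count_le m).trans
            (mul_le_mul_of_nonneg_left (hagent _ le_rfl m) hg2.le)
      _ = _ := by simp; ring
  have hNtau : N ≤ ((K + n + 1 : ℕ) : ℝ) := by
    have := count_server_le (P := P) act noise (n + 1)
    push_cast at this ⊢
    linarith
  have hC : 0 ≤ P.complexity kstar := Finset.sum_nonneg fun k _ => hA k
  have hmain : ((K + n + 1 : ℕ) : ℝ) ≤
      2 * (1 + P.gamma2 * M) * (Q * P.complexity kstar + K * (M + 1)) := by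
    have h1 : ((K + n + 1 : ℕ) : ℝ) ≤ (1 + P.gamma2 * M) * N := by
      push_cast at htotal ⊢
      linarith
    refine h1.trans ?_
    have := mul_le_mul_of_nonneg_left hhalf (show 0 ≤ 1 + P.gamma2 * M by positivity)
    linarith
  have hQle : Q ≤ (√2 + √(1 + 1 / (M : ℝ))) ^ 2 * (4 * P.sigma ^ 2 * d) *
      P.logTerm ((K + n + 1 : ℕ) : ℝ) := by
    have := logTerm_mono hP hN0 hNtau
    rw [hQ]
    gcongr
  refine hmain.trans ?_
  rw [boundGamma, boundFactor, hfac]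
  have h1 : Q * P.complexity kstar + K * (M + 1) ≤ (√2 + √(1 + 1 / (M : ℝ))) ^ 2 *
      (4 * P.sigma ^ 2 * d) * P.logTerm ((K + n + 1 : ℕ) : ℝ) * P.complexity kstar +
      K * (M + 1) := by gcongr
  refine (mul_le_mul_of_nonneg_left h1 (by positivity)).trans (le_of_eq ?_)
  rw [logTerm]
  ring

theorem log_le_sqrt {v : ℝ} (hv : 0 < v) : Real.log v ≤ √v := by
  have h1 : 0 ≤ √v / 2 := by positivity
  have h2 := Real.quadratic_le_exp_of_nonneg h1
  have h3 : √v ≤ Real.exp (√v / 2) := by nlinarith [sq_nonneg (√v / 2 - 1)]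
  have h4 := (Real.log_le_iff_le_exp (Real.sqrt_pos.2 hv)).2 h3
  rw [Real.log_sqrt hv.le] at h4
  linarith

/-- The implicit bound `t ≤ A log (1 + a t) + G` is made explicit by inserting the crude bound
`t ≤ (A √(1 + a) + G) ^ 2`, which follows from `log v ≤ √v`. -/
theorem le_of_le_mul_log {A a G t : ℝ} (hA : 0 ≤ A) (ha : 0 ≤ a) (hG : 0 ≤ G) (ht : 1 ≤ t)
    (h : t ≤ A * Real.log (1 + a * t) + G) :
    t ≤ A * Real.log (1 + a * (A * √(1 + a) + G) ^ 2) + G := by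
  have ht0 : 0 ≤ t := by linarith
  have hs : 1 ≤ √t := Real.one_le_sqrt.2 ht
  have h1 : Real.log (1 + a * t) ≤ √(1 + a) * √t := by
    rw [← Real.sqrt_mul (by positivity)]
    refine (log_le_sqrt (by positivity)).trans (Real.sqrt_le_sqrt ?_)
    linarith
  have h2 : √t * √t ≤ (A * √(1 + a) + G) * √t := by
    rw [Real.mul_self_sqrt ht0]
    calc t ≤ A * (√(1 + a) * √t) + G * 1 := by
          rw [mul_one]
          exact h.trans (by gcongr)
      _ ≤ A * (√(1 + a) * √t) + G * √t := by gcongr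
      _ = _ := by ring
  have h3 : √t ≤ A * √(1 + a) + G := le_of_mul_le_mul_right h2 (by linarith)
  have h4 : t ≤ (A * √(1 + a) + G) ^ 2 := (Real.sqrt_le_left (by positivity)).1 h3
  refine h.trans ?_
  gcongr

theorem boundFactor_nonneg (hP : P.Tuned)
    (hp : ∀ i j, IsOptimalAllocation P.x (P.y i j) (P.p i j)) (kstar : Fin K) :
    0 ≤ P.boundFactor kstar := by
  have hC : 0 ≤ P.complexity kstar := Finset.sum_nonneg fun k _ => armComplexity_nonneg hp kstar k
  have hM := hP.M_pos'
  have hK := hP.K_pos'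
  have hg2 := hP.gamma2_pos
  have hg2K : P.gamma2 * K * M = 1 / 2 := by rw [hP.gamma2_eq]; field_simp
  rw [boundFactor, hg2K]
  have : (0 : ℝ) < 1 - 1 / 2 := by norm_num
  positivity

/-- As long as the algorithm has not terminated, the number of rounds is within the claimed bound.
-/
theorem rounds_le_sampleBound (hP : P.Tuned) (hgood : P.Good act noise)
    (hb : IsArgmaxRule P.bestRule) (hc : IsArgmaxRule P.challengerRule)
    (harm : IsAllocationRule P.p P.armRule)
    (hp : ∀ i j, IsOptimalAllocation P.x (P.y i j) (P.p i j)) (heps : 0 < P.eps)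
    (hlam : P.lam ≤ P.sigma ^ 2 * (√(1 + P.gamma1 * M) + √(2 * P.gamma1) * M) ^ 2 *
      Real.log (2 / P.delta)) (kstar : Fin K) {n : ℕ} (hn : ∀ l < n, ¬ P.Breaks act noise l) :
    ((K + n + 1 : ℕ) : ℝ) ≤ P.sampleBound kstar := by
  have hA := boundFactor_nonneg hP hp kstar
  have hM := hP.M_pos'
  have hK := hP.K_pos'
  have hg2 := hP.gamma2_pos
  have hg2K : P.gamma2 * K * M = 1 / 2 := by rw [hP.gamma2_eq]; field_simp
  have hG : 0 ≤ P.boundGamma kstar := by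
    have := log_delta_pos hP
    rw [boundGamma, hg2K]
    have : (0 : ℝ) < 1 - 1 / 2 := by norm_num
    positivity
  have h := le_of_le_mul_log hA (rate_pos hP).le hG
    (by push_cast; linarith [Nat.cast_nonneg (α := ℝ) n])
    (rounds_le hP hgood hb hc harm hp heps hlam kstar hn)
  rw [sampleBound, boundLambda, mul_div_right_comm]
  exact h

/-- On the good event the algorithm terminates with an `ε`-optimal arm within the claimed number of
rounds. -/
theorem exists_terminates (hP : P.Tuned) (hgood : P.Good act noise)
    (hb : IsArgmaxRule P.bestRule) (hc : IsArgmaxRule P.challengerRule)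
    (harm : IsAllocationRule P.p P.armRule)
    (hp : ∀ i j, IsOptimalAllocation P.x (P.y i j) (P.p i j)) (heps : 0 < P.eps)
    (hlam : P.lam ≤ P.sigma ^ 2 * (√(1 + P.gamma1 * M) + √(2 * P.gamma1) * M) ^ 2 *
      Real.log (2 / P.delta)) (kstar : Fin K) :
    ∃ n, P.Terminates act noise n ∧ P.gap kstar (P.output act noise n) ≤ P.eps ∧
      ((K + n + 1 : ℕ) : ℝ) ≤ P.sampleBound kstar := by
  classical
  have hbreak : ∃ n, P.Breaks act noise n := by
    by_contra hno
    obtain ⟨n, hn⟩ := exists_nat_gt (P.sampleBound kstar)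
    have h := rounds_le_sampleBound hP hgood hb hc harm hp heps hlam kstar (n := n)
      fun l _ hl => hno ⟨l, hl⟩
    push_cast at h
    linarith [hP.K_pos']
  have hlt : ∀ l < Nat.find hbreak, ¬ P.Breaks act noise l := fun l hl => Nat.find_min hbreak hl
  refine ⟨Nat.find hbreak, ⟨Nat.find_spec hbreak, hlt⟩, ?_,
    rounds_le_sampleBound hP hgood hb hc harm hp heps hlam kstar hlt⟩
  obtain ⟨hcomm, hB⟩ := Nat.find_spec hbreak
  exact ((confident_of_communicates hP hgood hcomm).gap_best_le hc kstar).trans hB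

end Spec

end FedLin

end

theorem theorem2 {M K d : ℕ} (hM : 0 < M) (hd : 0 < d)
    -- the bandit instance and the inputs of the algorithm
    (P : FedLin.Spec M K d)
    (hx : ∀ k, P.x k ⬝ᵥ P.x k ≤ 1) (htheta : P.theta ⬝ᵥ P.theta ≤ 1)
    (hsigma : 0 < P.sigma) (heps : 0 < P.eps) (hdelta : 0 < P.delta) (hdelta' : P.delta < 1)
    (hgamma1 : P.gamma1 = 1 / (M : ℝ) ^ 2) (hgamma2 : P.gamma2 = 1 / (2 * (M : ℝ) * (K : ℝ)))
    (hlam : 0 < P.lam)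
    (hlam' : P.lam ≤ P.sigma ^ 2 * (√(1 + P.gamma1 * M) + √(2 * P.gamma1) * M) ^ 2 *
      Real.log (2 / P.delta))
    (hp : ∀ i j, FedLin.IsOptimalAllocation P.x (P.y i j) (P.p i j))
    (hbest : FedLin.IsArgmaxRule P.bestRule) (hchal : FedLin.IsArgmaxRule P.challengerRule)
    (harm : FedLin.IsAllocationRule P.p P.armRule)
    -- a best arm
    (kstar : Fin K) (hkstar : ∀ k, P.x k ⬝ᵥ P.theta ≤ P.x kstar ⬝ᵥ P.theta)
    -- the active agents (arbitrary, possibly depending on the past) and the noise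
    {Ω : Type*} {mΩ : MeasurableSpace Ω} (μ : MeasureTheory.Measure Ω)
    [MeasureTheory.IsProbabilityMeasure μ] (ℱ : MeasureTheory.Filtration ℕ mΩ)
    (act : ℕ → Ω → Fin M) (hact : ∀ t, Measurable[ℱ t] (act t))
    (η : ℕ → Ω → ℝ) (hη : FedLin.IsCondSubGaussian μ ℱ η P.sigma) :
    -- with probability at least `1 - δ` the algorithm terminates, its output is `ε`-optimal, and
    -- sample complexity and communication cost are bounded in terms of the inputs
    ENNReal.ofReal (1 - P.delta) ≤ μ {ω | ∃ n,
        P.Terminates (fun t => act t ω) (fun t => η t ω) n ∧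
        P.gap kstar (P.output (fun t => act t ω) (fun t => η t ω) n) ≤ P.eps ∧
        ((K + n + 1 : ℕ) : ℝ) ≤ P.sampleBound kstar ∧
        (P.commCost (fun t => act t ω) (fun t => η t ω) n : ℝ) ≤
          4 * max (2 * (M : ℝ) * K) ((M : ℝ) ^ 2) *
            (d * Real.logb 2 (1 + P.sampleBound kstar / (P.lam * d)) +
              Real.logb 2 (P.sampleBound kstar))} ∧
    -- whenever the algorithm terminates, the communication cost is bounded in terms of `τ`
    ∀ ω n, P.Terminates (fun t => act t ω) (fun t => η t ω) n →
      (P.commCost (fun t => act t ω) (fun t => η t ω) n : ℝ) ≤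
        2 * ((M + 1 / P.gamma1) * d * Real.logb 2 (1 + ((K + n + 1 : ℕ) : ℝ) / (P.lam * d)) +
          (M + 1 / P.gamma2) * Real.logb 2 ((K + n + 1 : ℕ) : ℝ)) := by
  have hP : P.Tuned :=
    ⟨hM, kstar.pos, hd, hx, htheta, hsigma, hdelta, hdelta', hgamma1, hgamma2, hlam⟩
  have hM1 : (1 : ℝ) ≤ M := by exact_mod_cast hM
  have hK1 : (1 : ℝ) ≤ K := by exact_mod_cast hP.K_pos
  have hd1 := hP.d_pos'
  have hg1' : P.gamma1 ≤ 1 := by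
    rw [hgamma1, div_le_one (by positivity)]
    exact one_le_pow₀ hM1
  have hMK : (1 : ℝ) ≤ M * K := one_le_mul_of_one_le_of_one_le hM1 hK1
  have hg2' : P.gamma2 ≤ 1 := by
    rw [hgamma2, div_le_one (by positivity)]
    linarith
  have hcost : ∀ ω n, _ := fun ω n =>
    FedLin.Spec.commCost_le (P := P) hP.K_pos hP.gamma1_pos hg1' hP.gamma2_pos hg2' hlam hd hx
      (fun t => act t ω) (fun t => η t ω) n
  refine ⟨?_, fun ω n _ => hcost ω n⟩
  refine (FedLin.Spec.measure_good_ge hP hbest hchal hact hη).trans (measure_mono ?_)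
  intro ω hω
  obtain ⟨n, hn, hgap, hU⟩ :=
    FedLin.Spec.exists_terminates hP hω hbest hchal harm hp heps hlam' kstar
  refine ⟨n, hn, hgap, hU, (hcost ω n).trans ?_⟩
  set U := P.sampleBound kstar
  have hn1 : (1 : ℝ) ≤ ((K + n + 1 : ℕ) : ℝ) := by
    push_cast; linarith [Nat.cast_nonneg (α := ℝ) n]
  set B := max (2 * (M : ℝ) * K) ((M : ℝ) ^ 2)
  have hMB : (M : ℝ) ≤ B := (by nlinarith : (M : ℝ) ≤ M ^ 2).trans (le_max_right _ _)
  -- `1 / γ₁ = M ^ 2` and `1 / γ₂ = 2 M K`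
  have h1 : M + 1 / P.gamma1 ≤ 2 * B := by
    rw [hgamma1, one_div_one_div]
    linarith [le_max_right (2 * (M : ℝ) * K) ((M : ℝ) ^ 2)]
  have h2 : M + 1 / P.gamma2 ≤ 2 * B := by
    rw [hgamma2, one_div_one_div]
    linarith [le_max_left (2 * (M : ℝ) * K) ((M : ℝ) ^ 2)]
  have h3 : Real.logb 2 (1 + ((K + n + 1 : ℕ) : ℝ) / (P.lam * d)) ≤
      Real.logb 2 (1 + U / (P.lam * d)) :=
    Real.logb_le_logb_of_le one_lt_two (by positivity) (by gcongr)
  have h4 : Real.logb 2 ((K + n + 1 : ℕ) : ℝ) ≤ Real.logb 2 U :=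
    Real.logb_le_logb_of_le one_lt_two (by linarith) hU
  have h5 : 0 ≤ Real.logb 2 (1 + ((K + n + 1 : ℕ) : ℝ) / (P.lam * d)) :=
    Real.logb_nonneg one_lt_two (le_add_of_nonneg_right (by positivity))
  have h6 : 0 ≤ Real.logb 2 ((K + n + 1 : ℕ) : ℝ) := Real.logb_nonneg one_lt_two hn1
  have hB0 : 0 ≤ B := by linarith
  calc 2 * ((M + 1 / P.gamma1) * d * Real.logb 2 (1 + ((K + n + 1 : ℕ) : ℝ) / (P.lam * d)) +
        (M + 1 / P.gamma2) * Real.logb 2 ((K + n + 1 : ℕ) : ℝ))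
      ≤ 2 * (2 * B * d * Real.logb 2 (1 + U / (P.lam * d)) + 2 * B * Real.logb 2 U) := by
        gcongr
    _ = _ := by ring
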